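/- All graphs are finite and simple. Let $T$ be a tree with vertex set $V(T)$. For $A \subseteq V(T)$ let $e(A)$ be the number of edges of $T$ with both endpoints in $A$ and $d(A)$ the number of edges of $T$ with exactly one endpoint in $A$. The \emph{generalized degree polynomial} of $T$ is $$\mathbf{G}_T(x,y,z) = \sum_{A \subseteq V(T)} x^{|A|} y^{d(A)} z^{e(A)},$$ and the \emph{chromatic symmetric function} of $T$ is $\mathbf{X}_T = \sum_{\kappa} \prod_{v \in V(T)} x_{\kappa(v)}$, where $\kappa$ ranges over the proper colorings $V(T) \to \mathbb{Z}_{>0}$. For a tree $D$ whose vertices $u$ are labeled with positive integers $a_u$, the \emph{degree embedding number} $N_D(T)$ is the number of subtrees $T' \subseteq T$ for which there is a graph isomorphism $\varphi \colon D \to T'$ with $a_u = \deg_T(\varphi(u))$ for all $u \in V(D)$. For integers $d, \ell \ge 0$, let $L_{d,\ell}(T)$ be the number of vertices of $T$ of degree $d$ that are adjacent to exactly $\ell$ leaves (vertices of degree $1$). \textbf{Theorem.} The generalized degree polynomial $\mathbf{G}_T$, and hence also the chromatic symmetric function $\mathbf{X}_T$, determines $N_D(T)$ for each of the following labeled trees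 $D$; that is, if $T_1, T_2$ are trees with $\mathbf{G}_{T_1} = \mathbf{G}_{T_2}$ or $\mathbf{X}_{T_1} = \mathbf{X}_{T_2}$, then $N_D(T_1) = N_D(T_2)$ when $D$ is (i) a path of order $2$ (with any positive labels $a, b$); (ii) a path of order $3$ with all vertex labels equal; (iii) a path of order $3$ with vertex labels $a, a, b$ in that order, where $b \ge 2a$; (iv) a path (of any order $m \ge 1$) in which all vertices are labeled $2$; (v) a star with center labeled $d \ge 1$ and $k \ge 0$ outer vertices, all labeled $1$. Moreover, in the same sense, $\mathbf{G}_T$ and $\mathbf{X}_T$ each determine all the numbers $L_{d,\ell}(T)$. This is equivalent to part (v): writing $\star_{d,k}$ for the labeled star in (v), for any two trees $T_1, T_2$ and any $d \ge 1$ one has $N_{\star_{d,k}}(T_1) = N_{\star_{d,k}}(T_2)$ for all $k \ge 0$ if and only if $L_{d,\ell}(T_1) = L_{d,\ell}(T_2)$ for all $\ell \ge 0$. -/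

import Mathlib

open SimpleGraph

/-- The number `e(A)` of internal edges of `A`: edges of `T` with both endpoints in `A`. -/
def internalEdgeCount {V : Type*} [Fintype V] [DecidableEq V] (T : SimpleGraph V)
    [DecidableRel T.Adj] (A : Finset V) : ℕ :=
  (T.edgeFinset.filter (fun e => ∀ v ∈ e, v ∈ A)).card

/-- The number `d(A)` of boundary edges of `A`: edges of `T` with exactly one endpoint in `A`
(one endpoint in `A` and the other one outside `A`). -/
def boundaryEdgeCount {V : Type*} [Fintype V] [DecidableEq V] (T : SimpleGraph V)
    [DecidableRel T.Adj] (A : Finset V) : ℕ :=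
  (T.edgeFinset.filter (fun e => (∃ v ∈ e, v ∈ A) ∧ ∃ v ∈ e, v ∉ A)).card

/-- The generalized degree polynomial `∑ A ⊆ V, x ^ |A| * y ^ d(A) * z ^ e(A)`, where
`x, y, z` are the variables `X 0, X 1, X 2`. -/
noncomputable def generalizedDegreePolynomial {V : Type*} [Fintype V] [DecidableEq V]
    (T : SimpleGraph V) [DecidableRel T.Adj] : MvPolynomial (Fin 3) ℚ :=
  ∑ A : Finset V, MvPolynomial.X 0 ^ A.card * MvPolynomial.X 1 ^ boundaryEdgeCount T A *
    MvPolynomial.X 2 ^ internalEdgeCount T A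

/-- Stanley's chromatic symmetric function `∑ κ, ∏ v, x_{κ v}`, the sum being over the proper
colorings `κ` with positive integers, as a formal power series in the variables `x_1, x_2, …`:
the coefficient of the monomial `x ^ m` is the number of proper colorings `κ`
with `∏ v, x_{κ v} = x ^ m`. -/
noncomputable def chromaticSymmetricFunction {V : Type*} [Fintype V] (T : SimpleGraph V) :
    MvPowerSeries ℕ+ ℚ :=
  fun m => (Set.ncard {κ : T.Coloring ℕ+ | ∑ v, Finsupp.single (κ v) 1 = m} : ℚ)

/-- The degree embedding number `N_D(T)` of a tree `D` with vertex labels `a`: the number of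
subtrees `T'` of `T` for which there is an isomorphism `φ : D → T'` such that
`a u` is the degree in `T` of `φ u`, for every vertex `u` of `D`. -/
noncomputable def degreeEmbeddingNumber {W V : Type*} [Fintype V] (D : SimpleGraph W) (a : W → ℕ)
    (T : SimpleGraph V) [DecidableRel T.Adj] : ℕ :=
  Set.ncard {T' : T.Subgraph | T'.coe.IsTree ∧
    ∃ φ : D ≃g T'.coe, ∀ u : W, a u = T.degree (φ u : V)}

/-- `N_{a_1, …, a_m}(T)`: the degree embedding number of the path of order `m` whose vertices are
labeled `a_1, …, a_m` in that order. -/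
noncomputable def pathEmbeddingNumber {V : Type*} [Fintype V] {m : ℕ} (a : Fin m → ℕ)
    (T : SimpleGraph V) [DecidableRel T.Adj] : ℕ :=
  degreeEmbeddingNumber (pathGraph m) a T

/-- The degree embedding number of the star whose center is labeled `d` and which has `k` outer
vertices, all labeled `1`. -/
noncomputable def starEmbeddingNumber {V : Type*} [Fintype V] (d k : ℕ)
    (T : SimpleGraph V) [DecidableRel T.Adj] : ℕ :=
  degreeEmbeddingNumber (starGraph (0 : Fin (k + 1))) (Fin.cons d (fun _ : Fin k => 1)) T

/-- `ℓ(v)`: the number of leaves adjacent to `v`. -/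
def adjacentLeafCount {V : Type*} [Fintype V] (T : SimpleGraph V) [DecidableRel T.Adj]
    (v : V) : ℕ :=
  ((T.neighborFinset v).filter (fun w => T.degree w = 1)).card

/-- `L_{d,ℓ}(T)`: the number of vertices of degree `d` that are adjacent to exactly `ℓ` leaves. -/
def leafAdjacencyNumber {V : Type*} [Fintype V] (T : SimpleGraph V) [DecidableRel T.Adj]
    (d l : ℕ) : ℕ :=
  (Finset.univ.filter (fun v => T.degree v = d ∧ adjacentLeafCount T v = l)).card

/-! Everything is read off from the joint distribution of (|A|, d(A), e(A)), the profile. The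
generalized degree polynomial is its generating function. For the chromatic symmetric function,
color a tree of order n with disjoint palettes of sizes p and q, using the first exactly k times. A
forest with m vertices and e edges has p^m (1 - 1/p)^e proper p-colorings, so the count is p^k
q^(n-k) times the sum over |A| = k of (1 - 1/p)^e(A) (1 - 1/q)^e(Aᶜ) (`card_colorings_union`).
Varying p and q separates the exponents, and d(A) = n - 1 - e(A) - e(Aᶜ).

Since d(A) + 2e(A) is the degree sum over A, subsets may be weighted by products of x y^deg(v).
After normalization A behaves like a random set containing the vertices independently, a vertex of
degree d with formal probability p_d = x y^d / (1 + x y^d), and the profile determines the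
expectation of any function of e(A) (`sum_prod_fugacity_eq`). Put x = (ε - 1) / y^a and let ε → 0:
p_a has a simple pole, every other p_d stays finite, and so pole orders filter the degrees.

Paths of orders 2 and 3 come from the first two moments of e(A). The leading pole counts the paths
with all labels a. The next order gives ∑ δ_d p_d = 0 at ε = 0, over d ≠ a, with δ_d the difference
between the two trees of the counts for (a, d) or (a, a, d). With L_k = y^k / (1 - y^k), there
p_{a+k} = -L_k and p_{a-k} = 1 + L_k, so independence of the L_k forces δ_{a+k} = δ_{a-k}
(`coefficient_reflect`). For edges, induction on a finishes; for (a, a, b) with b ≥ 2a the reflected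
label 2a - b is not positive.

For paths labeled 2, the expectation of t^e(A) with t = 1 + φ ε² tends to the matching polynomial at
φ of the subgraph induced on degree a (`tendsto_sum_edge_subsets`). For a = 2 this is a linear
forest. The square of its matching polynomial is a product over its directed subpaths, a subpath of
order j + 2 contributing a factor that begins 1 ± X^(j+1), by a Cassini identity. Distinct leading
exponents make the multiplicities unique (`exponent_eq_of_prod_pow_eq`).

For leaves, take a = 1 and t = (1 - εh) / (1 - ε). Summing out the leaves and letting ε → 0 leaves
the product of 1 - y^(d-1) h^ℓ over the nonleaves (`prod_nonleaf_eq`), which determines all pairs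
(d, ℓ). Stars and leaf adjacency numbers are related by a triangular system of falling factorials.
-/

/-- The multiset of triples `(|A|, d(A), e(A))` over all vertex subsets `A`. -/
def subsetProfile {V : Type*} [Fintype V] [DecidableEq V] (T : SimpleGraph V)
    [DecidableRel T.Adj] : Multiset (ℕ × ℕ × ℕ) :=
  (Finset.univ : Finset (Finset V)).val.map
    (fun A => (A.card, boundaryEdgeCount T A, internalEdgeCount T A))

/-! ### The generalized degree polynomial as generating function of the profile -/

theorem coeff_generalizedDegreePolynomial {V : Type*} [Fintype V] [DecidableEq V]
    (T : SimpleGraph V) [DecidableRel T.Adj] (a b c : ℕ) :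
    MvPolynomial.coeff (Finsupp.single 0 a + Finsupp.single 1 b + Finsupp.single 2 c)
      (generalizedDegreePolynomial T) = (subsetProfile T).count (a, b, c) := by
  classical
  have h : ∀ A : Finset V, (MvPolynomial.X 0 ^ A.card * MvPolynomial.X 1 ^ boundaryEdgeCount T A *
      MvPolynomial.X 2 ^ internalEdgeCount T A : MvPolynomial (Fin 3) ℚ) =
      MvPolynomial.monomial (Finsupp.single 0 A.card +
        Finsupp.single 1 (boundaryEdgeCount T A) +
        Finsupp.single 2 (internalEdgeCount T A)) 1 := by
    intro A
    simp [MvPolynomial.X_pow_eq_monomial, MvPolynomial.monomial_mul]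
  have key : ∀ a b c a' b' c' : ℕ,
      ((Finsupp.single 0 a' + Finsupp.single 1 b' + Finsupp.single 2 c' : Fin 3 →₀ ℕ) =
        Finsupp.single 0 a + Finsupp.single 1 b + Finsupp.single 2 c) ↔
      (a, b, c) = (a', b', c') := by
    intro a b c a' b' c'
    constructor
    · intro h
      have h0 := DFunLike.congr_fun h 0
      have h1 := DFunLike.congr_fun h 1
      have h2 := DFunLike.congr_fun h 2
      simp at h0 h1 h2
      simp [h0, h1, h2]
    · intro h
      simp only [Prod.mk.injEq] at h
      obtain ⟨rfl, rfl, rfl⟩ := h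
      rfl
  rw [generalizedDegreePolynomial, MvPolynomial.coeff_sum]
  simp only [h, MvPolynomial.coeff_monomial, key]
  rw [subsetProfile, Multiset.count_map, Finset.sum_boole]
  rfl

theorem subsetProfile_eq_of_generalizedDegreePolynomial_eq {V₁ V₂ : Type*}
    [Fintype V₁] [DecidableEq V₁] [Fintype V₂] [DecidableEq V₂]
    {T₁ : SimpleGraph V₁} [DecidableRel T₁.Adj] {T₂ : SimpleGraph V₂} [DecidableRel T₂.Adj]
    (h : generalizedDegreePolynomial T₁ = generalizedDegreePolynomial T₂) :
    subsetProfile T₁ = subsetProfile T₂ := by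
  ext ⟨a, b, c⟩
  have := coeff_generalizedDegreePolynomial T₁ a b c
  rw [h, coeff_generalizedDegreePolynomial] at this
  exact_mod_cast this.symm

/-- A sum over vertex subsets of a function of `(|A|, d(A), e(A))` depends only on the profile. -/
theorem sum_subsets_eq_of_subsetProfile_eq {V₁ V₂ R : Type*} [AddCommMonoid R]
    [Fintype V₁] [DecidableEq V₁] [Fintype V₂] [DecidableEq V₂]
    {T₁ : SimpleGraph V₁} [DecidableRel T₁.Adj] {T₂ : SimpleGraph V₂} [DecidableRel T₂.Adj]
    (h : subsetProfile T₁ = subsetProfile T₂) (φ : ℕ → ℕ → ℕ → R) :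
    ∑ A : Finset V₁, φ A.card (boundaryEdgeCount T₁ A) (internalEdgeCount T₁ A) =
      ∑ A : Finset V₂, φ A.card (boundaryEdgeCount T₂ A) (internalEdgeCount T₂ A) := by
  have := congrArg (fun m => (m.map (fun t : ℕ × ℕ × ℕ => φ t.1 t.2.1 t.2.2)).sum) h
  simp only [subsetProfile, Multiset.map_map] at this
  exact this

/-! ### Pendant vertices and degree sums -/

/-- The component of `a` is a nontrivial tree and so has a vertex of degree one. Both inductions on
forests, for colorings and for matchings, remove such a vertex or its edge. -/
theorem exists_existsUnique_adj_of_isAcyclic {V : Type*} [Finite V] {G : SimpleGraph V}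
    (hG : G.IsAcyclic) {a b : V} (hab : G.Adj a b) : ∃ v, ∃! w, G.Adj v w := by
  classical
  have := Fintype.ofFinite V
  set c := G.connectedComponentMk a
  have ht := hG.isTree_connectedComponent c
  have ha : a ∈ c := rfl
  have hb : b ∈ c := ConnectedComponent.sound hab.symm.reachable
  have : Nontrivial c := ⟨⟨⟨a, ha⟩, ⟨b, hb⟩, by simpa using hab.ne⟩⟩
  obtain ⟨v, hv⟩ := ht.exists_vert_degree_one_of_nontrivial
  obtain ⟨w, hw, hu⟩ := degree_eq_one_iff_existsUnique_adj.mp hv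
  refine ⟨v, w, hw, fun z hz => ?_⟩
  have hz' : z ∈ c := by
    have h1 : G.connectedComponentMk v = c := v.2
    exact (ConnectedComponent.sound hz.symm.reachable).trans h1
  exact congrArg Subtype.val (hu ⟨z, hz'⟩ hz)

/-- The degree sum over `A` counts internal edges twice and boundary edges once. -/
theorem sum_degree_eq {V : Type*} [Fintype V] [DecidableEq V] (T : SimpleGraph V)
    [DecidableRel T.Adj] (A : Finset V) :
    ∑ v ∈ A, T.degree v = boundaryEdgeCount T A + 2 * internalEdgeCount T A := by
  have h1 : ∀ v ∈ A, T.degree v = ∑ e ∈ T.edgeFinset, if v ∈ e then 1 else 0 := by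
    intro v _
    rw [← card_incidenceFinset_eq_degree, incidenceFinset_eq_filter]
    simp
  rw [Finset.sum_congr rfl h1, Finset.sum_comm, boundaryEdgeCount, internalEdgeCount,
    Finset.card_filter, Finset.card_filter, Finset.mul_sum, ← Finset.sum_add_distrib]
  refine Finset.sum_congr rfl fun e he => ?_
  induction e with | _ u v => ?_
  have huv : u ≠ v := (mem_edgeFinset.mp he : T.Adj u v).ne
  have : ∑ w ∈ A, (if w ∈ s(u, v) then 1 else 0) =
      (if u ∈ A then 1 else 0) + (if v ∈ A then 1 else 0) := by
    rw [← Finset.sum_ite_eq' A u (fun _ => 1), ← Finset.sum_ite_eq' A v (fun _ => 1),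
      ← Finset.sum_add_distrib]
    refine Finset.sum_congr rfl fun w _ => ?_
    by_cases h1 : w = u <;> by_cases h2 : w = v <;> simp_all
  rw [this]
  by_cases hu : u ∈ A <;> by_cases hv : v ∈ A <;> simp [hu, hv]

/-- Replacing d(A) by the degree sum costs nothing and is what allows product weights: unlike d(A),
the degree sum is additive over the vertices of A. -/
theorem sum_subsets_eq {V₁ V₂ R : Type*} [AddCommMonoid R]
    [Fintype V₁] [DecidableEq V₁] [Fintype V₂] [DecidableEq V₂]
    {T₁ : SimpleGraph V₁} [DecidableRel T₁.Adj] {T₂ : SimpleGraph V₂} [DecidableRel T₂.Adj]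
    (h : subsetProfile T₁ = subsetProfile T₂) (φ : ℕ → ℕ → ℕ → R) :
    ∑ A : Finset V₁, φ A.card (∑ v ∈ A, T₁.degree v) (internalEdgeCount T₁ A) =
      ∑ A : Finset V₂, φ A.card (∑ v ∈ A, T₂.degree v) (internalEdgeCount T₂ A) := by
  simp only [sum_degree_eq]
  exact sum_subsets_eq_of_subsetProfile_eq h (fun a b c => φ a (b + 2 * c) c)

theorem card_eq_of_subsetProfile_eq {V₁ V₂ : Type*}
    [Fintype V₁] [DecidableEq V₁] [Fintype V₂] [DecidableEq V₂]
    {T₁ : SimpleGraph V₁} [DecidableRel T₁.Adj] {T₂ : SimpleGraph V₂} [DecidableRel T₂.Adj]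
    (h : subsetProfile T₁ = subsetProfile T₂) : Fintype.card V₁ = Fintype.card V₂ := by
  have := congrArg Multiset.card h
  simp only [subsetProfile, Multiset.card_map, Finset.card_val, Finset.card_univ,
    Fintype.card_finset] at this
  exact Nat.pow_right_injective le_rfl this

theorem card_filter_degree_eq_sum_subsets {V : Type*} [Fintype V] [DecidableEq V]
    (T : SimpleGraph V) [DecidableRel T.Adj] (d : ℕ) :
    (Finset.univ.filter (fun v => T.degree v = d)).card =
      ∑ A : Finset V, (if A.card = 1 ∧ (∑ v ∈ A, T.degree v) = d then 1 else 0) := by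
  rw [← Finset.card_filter]
  refine Finset.card_bij (fun v _ => {v}) ?_ ?_ ?_
  · intro v hv; simpa using hv
  · intro v _ w _ hvw; simpa using hvw
  · intro A hA
    simp only [Finset.mem_filter, Finset.mem_univ, true_and, Finset.card_eq_one] at hA
    obtain ⟨⟨v, rfl⟩, hv⟩ := hA
    exact ⟨v, by simpa using hv, rfl⟩

theorem card_degree_eq {V₁ V₂ : Type*}
    [Fintype V₁] [DecidableEq V₁] [Fintype V₂] [DecidableEq V₂]
    {T₁ : SimpleGraph V₁} [DecidableRel T₁.Adj] {T₂ : SimpleGraph V₂} [DecidableRel T₂.Adj]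
    (h : subsetProfile T₁ = subsetProfile T₂) (d : ℕ) :
    (Finset.univ.filter (fun v => T₁.degree v = d)).card =
      (Finset.univ.filter (fun v => T₂.degree v = d)).card := by
  rw [card_filter_degree_eq_sum_subsets, card_filter_degree_eq_sum_subsets]
  exact sum_subsets_eq h (fun a D _ => if a = 1 ∧ D = d then 1 else 0)

/-! ### From the chromatic symmetric function to the profile -/

/-- The number of proper colorings of a graph with colors from `C`. -/
noncomputable def properColoringCount {V : Type*} (H : SimpleGraph V) (C : Type*) : ℕ :=
  Nat.card {κ : V → C // ∀ u v, H.Adj u v → κ u ≠ κ v}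

/-- Once its only edge is deleted, v is isolated and its color is free, so exactly one in |C| of the
colorings gives v the color of u; the others are the proper colorings of H. The multiplied form also
covers empty C. -/
theorem properColoringCount_mul_card {V C : Type*} [Finite V] [Fintype C] [DecidableEq V]
    {H : SimpleGraph V} {u v : V} (hu : H.Adj v u) (huniq : ∀ w, H.Adj v w → w = u) :
    (properColoringCount H C : ℚ) * Fintype.card C =
      properColoringCount (H.deleteEdges {s(v, u)}) C * (Fintype.card C - 1) := by
  classical
  set H' := H.deleteEdges {s(v, u)} with hH'
  have hne : u ≠ v := hu.ne'
  have hadj : ∀ x y, H.Adj x y ↔ H'.Adj x y ∨ (x = v ∧ y = u) ∨ (x = u ∧ y = v) := by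
    intro x y
    simp only [hH', deleteEdges_adj, Set.mem_singleton_iff, Sym2.eq_iff]
    constructor
    · intro h
      by_cases h' : (x = v ∧ y = u) ∨ (x = u ∧ y = v)
      · exact Or.inr h'
      · exact Or.inl ⟨h, h'⟩
    · rintro (h | ⟨rfl, rfl⟩ | ⟨rfl, rfl⟩)
      · exact h.1
      · exact hu
      · exact hu.symm
  have hiso : ∀ x y, H'.Adj x y → x ≠ v ∧ y ≠ v := by
    intro x y h
    simp only [hH', deleteEdges_adj, Set.mem_singleton_iff, Sym2.eq_iff] at h
    constructor
    · rintro rfl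
      exact h.2 (Or.inl ⟨rfl, huniq _ h.1⟩)
    · rintro rfl
      exact h.2 (Or.inr ⟨huniq _ h.1.symm, rfl⟩)
  have hupd : ∀ (κ : V → C) (c : C), (∀ x y, H'.Adj x y → κ x ≠ κ y) →
      ∀ x y, H'.Adj x y → Function.update κ v c x ≠ Function.update κ v c y := by
    intro κ c hκ x y h
    rw [Function.update_of_ne (hiso x y h).1, Function.update_of_ne (hiso x y h).2]
    exact hκ x y h
  have h1 : properColoringCount H' C = properColoringCount H C +
      Nat.card {κ : {κ : V → C // ∀ x y, H'.Adj x y → κ x ≠ κ y} // κ.1 v = κ.1 u} := by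
    rw [add_comm, properColoringCount, properColoringCount,
      ← Nat.card_congr (Equiv.sumCompl (fun κ : {κ : V → C // ∀ x y, H'.Adj x y → κ x ≠ κ y} =>
        κ.1 v = κ.1 u)), Nat.card_sum]
    congr 1
    refine Nat.card_congr
      { toFun := fun κ => ⟨κ.1.1, fun x y h => ?_⟩
        invFun := fun κ => ⟨⟨κ.1, fun x y h => κ.2 x y ((hadj x y).2 (Or.inl h))⟩,
          κ.2 v u hu⟩
        left_inv := fun _ => rfl
        right_inv := fun _ => rfl }
    rcases (hadj x y).1 h with h | ⟨rfl, rfl⟩ | ⟨rfl, rfl⟩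
    · exact κ.1.2 x y h
    · exact κ.2
    · exact fun h => κ.2 h.symm
  have h2 : properColoringCount H' C =
      Nat.card {κ : {κ : V → C // ∀ x y, H'.Adj x y → κ x ≠ κ y} // κ.1 v = κ.1 u} *
        Fintype.card C := by
    rw [← Nat.card_eq_fintype_card (α := C), ← Nat.card_prod, properColoringCount]
    refine Nat.card_congr
      { toFun := fun κ => (⟨⟨Function.update κ.1 v (κ.1 u), hupd _ _ κ.2⟩, by simp [hne]⟩, κ.1 v)
        invFun := fun p => ⟨Function.update p.1.1.1 v p.2, hupd _ _ p.1.1.2⟩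
        left_inv := fun κ => by simp
        right_inv := fun p => ?_ }
    obtain ⟨⟨⟨κ, hκ⟩, h⟩, c⟩ := p
    simp only [Function.update_idem, Function.update_self, Prod.mk.injEq, Subtype.mk.injEq,
      and_true]
    rw [Function.update_of_ne hne]
    simp only at h
    rw [← h, Function.update_eq_self]
  rw [h2] at h1
  rw [h2]
  have h1' := congrArg (Nat.cast (R := ℚ)) h1
  push_cast at h1' ⊢
  linear_combination (-(Fintype.card C : ℚ)) * h1'

/-- The number of proper colorings of a finite forest. -/
theorem properColoringCount_of_isAcyclic {V C : Type*} [Fintype V] [Fintype C]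
    {H : SimpleGraph V} (hH : H.IsAcyclic) :
    (properColoringCount H C : ℚ) * Fintype.card C ^ H.edgeSet.ncard =
      Fintype.card C ^ Fintype.card V * (Fintype.card C - 1) ^ H.edgeSet.ncard := by
  classical
  induction hn : H.edgeSet.ncard generalizing H with
  | zero =>
    have : H = ⊥ := by
      rw [← edgeSet_eq_empty]
      exact (Set.ncard_eq_zero (Set.toFinite _)).1 hn
    subst this
    simp only [properColoringCount, bot_adj, IsEmpty.forall_iff, implies_true, pow_zero, mul_one]
    rw [Nat.card_congr (Equiv.subtypeUnivEquiv (fun _ => trivial))]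
    simp
  | succ n ih =>
    have hne : H.edgeSet.Nonempty := by
      rw [← Set.ncard_pos (Set.toFinite _)]; omega
    obtain ⟨⟨a, b⟩, hab⟩ := hne
    obtain ⟨v, u, hu, huniq⟩ := exists_existsUnique_adj_of_isAcyclic hH hab
    have hstep := properColoringCount_mul_card (C := C) hu huniq
    have hcard : (H.deleteEdges {s(v, u)}).edgeSet.ncard = n := by
      rw [edgeSet_deleteEdges, Set.ncard_sdiff_singleton_of_mem (by exact hu), hn]
      rfl
    have := ih (hH.anti (deleteEdges_le _)) hcard
    rw [pow_succ, pow_succ]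
    linear_combination (Fintype.card C : ℚ) ^ n * hstep + (Fintype.card C - 1 : ℚ) * this

theorem ncard_edgeSet_comap_val {V : Type*} [Fintype V] [DecidableEq V] (T : SimpleGraph V)
    [DecidableRel T.Adj] (A : Finset V) :
    (T.comap (Subtype.val : {v // v ∈ A} → V)).edgeSet.ncard = internalEdgeCount T A := by
  rw [← Set.ncard_image_of_injective _ (Sym2.map.injective Subtype.val_injective),
    internalEdgeCount, ← Set.ncard_coe_finset]
  congr 1
  ext e
  simp only [Set.mem_image, Finset.coe_filter, Set.mem_ofPred_eq, mem_edgeFinset]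
  constructor
  · rintro ⟨e, he, rfl⟩
    induction e with | _ a b => ?_
    refine ⟨he, ?_⟩
    simp
  · rintro ⟨he, hA⟩
    induction e with | _ a b => ?_
    simp only [Sym2.mem_iff, forall_eq_or_imp, forall_eq] at hA
    exact ⟨s(⟨a, hA.1⟩, ⟨b, hA.2⟩), he, rfl⟩

/-- Disjoint palettes make the edges between A and its complement harmless, so the two sides are
colored independently. -/
theorem card_colorings_split {V : Type*} [Fintype V] [DecidableEq V] (T : SimpleGraph V)
    (A : Finset V) {P Q : Finset ℕ+} (hPQ : Disjoint P Q) :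
    Nat.card {κ : T.Coloring ℕ+ // (∀ v ∈ A, κ v ∈ P) ∧ ∀ v ∈ Aᶜ, κ v ∈ Q} =
      properColoringCount (T.comap (Subtype.val : {v // v ∈ A} → V)) P *
        properColoringCount (T.comap (Subtype.val : {v // v ∈ Aᶜ} → V)) Q := by
  rw [properColoringCount, properColoringCount, ← Nat.card_prod]
  refine Nat.card_congr
    { toFun := fun κ => (⟨fun v => ⟨κ.1 v, κ.2.1 v v.2⟩, fun u v h => ?_⟩,
        ⟨fun v => ⟨κ.1 v, κ.2.2 v v.2⟩, fun u v h => ?_⟩)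
      invFun := fun p => ⟨Coloring.mk (fun v => if h : v ∈ A then (p.1.1 ⟨v, h⟩ : ℕ+)
        else p.2.1 ⟨v, Finset.mem_compl.2 h⟩) ?_, ?_, ?_⟩
      left_inv := ?_
      right_inv := ?_ }
  · have := κ.1.valid h
    simpa [Subtype.ext_iff] using this
  · have := κ.1.valid h
    simpa [Subtype.ext_iff] using this
  · intro u v h
    by_cases hu : u ∈ A <;> by_cases hv : v ∈ A
    · simp only [hu, hv, dite_true]
      exact fun h' => p.1.2 ⟨u, hu⟩ ⟨v, hv⟩ h (Subtype.ext h')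
    · simp only [hu, hv, dite_true, dite_false]
      exact Finset.disjoint_iff_ne.1 hPQ _ (Subtype.prop _) _ (Subtype.prop _)
    · simp only [hu, hv, dite_true, dite_false]
      exact fun h' => Finset.disjoint_iff_ne.1 hPQ _ (Subtype.prop _) _ (Subtype.prop _) h'.symm
    · simp only [hu, hv, dite_false]
      exact fun h' => p.2.2 ⟨u, Finset.mem_compl.2 hu⟩ ⟨v, Finset.mem_compl.2 hv⟩ h (Subtype.ext h')
  · intro v hv
    change (if h : v ∈ A then _ else _) ∈ P
    rw [dif_pos hv]
    exact Subtype.prop _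
  · intro v hv
    change (if h : v ∈ A then _ else _) ∈ Q
    rw [dif_neg (Finset.mem_compl.1 hv)]
    exact Subtype.prop _
  · intro κ
    apply Subtype.ext
    apply DFunLike.ext
    intro v
    change (if h : v ∈ A then _ else _) = _
    split_ifs <;> rfl
  · intro p
    obtain ⟨⟨p, hp⟩, ⟨q, hq⟩⟩ := p
    simp only [Prod.mk.injEq, Subtype.mk.injEq]
    constructor
    · funext v
      apply Subtype.ext
      change (if h : (v : V) ∈ A then _ else _) = _
      rw [dif_pos v.2]
    · funext v
      apply Subtype.ext
      change (if h : (v : V) ∈ A then _ else _) = _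
      rw [dif_neg (Finset.mem_compl.1 v.2)]

theorem card_split_eq {V : Type*} [Fintype V] [DecidableEq V] {T : SimpleGraph V}
    [DecidableRel T.Adj] (hT : T.IsAcyclic)
    (A : Finset V) {P Q : Finset ℕ+} (hPQ : Disjoint P Q) (hP : P.Nonempty) (hQ : Q.Nonempty) :
    (Nat.card {κ : T.Coloring ℕ+ // (∀ v ∈ A, κ v ∈ P) ∧ ∀ v ∈ Aᶜ, κ v ∈ Q} : ℚ) =
      P.card ^ A.card * Q.card ^ (Fintype.card V - A.card) *
        ((1 - 1 / P.card) ^ internalEdgeCount T A * (1 - 1 / Q.card) ^ internalEdgeCount T Aᶜ) := by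
  have hp : (P.card : ℚ) ≠ 0 := by exact_mod_cast hP.card_pos.ne'
  have hq : (Q.card : ℚ) ≠ 0 := by exact_mod_cast hQ.card_pos.ne'
  have h : ∀ (B : Finset V) (R : Finset ℕ+), (R.card : ℚ) ≠ 0 →
      (properColoringCount (T.comap (Subtype.val : {v // v ∈ B} → V)) R : ℚ) =
        R.card ^ B.card * (1 - 1 / R.card) ^ internalEdgeCount T B := by
    intro B R hR
    have := properColoringCount_of_isAcyclic (C := R)
      (hT.of_comap (Function.Embedding.subtype (· ∈ B)))
    simp only [Function.Embedding.coe_subtype, Fintype.card_coe,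
      ncard_edgeSet_comap_val] at this
    rw [one_sub_div hR, div_pow, mul_div_assoc', eq_div_iff (pow_ne_zero _ hR)]
    exact this
  rw [card_colorings_split T A hPQ]
  push_cast
  rw [h A P hp, h Aᶜ Q hq, Finset.card_compl]
  ring

/-- The number of colorings with colors in `P ∪ Q` that use colors of `P` exactly `k` times. -/
theorem card_colorings_union {V : Type*} [Fintype V] [DecidableEq V] {T : SimpleGraph V}
    [DecidableRel T.Adj] (hT : T.IsAcyclic) {P Q : Finset ℕ+} (hPQ : Disjoint P Q)
    (hP : P.Nonempty) (hQ : Q.Nonempty) (k : ℕ) :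
    (Nat.card {κ : T.Coloring ℕ+ // (∀ v, κ v ∈ P ∪ Q) ∧
        (Finset.univ.filter (fun v => κ v ∈ P)).card = k} : ℚ) =
      P.card ^ k * Q.card ^ (Fintype.card V - k) *
        ∑ A ∈ Finset.univ.filter (fun A : Finset V => A.card = k),
          ((1 - 1 / P.card : ℚ) ^ internalEdgeCount T A *
            (1 - 1 / Q.card) ^ internalEdgeCount T Aᶜ) := by
  have hfin : ∀ A : {A : Finset V // A.card = k},
      Finite {κ : T.Coloring ℕ+ // (∀ v ∈ A.1, κ v ∈ P) ∧ ∀ v ∈ A.1ᶜ, κ v ∈ Q} := by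
    intro A
    refine Finite.of_injective
      (β := V → (P ∪ Q : Finset ℕ+)) (fun κ v => ⟨κ.1 v, ?_⟩) ?_
    · by_cases hv : v ∈ A.1
      · exact Finset.mem_union_left _ (κ.2.1 v hv)
      · exact Finset.mem_union_right _ (κ.2.2 v (Finset.mem_compl.2 hv))
    · intro κ κ' h
      apply Subtype.ext
      apply DFunLike.ext
      intro v
      exact congrArg Subtype.val (congrFun h v)
  have hmem : ∀ (A : Finset V) (κ : T.Coloring ℕ+),
      ((∀ v ∈ A, κ v ∈ P) ∧ ∀ v ∈ Aᶜ, κ v ∈ Q) ↔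
        (∀ v, κ v ∈ P ∪ Q) ∧ Finset.univ.filter (fun v => κ v ∈ P) = A := by
    intro A κ
    constructor
    · rintro ⟨h1, h2⟩
      refine ⟨fun v => ?_, ?_⟩
      · by_cases hv : v ∈ A
        · exact Finset.mem_union_left _ (h1 v hv)
        · exact Finset.mem_union_right _ (h2 v (Finset.mem_compl.2 hv))
      · ext v
        simp only [Finset.mem_filter, Finset.mem_univ, true_and]
        refine ⟨fun h => ?_, h1 v⟩
        by_contra hv
        exact Finset.disjoint_left.1 hPQ h (h2 v (Finset.mem_compl.2 hv))
    · rintro ⟨h1, rfl⟩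
      refine ⟨fun v hv => by simpa using hv, fun v hv => ?_⟩
      have := h1 v
      simp only [Finset.mem_compl, Finset.mem_filter, Finset.mem_univ, true_and] at hv
      rw [Finset.mem_union] at this
      exact this.resolve_left hv
  have h : Nat.card {κ : T.Coloring ℕ+ // (∀ v, κ v ∈ P ∪ Q) ∧
        (Finset.univ.filter (fun v => κ v ∈ P)).card = k} =
      Nat.card (Σ A : {A : Finset V // A.card = k},
        {κ : T.Coloring ℕ+ // (∀ v ∈ A.1, κ v ∈ P) ∧ ∀ v ∈ A.1ᶜ, κ v ∈ Q}) := by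
    refine Nat.card_congr
      { toFun := fun κ => ⟨⟨_, κ.2.2⟩, κ.1, (hmem _ _).2 ⟨κ.2.1, rfl⟩⟩
        invFun := fun p => ⟨p.2.1, ((hmem _ _).1 p.2.2).1, ?_⟩
        left_inv := fun _ => rfl
        right_inv := ?_ }
    · rw [((hmem _ _).1 p.2.2).2]
      exact p.1.2
    · rintro ⟨⟨A, hA⟩, κ, hκ⟩
      have := ((hmem _ _).1 hκ).2
      subst this
      rfl
  rw [h, Nat.card_sigma]
  push_cast
  rw [Finset.mul_sum, Finset.sum_subtype (p := fun A : Finset V => A.card = k) _ (by simp)]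
  refine Finset.sum_congr rfl fun A _ => ?_
  rw [card_split_eq hT A.1 hPQ hP hQ, A.2]

/-- Power sums of the exponents over an infinite set determine the weights of the exponents. -/
theorem sum_filter_eq_of_forall_sum_pow_eq {ι₁ ι₂ : Type*} {s₁ : Finset ι₁} {s₂ : Finset ι₂}
    {i₁ : ι₁ → ℕ} {i₂ : ι₂ → ℕ} {c₁ : ι₁ → ℚ} {c₂ : ι₂ → ℚ} {S : Set ℚ} (hS : S.Infinite)
    (h : ∀ x ∈ S, ∑ A ∈ s₁, x ^ i₁ A * c₁ A = ∑ A ∈ s₂, x ^ i₂ A * c₂ A) (i : ℕ) :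
    ∑ A ∈ s₁.filter (fun A => i₁ A = i), c₁ A = ∑ A ∈ s₂.filter (fun A => i₂ A = i), c₂ A := by
  have hp : (∑ A ∈ s₁, Polynomial.X ^ i₁ A * Polynomial.C (c₁ A) : Polynomial ℚ) =
      ∑ A ∈ s₂, Polynomial.X ^ i₂ A * Polynomial.C (c₂ A) := by
    refine Polynomial.eq_of_infinite_eval_eq _ _ (hS.mono fun x hx => ?_)
    change Polynomial.eval x _ = Polynomial.eval x _
    rw [Polynomial.eval_finsetSum, Polynomial.eval_finsetSum]
    simpa only [Polynomial.eval_mul, Polynomial.eval_pow, Polynomial.eval_X, Polynomial.eval_C]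
      using h x hx
  have := congrArg (fun p => Polynomial.coeff p i) hp
  simpa [Polynomial.finsetSum_coeff, Polynomial.coeff_mul_C, Polynomial.coeff_X_pow,
    Finset.sum_filter, eq_comm] using this

theorem infinite_range_one_sub_inv :
    (Set.range (fun r : ℕ => (1 - 1 / ((r + 1 : ℕ) : ℚ)))).Infinite := by
  refine Set.infinite_range_of_injective fun r s h => ?_
  simp only [one_div, sub_right_inj, inv_inj] at h
  have := Nat.cast_injective h
  omega

/-- Needed because `Set.ncard` is 0 on infinite sets: equal coefficients give bijections of fibers
only once the fibers are known to be finite. -/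
theorem finite_colorings_monomial {V : Type*} [Fintype V] (T : SimpleGraph V) (m : ℕ+ →₀ ℕ) :
    Finite {κ : T.Coloring ℕ+ // ∑ v, Finsupp.single (κ v) 1 = m} := by
  classical
  refine Finite.of_injective (β := V → m.support) (fun κ v => ⟨κ.1 v, ?_⟩) ?_
  · obtain ⟨κ, rfl⟩ := κ
    rw [Finsupp.mem_support_iff, Finsupp.finsetSum_apply]
    refine (Finset.sum_pos' (fun _ _ => Nat.zero_le _) ⟨v, Finset.mem_univ _, ?_⟩).ne'
    simp
  · intro κ κ' h
    apply Subtype.ext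
    apply DFunLike.ext
    intro v
    exact congrArg Subtype.val (congrFun h v)

/-- Fiberwise bijections over the monomials glue to one bijection that preserves how often each
color is used. Any count of colorings expressed through color multiplicities can then be
transported. -/
theorem exists_coloring_equiv_of_chromaticSymmetricFunction_eq {V₁ V₂ : Type*}
    [Fintype V₁] [Fintype V₂] {T₁ : SimpleGraph V₁} {T₂ : SimpleGraph V₂}
    (h : chromaticSymmetricFunction T₁ = chromaticSymmetricFunction T₂) :
    ∃ e : T₁.Coloring ℕ+ ≃ T₂.Coloring ℕ+, ∀ κ,
      ∑ v, Finsupp.single (e κ v) 1 = (∑ v, Finsupp.single (κ v) 1 : ℕ+ →₀ ℕ) := by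
  have he : ∀ m, Nonempty ({κ : T₁.Coloring ℕ+ // ∑ v, Finsupp.single (κ v) 1 = m} ≃
      {κ : T₂.Coloring ℕ+ // ∑ v, Finsupp.single (κ v) 1 = m}) := fun m => by
    have := finite_colorings_monomial T₁ m
    have := finite_colorings_monomial T₂ m
    have hm := congrFun h m
    simp only [chromaticSymmetricFunction, Nat.cast_inj] at hm
    have hm' : Nat.card {κ : T₁.Coloring ℕ+ // ∑ v, Finsupp.single (κ v) 1 = m} =
      Nat.card {κ : T₂.Coloring ℕ+ // ∑ v, Finsupp.single (κ v) 1 = m} := hm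
    exact ⟨(Finite.equivFin _).trans ((finCongr hm').trans (Finite.equivFin _).symm)⟩
  exact ⟨Equiv.ofFiberEquiv (f := fun κ : T₁.Coloring ℕ+ => ∑ v, Finsupp.single (κ v) 1)
    (g := fun κ : T₂.Coloring ℕ+ => ∑ v, Finsupp.single (κ v) 1) fun m => (he m).some,
    fun κ => Equiv.ofFiberEquiv_map (f := fun κ : T₁.Coloring ℕ+ => ∑ v, Finsupp.single (κ v) 1)
    (g := fun κ : T₂.Coloring ℕ+ => ∑ v, Finsupp.single (κ v) 1) _ κ⟩

theorem sum_filter_coloring_monomial {V : Type*} [Fintype V] {T : SimpleGraph V}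
    (κ : T.Coloring ℕ+) (P : Finset ℕ+) :
    ∑ i ∈ P, (∑ v, Finsupp.single (κ v) 1 : ℕ+ →₀ ℕ) i =
      (Finset.univ.filter (fun v => κ v ∈ P)).card := by
  simp only [Finsupp.finsetSum_apply]
  rw [Finset.sum_comm, Finset.card_filter]
  refine Finset.sum_congr rfl fun v _ => ?_
  simp [Finsupp.single_apply]

theorem boundaryEdgeCount_add_internalEdgeCount {V : Type*} [Fintype V] [DecidableEq V]
    (T : SimpleGraph V) [DecidableRel T.Adj] (A : Finset V) :
    boundaryEdgeCount T A + internalEdgeCount T A + internalEdgeCount T Aᶜ =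
      T.edgeFinset.card := by
  rw [boundaryEdgeCount, internalEdgeCount, internalEdgeCount, Finset.card_filter,
    Finset.card_filter, Finset.card_filter, Finset.card_eq_sum_ones, ← Finset.sum_add_distrib,
    ← Finset.sum_add_distrib]
  refine Finset.sum_congr rfl fun e he => ?_
  induction e with | _ u v => ?_
  by_cases hu : u ∈ A <;> by_cases hv : v ∈ A <;> simp [hu, hv]

/-- The chromatic symmetric function of a tree determines its generalized degree polynomial. -/
theorem subsetProfile_eq_of_chromaticSymmetricFunction_eq {V₁ V₂ : Type*}
    [Fintype V₁] [DecidableEq V₁] [Fintype V₂] [DecidableEq V₂]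
    {T₁ : SimpleGraph V₁} [DecidableRel T₁.Adj] {T₂ : SimpleGraph V₂} [DecidableRel T₂.Adj]
    (hT₁ : T₁.IsTree) (hT₂ : T₂.IsTree)
    (h : chromaticSymmetricFunction T₁ = chromaticSymmetricFunction T₂) :
    subsetProfile T₁ = subsetProfile T₂ := by
  obtain ⟨e, he⟩ := exists_coloring_equiv_of_chromaticSymmetricFunction_eq h
  have hP : ∀ κ (P : Finset ℕ+), (Finset.univ.filter (fun v => e κ v ∈ P)).card =
      (Finset.univ.filter (fun v => κ v ∈ P)).card := by
    intro κ P
    rw [← sum_filter_coloring_monomial, ← sum_filter_coloring_monomial, he]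
  have hcard : Fintype.card V₁ = Fintype.card V₂ := by
    -- Some coloring must be at hand, and an injective one is always proper. On a palette containing
    -- the images of κ and of e κ, `hP` counts all vertices on both sides.
    let κ : T₁.Coloring ℕ+ := Coloring.mk (fun v => (Fintype.equivFin V₁ v).1.succPNat) (by
      intro u v huv h
      rw [Nat.succPNat_injective.eq_iff, Fin.val_injective.eq_iff,
        (Fintype.equivFin V₁).injective.eq_iff] at h
      exact huv.ne h)
    have := hP κ (Finset.univ.image κ ∪ Finset.univ.image (e κ))
    simpa using this.symm
  have hall : ∀ κ (P : Finset ℕ+), (∀ v, e κ v ∈ P) ↔ ∀ v, κ v ∈ P := by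
    intro κ P
    have h1 := Finset.card_filter_eq_iff (s := Finset.univ) (p := fun v => κ v ∈ P)
    have h2 := Finset.card_filter_eq_iff (s := Finset.univ) (p := fun v => e κ v ∈ P)
    rw [hP κ P, Finset.card_univ, ← hcard] at h2
    rw [Finset.card_univ] at h1
    simpa using h2.symm.trans h1
  have hcount : ∀ (k r s : ℕ),
      ∑ A ∈ Finset.univ.filter (fun A : Finset V₁ => A.card = k),
          ((1 - 1 / (r + 1 : ℕ) : ℚ) ^ internalEdgeCount T₁ A *
            (1 - 1 / (s + 1 : ℕ)) ^ internalEdgeCount T₁ Aᶜ) =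
      ∑ A ∈ Finset.univ.filter (fun A : Finset V₂ => A.card = k),
          ((1 - 1 / (r + 1 : ℕ) : ℚ) ^ internalEdgeCount T₂ A *
            (1 - 1 / (s + 1 : ℕ)) ^ internalEdgeCount T₂ Aᶜ) := by
    intro k r s
    let P : Finset ℕ+ := (Finset.range (r + 1)).image Nat.succPNat
    let Q : Finset ℕ+ := (Finset.Ico (r + 1) (r + 1 + (s + 1))).image Nat.succPNat
    have hPc : P.card = r + 1 := by
      rw [Finset.card_image_of_injective _ Nat.succPNat_injective, Finset.card_range]
    have hQc : Q.card = s + 1 := by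
      rw [Finset.card_image_of_injective _ Nat.succPNat_injective, Nat.card_Ico]; omega
    have hPQ : Disjoint P Q := by
      rw [Finset.disjoint_image Nat.succPNat_injective, Finset.disjoint_left]
      intro i hi hj
      rw [Finset.mem_range] at hi
      rw [Finset.mem_Ico] at hj
      omega
    have hPne : P.Nonempty := Finset.card_pos.1 (by omega)
    have hQne : Q.Nonempty := Finset.card_pos.1 (by omega)
    have h1 := card_colorings_union hT₁.isAcyclic hPQ hPne hQne k
    have h2 := card_colorings_union hT₂.isAcyclic hPQ hPne hQne k
    have h3 : Nat.card {κ : T₁.Coloring ℕ+ // (∀ v, κ v ∈ P ∪ Q) ∧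
          (Finset.univ.filter (fun v => κ v ∈ P)).card = k} =
        Nat.card {κ : T₂.Coloring ℕ+ // (∀ v, κ v ∈ P ∪ Q) ∧
          (Finset.univ.filter (fun v => κ v ∈ P)).card = k} := by
      refine Nat.card_congr (e.subtypeEquiv fun κ => ?_)
      rw [hall, hP]
    rw [h3, h2, hPc, hQc, hcard] at h1
    refine (mul_left_cancel₀ ?_ h1).symm
    positivity
  have hfilter : ∀ k i j : ℕ,
      (Finset.univ.filter (fun A : Finset V₁ => A.card = k ∧ internalEdgeCount T₁ A = i ∧
        internalEdgeCount T₁ Aᶜ = j)).card =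
      (Finset.univ.filter (fun A : Finset V₂ => A.card = k ∧ internalEdgeCount T₂ A = i ∧
        internalEdgeCount T₂ Aᶜ = j)).card := by
    intro k i j
    -- The double generating function is separated one variable at a time: first the exponent i of x
    -- for fixed y, then the exponent j of y. The factor 1 is the coefficient for the second
    -- separation.
    have h1 : ∀ y ∈ Set.range (fun r : ℕ => (1 - 1 / ((r + 1 : ℕ) : ℚ))), _ := fun y hy =>
      sum_filter_eq_of_forall_sum_pow_eq (c₁ := fun A => y ^ internalEdgeCount T₁ Aᶜ * 1)
        (c₂ := fun A => y ^ internalEdgeCount T₂ Aᶜ * 1) infinite_range_one_sub_inv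
        (fun x hx => by
          obtain ⟨r, rfl⟩ := hx
          obtain ⟨s, rfl⟩ := hy
          simpa only [mul_one] using hcount k r s) i
    have h2 := sum_filter_eq_of_forall_sum_pow_eq infinite_range_one_sub_inv h1 j
    simp only [Finset.sum_const, nsmul_eq_mul, mul_one, Nat.cast_inj, Finset.filter_filter,
      and_assoc] at h2
    exact h2
  have hedge : T₁.edgeFinset.card = T₂.edgeFinset.card := by
    have h1 := hT₁.card_edgeFinset
    have h2 := hT₂.card_edgeFinset
    omega
  ext ⟨a, b, c⟩
  rw [subsetProfile, subsetProfile, Multiset.count_map, Multiset.count_map]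
  -- The value of e(Aᶜ) encodes d(A) through the number of edges. Truncated subtraction would
  -- falsify this for b + c above that number, where both multiplicities are 0.
  by_cases hbc : b + c ≤ T₁.edgeFinset.card
  · have := hfilter a c (T₁.edgeFinset.card - b - c)
    refine Eq.trans ?_ (this.trans ?_)
    · change (Finset.univ.filter (fun A : Finset V₁ => (a, b, c) =
        (A.card, boundaryEdgeCount T₁ A, internalEdgeCount T₁ A))).card = _
      congr 1
      refine Finset.filter_congr fun A _ => ?_
      have := boundaryEdgeCount_add_internalEdgeCount T₁ A
      simp only [Prod.mk.injEq]
      omega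
    · change _ = (Finset.univ.filter (fun A : Finset V₂ => (a, b, c) =
        (A.card, boundaryEdgeCount T₂ A, internalEdgeCount T₂ A))).card
      congr 1
      refine Finset.filter_congr fun A _ => ?_
      have := boundaryEdgeCount_add_internalEdgeCount T₂ A
      simp only [Prod.mk.injEq]
      omega
  · rw [Multiset.filter_eq_nil.2, Multiset.filter_eq_nil.2]
    · rfl
    · intro A _ h
      have := boundaryEdgeCount_add_internalEdgeCount T₂ A
      simp only [Prod.mk.injEq] at h
      omega
    · intro A _ h
      have := boundaryEdgeCount_add_internalEdgeCount T₁ A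
      simp only [Prod.mk.injEq] at h
      omega

/-! ### Product weights and independent random subsets -/

/-- Divided by ∏ (1 + w v), this is the probability that U lies in a random set containing each v
independently with probability w v / (1 + w v). The weights may be negative, so the identity is only
formal; it is the expansion of ∏ (w v + [v ∉ U]). -/
theorem sum_superset_prod {V : Type*} [Fintype V] [DecidableEq V] (w : V → ℝ)
    (hw : ∀ v, 1 + w v ≠ 0) (U : Finset V) :
    ∑ A : Finset V, (if U ⊆ A then 1 else 0) * ∏ v ∈ A, w v =
      (∏ v, (1 + w v)) * ∏ v ∈ U, w v / (1 + w v) := by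
  have h1 : (∏ v, (1 + w v)) * ∏ v ∈ U, w v / (1 + w v) =
      ∏ v, (w v + if v ∈ U then 0 else 1) := by
    rw [← Fintype.prod_ite_mem U, ← Finset.prod_mul_distrib]
    refine Finset.prod_congr rfl fun v _ => ?_
    split_ifs
    · rw [mul_div_cancel₀ _ (hw v), add_zero]
    · ring
  rw [h1, Finset.prod_add, Finset.powerset_univ]
  refine Finset.sum_congr rfl fun A _ => ?_
  rw [mul_comm]
  congr 1
  split_ifs with h
  · symm
    refine Finset.prod_eq_one fun v hv => if_neg fun hU => ?_
    exact (Finset.mem_sdiff.1 hv).2 (h hU)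
  · symm
    obtain ⟨v, hU, hA⟩ := Finset.not_subset.1 h
    exact Finset.prod_eq_zero (Finset.mem_sdiff.2 ⟨Finset.mem_univ v, hA⟩) (if_pos hU)

/-- The weight `x y ^ d` of a vertex of degree `d`, normalized by `1 + x y ^ d`. -/
noncomputable def degreeFugacity (x y : ℝ) (d : ℕ) : ℝ := x * y ^ d / (1 + x * y ^ d)

theorem prod_weight {V : Type*} (A : Finset V) (deg : V → ℕ) (x y : ℝ) :
    ∏ v ∈ A, x * y ^ deg v = x ^ A.card * y ^ (∑ v ∈ A, deg v) := by
  rw [Finset.prod_mul_distrib, Finset.prod_const, Finset.prod_pow_eq_pow_sum]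

theorem prod_one_add_weight_eq {V₁ V₂ : Type*}
    [Fintype V₁] [DecidableEq V₁] [Fintype V₂] [DecidableEq V₂]
    {T₁ : SimpleGraph V₁} [DecidableRel T₁.Adj] {T₂ : SimpleGraph V₂} [DecidableRel T₂.Adj]
    (h : subsetProfile T₁ = subsetProfile T₂) (x y : ℝ) :
    ∏ v, (1 + x * y ^ T₁.degree v) = ∏ v, (1 + x * y ^ T₂.degree v) := by
  simp only [Finset.prod_one_add, prod_weight, Finset.powerset_univ]
  exact sum_subsets_eq h (fun a D _ => x ^ a * y ^ D)

/-- If weighted families of vertex sets are counted, inside each `A`, by the same function of the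
number of internal edges, then their fugacity sums agree. -/
theorem sum_prod_fugacity_eq {V₁ V₂ ι₁ ι₂ : Type*}
    [Fintype V₁] [DecidableEq V₁] [Fintype V₂] [DecidableEq V₂]
    {T₁ : SimpleGraph V₁} [DecidableRel T₁.Adj] {T₂ : SimpleGraph V₂} [DecidableRel T₂.Adj]
    (h : subsetProfile T₁ = subsetProfile T₂) {I₁ : Finset ι₁} {I₂ : Finset ι₂}
    {U₁ : ι₁ → Finset V₁} {U₂ : ι₂ → Finset V₂} {c₁ : ι₁ → ℝ} {c₂ : ι₂ → ℝ} (φ : ℕ → ℝ)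
    (h₁ : ∀ A, ∑ i ∈ I₁, c₁ i * (if U₁ i ⊆ A then 1 else 0) = φ (internalEdgeCount T₁ A))
    (h₂ : ∀ A, ∑ i ∈ I₂, c₂ i * (if U₂ i ⊆ A then 1 else 0) = φ (internalEdgeCount T₂ A))
    {x y : ℝ} (hx₁ : ∀ v, 1 + x * y ^ T₁.degree v ≠ 0)
    (hx₂ : ∀ v, 1 + x * y ^ T₂.degree v ≠ 0) :
    ∑ i ∈ I₁, c₁ i * ∏ v ∈ U₁ i, degreeFugacity x y (T₁.degree v) =
      ∑ i ∈ I₂, c₂ i * ∏ v ∈ U₂ i, degreeFugacity x y (T₂.degree v) := by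
  have e₁ : (∏ v, (1 + x * y ^ T₁.degree v)) *
      ∑ i ∈ I₁, c₁ i * ∏ v ∈ U₁ i, degreeFugacity x y (T₁.degree v) =
      ∑ A : Finset V₁, φ (internalEdgeCount T₁ A) * (x ^ A.card * y ^ (∑ v ∈ A, T₁.degree v)) := by
    simp only [← h₁, ← prod_weight, Finset.sum_mul]
    rw [Finset.sum_comm, Finset.mul_sum]
    refine Finset.sum_congr rfl fun i _ => ?_
    simp only [mul_assoc]
    rw [← Finset.mul_sum, sum_superset_prod _ hx₁]
    simp only [degreeFugacity]
    ring
  have e₂ : (∏ v, (1 + x * y ^ T₂.degree v)) *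
      ∑ i ∈ I₂, c₂ i * ∏ v ∈ U₂ i, degreeFugacity x y (T₂.degree v) =
      ∑ A : Finset V₂, φ (internalEdgeCount T₂ A) * (x ^ A.card * y ^ (∑ v ∈ A, T₂.degree v)) := by
    simp only [← h₂, ← prod_weight, Finset.sum_mul]
    rw [Finset.sum_comm, Finset.mul_sum]
    refine Finset.sum_congr rfl fun i _ => ?_
    simp only [mul_assoc]
    rw [← Finset.mul_sum, sum_superset_prod _ hx₂]
    simp only [degreeFugacity]
    ring
  have h0 : ∏ v, (1 + x * y ^ T₁.degree v) ≠ 0 := Finset.prod_ne_zero_iff.2 fun v _ => hx₁ v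
  refine mul_left_cancel₀ h0 ?_
  rw [e₁, prod_one_add_weight_eq h, e₂]
  exact sum_subsets_eq h (fun a D e => φ e * (x ^ a * y ^ D))

/-! ### First and second moments of the number of internal edges -/

/-- The real-valued adjacency indicator. -/
def adjIndicator {V : Type*} (T : SimpleGraph V) [DecidableRel T.Adj] (u v : V) : ℝ :=
  if T.Adj u v then 1 else 0

theorem adjIndicator_comm {V : Type*} (T : SimpleGraph V) [DecidableRel T.Adj] (u v : V) :
    adjIndicator T u v = adjIndicator T v u := by
  simp only [adjIndicator, T.adj_comm u v]

theorem sum_adjIndicator_subset {V : Type*} [Fintype V] [DecidableEq V] (T : SimpleGraph V)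
    [DecidableRel T.Adj] (A : Finset V) :
    ∑ q : V × V, adjIndicator T q.1 q.2 * (if {q.1, q.2} ⊆ A then 1 else 0) =
      2 * (internalEdgeCount T A : ℝ) := by
  classical
  let H : SimpleGraph V :=
    { Adj := fun u v => T.Adj u v ∧ u ∈ A ∧ v ∈ A
      symm := ⟨fun u v h => ⟨h.1.symm, h.2.2, h.2.1⟩⟩
      loopless := ⟨fun u h => h.1.ne rfl⟩ }
  have hE : H.edgeFinset = T.edgeFinset.filter (fun e => ∀ v ∈ e, v ∈ A) := by
    ext e
    induction e with | _ u v => ?_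
    simp [H]
  have h := H.sum_degrees_eq_twice_card_edges
  rw [hE] at h
  rw [internalEdgeCount, ← Nat.cast_ofNat, ← Nat.cast_mul, ← h, Fintype.sum_prod_type]
  push_cast
  refine Finset.sum_congr rfl fun u _ => ?_
  rw [← card_neighborFinset_eq_degree, neighborFinset_eq_filter, Finset.card_filter]
  push_cast
  refine Finset.sum_congr rfl fun v _ => ?_
  by_cases h : T.Adj u v <;> by_cases hu : u ∈ A <;> by_cases hv : v ∈ A <;>
    simp [H, adjIndicator, h, hu, hv, Finset.insert_subset_iff]

theorem sum_adjIndicator_sq_subset {V : Type*} [Fintype V] [DecidableEq V] (T : SimpleGraph V)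
    [DecidableRel T.Adj] (A : Finset V) :
    ∑ q : (V × V) × (V × V), (adjIndicator T q.1.1 q.1.2 * adjIndicator T q.2.1 q.2.2) *
      (if {q.1.1, q.1.2} ∪ {q.2.1, q.2.2} ⊆ A then 1 else 0) =
      (2 * (internalEdgeCount T A : ℝ)) ^ 2 := by
  rw [sq, ← sum_adjIndicator_subset, Finset.sum_mul_sum, Fintype.sum_prod_type]
  refine Finset.sum_congr rfl fun q _ => Finset.sum_congr rfl fun r _ => ?_
  simp only [Finset.union_subset_iff]
  by_cases h1 : {q.1, q.2} ⊆ A <;> by_cases h2 : {r.1, r.2} ⊆ A <;> simp [h1, h2]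

/-- The sum of the product of fugacities over pairs of oriented edges. -/
theorem sum_edge_pairs_eq {V : Type*} [Fintype V] [DecidableEq V] (T : SimpleGraph V)
    [DecidableRel T.Adj] (p : V → ℝ) :
    ∑ q : (V × V) × (V × V), (adjIndicator T q.1.1 q.1.2 * adjIndicator T q.2.1 q.2.2) *
      ∏ v ∈ {q.1.1, q.1.2} ∪ {q.2.1, q.2.2}, p v =
    (∑ u, ∑ v, adjIndicator T u v * (p u * p v)) ^ 2 +
      2 * (∑ u, ∑ v, adjIndicator T u v * (p u * p v - (p u * p v) ^ 2)) +
      4 * ∑ u, ∑ v, ∑ w, adjIndicator T u v * adjIndicator T v w *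
        (if u = w then 0 else p u * (p v * (1 - p v)) * p w) := by
  set a := adjIndicator T with ha
  have hsymm : ∀ u v, a u v = a v u := adjIndicator_comm T
  set F : V → V → ℝ := fun u v => p u * p v - (p u * p v) ^ 2 with hF
  set Q : V → V → V → ℝ := fun u v w => if u = w then 0 else p u * (p v * (1 - p v)) * p w with hQ
  -- Compared with the product for two disjoint edges, overlaps need corrections: F when the edges
  -- coincide (two relative orientations), Q when they share one vertex (four ways). Q vanishes when
  -- its ends agree, so coinciding edges are not corrected twice.
  have hpt : ∀ u v u' v', a u v * a u' v' * ∏ x ∈ {u, v} ∪ {u', v'}, p x =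
      a u v * (p u * p v) * (a u' v' * (p u' * p v')) +
      ((if u' = u then if v' = v then a u v * a u' v' * F u v else 0 else 0) +
      (if u' = v then if v' = u then a u v * a u' v' * F u v else 0 else 0)) +
      ((if u' = u then a u v * a u' v' * Q v u v' else 0) +
      (if u' = v then a u v * a u' v' * Q u v v' else 0) +
      (if v' = u then a u v * a u' v' * Q v u u' else 0) +
      (if v' = v then a u v * a u' v' * Q u v u' else 0)) := by
    intro u v u' v'
    by_cases h1 : T.Adj u v
    swap
    · simp [ha, adjIndicator, h1]
    by_cases h2 : T.Adj u' v'
    swap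
    · simp [ha, adjIndicator, h2]
    have e1 : a u v = 1 := if_pos h1
    have e2 : a u' v' = 1 := if_pos h2
    rw [e1, e2]
    have n1 := h1.ne
    have n2 := h2.ne
    by_cases c1 : u' = u
    · subst c1
      by_cases c2 : v' = v
      · subst c2
        simp [hF, hQ, n1, n1.symm]
        ring
      · have : ({u', v} ∪ {u', v'} : Finset V) = {u', v, v'} := by ext; simp
        rw [this, Finset.prod_insert (by simp [n1, n2]), Finset.prod_pair (Ne.symm c2)]
        simp [hQ, n1, n2.symm, c2, Ne.symm c2]
        ring
    · by_cases c2 : u' = v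
      · subst c2
        by_cases c3 : v' = u
        · subst c3
          have : ({v', u'} ∪ {u', v'} : Finset V) = {v', u'} := by ext; simp; tauto
          rw [this, Finset.prod_pair n1]
          simp [hF, hQ, n1, n1.symm]
          ring
        · have : ({u, u'} ∪ {u', v'} : Finset V) = {u, u', v'} := by ext; simp
          rw [this, Finset.prod_insert (by simp [n1, Ne.symm c3]), Finset.prod_pair n2]
          simp [hQ, c1, c3, Ne.symm c3, n2.symm]
          ring
      · by_cases c3 : v' = u
        · subst c3
          have : ({v', v} ∪ {u', v'} : Finset V) = {v', v, u'} := by ext; simp; tauto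
          rw [this, Finset.prod_insert (by simp [n1, n2.symm]), Finset.prod_pair (Ne.symm c2)]
          simp [hQ, c1, c2, Ne.symm c2, n1]
          ring
        · by_cases c4 : v' = v
          · subst c4
            have : ({u, v'} ∪ {u', v'} : Finset V) = {u, v', u'} := by ext; simp; tauto
            rw [this, Finset.prod_insert (by simp [n1, Ne.symm c1]), Finset.prod_pair n2.symm]
            simp [hQ, c1, c2, Ne.symm c1, c3]
            ring
          · rw [Finset.prod_union, Finset.prod_pair n1, Finset.prod_pair n2]
            · simp [c1, c2, c3, c4]
            · simp [Finset.disjoint_left, Ne.symm c1, Ne.symm c2, Ne.symm c3, Ne.symm c4]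
  have haa : ∀ u v, a u v * a u v = a u v := by
    intro u v
    by_cases h : T.Adj u v <;> simp [ha, adjIndicator, h]
  have hQs : ∀ u v w, Q u v w = Q w v u := by
    intro u v w
    simp only [hQ, eq_comm (a := u)]
    split_ifs <;> ring
  rw [Fintype.sum_prod_type]
  simp only [Fintype.sum_prod_type, hpt, Finset.sum_add_distrib]
  have s0 : ∑ u, ∑ v, ∑ u', ∑ v', a u v * (p u * p v) * (a u' v' * (p u' * p v')) =
      (∑ u, ∑ v, a u v * (p u * p v)) ^ 2 := by
    rw [sq, Finset.sum_mul]
    refine Finset.sum_congr rfl fun u _ => ?_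
    rw [Finset.sum_mul]
    refine Finset.sum_congr rfl fun v _ => ?_
    simp only [Finset.mul_sum]
  have s1 : ∑ u, ∑ v, ∑ u', ∑ v', (if u' = u then if v' = v then a u v * a u' v' * F u v else 0
      else 0) = ∑ u, ∑ v, a u v * F u v := by
    refine Finset.sum_congr rfl fun u _ => Finset.sum_congr rfl fun v _ => ?_
    rw [Finset.sum_comm]
    simp [haa]
  have s2 : ∑ u, ∑ v, ∑ u', ∑ v', (if u' = v then if v' = u then a u v * a u' v' * F u v else 0
      else 0) = ∑ u, ∑ v, a u v * F u v := by
    refine Finset.sum_congr rfl fun u _ => Finset.sum_congr rfl fun v _ => ?_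
    rw [Finset.sum_comm]
    simp [hsymm v u, haa]
  have s3 : ∑ u, ∑ v, ∑ u', ∑ v', (if u' = u then a u v * a u' v' * Q v u v' else 0) =
      ∑ u, ∑ v, ∑ w, a u v * a v w * Q u v w := by
    rw [Finset.sum_comm]
    refine Finset.sum_congr rfl fun v _ => Finset.sum_congr rfl fun u _ => ?_
    rw [Finset.sum_comm]
    simp [hsymm u v]
  have s4 : ∑ u, ∑ v, ∑ u', ∑ v', (if u' = v then a u v * a u' v' * Q u v v' else 0) =
      ∑ u, ∑ v, ∑ w, a u v * a v w * Q u v w := by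
    refine Finset.sum_congr rfl fun v _ => Finset.sum_congr rfl fun u _ => ?_
    rw [Finset.sum_comm]
    simp
  have s5 : ∑ u, ∑ v, ∑ u', ∑ v', (if v' = u then a u v * a u' v' * Q v u u' else 0) =
      ∑ u, ∑ v, ∑ w, a u v * a v w * Q u v w := by
    rw [Finset.sum_comm]
    refine Finset.sum_congr rfl fun v _ => Finset.sum_congr rfl fun u _ =>
      Finset.sum_congr rfl fun w _ => ?_
    simp [hsymm u v, hsymm w u]
  have s6 : ∑ u, ∑ v, ∑ u', ∑ v', (if v' = v then a u v * a u' v' * Q u v u' else 0) =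
      ∑ u, ∑ v, ∑ w, a u v * a v w * Q u v w := by
    refine Finset.sum_congr rfl fun v _ => Finset.sum_congr rfl fun u _ =>
      Finset.sum_congr rfl fun w _ => ?_
    simp [hsymm w u]
  rw [s0, s1, s2, s3, s4, s5, s6]
  ring

/-! ### Grouping edges and paths by their degrees -/

/-- The number of oriented edges whose endpoints have degrees `b`, `c`. -/
def edgeLabelCount {V : Type*} [Fintype V] (T : SimpleGraph V) [DecidableRel T.Adj]
    (b c : ℕ) : ℕ :=
  (Finset.univ.filter (fun q : V × V =>
    T.Adj q.1 q.2 ∧ T.degree q.1 = b ∧ T.degree q.2 = c)).card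

/-- The number of oriented paths of order three whose vertices have degrees `b`, `c`, `d`. -/
def pathLabelCount {V : Type*} [Fintype V] [DecidableEq V] (T : SimpleGraph V)
    [DecidableRel T.Adj] (b c d : ℕ) : ℕ :=
  (Finset.univ.filter (fun q : V × V × V => (T.Adj q.1 q.2.1 ∧ T.Adj q.2.1 q.2.2 ∧ q.1 ≠ q.2.2) ∧
    T.degree q.1 = b ∧ T.degree q.2.1 = c ∧ T.degree q.2.2 = d)).card

theorem sum_adjIndicator_eq_sum_edgeLabelCount {V : Type*} [Fintype V]
    (T : SimpleGraph V) [DecidableRel T.Adj] {N : ℕ} (hN : ∀ v, T.degree v < N)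
    (f : ℕ → ℕ → ℝ) :
    ∑ u, ∑ v, adjIndicator T u v * f (T.degree u) (T.degree v) =
      ∑ b ∈ Finset.range N, ∑ c ∈ Finset.range N, (edgeLabelCount T b c : ℝ) * f b c := by
  rw [← Fintype.sum_prod_type' (f := fun u v => adjIndicator T u v * f (T.degree u) (T.degree v)),
    ← Finset.sum_product' (f := fun b c => (edgeLabelCount T b c : ℝ) * f b c),
    ← Finset.sum_fiberwise_of_maps_to (s := Finset.univ)
      (g := fun q : V × V => (T.degree q.1, T.degree q.2))]
  · refine Finset.sum_congr rfl fun b _ => ?_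
    rw [edgeLabelCount, Finset.card_filter, Finset.sum_filter]
    push_cast
    rw [Finset.sum_mul]
    refine Finset.sum_congr rfl fun q _ => ?_
    by_cases h : (T.degree q.1, T.degree q.2) = b
    · subst h
      simp [adjIndicator]
    · rw [if_neg h, if_neg, zero_mul]
      rintro ⟨-, h1, h2⟩
      exact h (Prod.ext h1 h2)
  · intro q _
    simp [hN]

theorem sum_adjIndicator_eq_sum_pathLabelCount {V : Type*} [Fintype V] [DecidableEq V]
    (T : SimpleGraph V) [DecidableRel T.Adj] {N : ℕ} (hN : ∀ v, T.degree v < N)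
    (f : ℕ → ℕ → ℕ → ℝ) :
    ∑ u, ∑ v, ∑ w, adjIndicator T u v * adjIndicator T v w *
        (if u = w then 0 else f (T.degree u) (T.degree v) (T.degree w)) =
      ∑ b ∈ Finset.range N, ∑ c ∈ Finset.range N, ∑ d ∈ Finset.range N,
        (pathLabelCount T b c d : ℝ) * f b c d := by
  simp only [← Finset.sum_product']
  rw [← Finset.sum_fiberwise_of_maps_to (s := Finset.univ ×ˢ Finset.univ ×ˢ Finset.univ)
      (g := fun q : V × V × V => (T.degree q.1, T.degree q.2.1, T.degree q.2.2))]
  · refine Finset.sum_congr rfl fun b _ => ?_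
    rw [pathLabelCount, Finset.card_filter, Finset.sum_filter, Finset.univ_product_univ,
      Finset.univ_product_univ]
    push_cast
    rw [Finset.sum_mul]
    refine Finset.sum_congr rfl fun q _ => ?_
    by_cases h : (T.degree q.1, T.degree q.2.1, T.degree q.2.2) = b
    · subst h
      by_cases h1 : T.Adj q.1 q.2.1 <;> by_cases h2 : T.Adj q.2.1 q.2.2 <;>
        by_cases h3 : q.1 = q.2.2 <;> simp [adjIndicator, h1, h2, h3]
    · rw [if_neg h, if_neg, zero_mul]
      rintro ⟨-, h1, h2, h3⟩
      exact h (Prod.ext h1 (Prod.ext h2 h3))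
  · intro q _
    simp [hN]

section Relations

variable {V₁ V₂ : Type*} [Fintype V₁] [DecidableEq V₁] [Fintype V₂] [DecidableEq V₂]
  {T₁ : SimpleGraph V₁} [DecidableRel T₁.Adj] {T₂ : SimpleGraph V₂} [DecidableRel T₂.Adj]

/-- The first moment of 2e(A): each oriented edge lies inside A with probability the product of its
two fugacities. -/
theorem sum_edgeLabelCount_fugacity_eq (h : subsetProfile T₁ = subsetProfile T₂) {N : ℕ}
    (hN₁ : ∀ v, T₁.degree v < N) (hN₂ : ∀ v, T₂.degree v < N) {x y : ℝ}
    (hx : ∀ d, 1 + x * y ^ d ≠ 0) :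
    ∑ b ∈ Finset.range N, ∑ c ∈ Finset.range N,
      (edgeLabelCount T₁ b c : ℝ) * (degreeFugacity x y b * degreeFugacity x y c) =
    ∑ b ∈ Finset.range N, ∑ c ∈ Finset.range N,
      (edgeLabelCount T₂ b c : ℝ) * (degreeFugacity x y b * degreeFugacity x y c) := by
  have h1 := sum_prod_fugacity_eq h (φ := fun e => 2 * (e : ℝ))
    (sum_adjIndicator_subset T₁) (sum_adjIndicator_subset T₂)
    (fun v => hx _) (fun v => hx _)
  rw [← sum_adjIndicator_eq_sum_edgeLabelCount T₁ hN₁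
      (fun b c => degreeFugacity x y b * degreeFugacity x y c),
    ← sum_adjIndicator_eq_sum_edgeLabelCount T₂ hN₂
      (fun b c => degreeFugacity x y b * degreeFugacity x y c)]
  have key₁ : ∑ q : V₁ × V₁, adjIndicator T₁ q.1 q.2 *
      ∏ v ∈ {q.1, q.2}, degreeFugacity x y (T₁.degree v) =
      ∑ u, ∑ v, adjIndicator T₁ u v *
        (degreeFugacity x y (T₁.degree u) * degreeFugacity x y (T₁.degree v)) := by
    rw [Fintype.sum_prod_type]
    refine Finset.sum_congr rfl fun u _ => Finset.sum_congr rfl fun v _ => ?_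
    by_cases huv : T₁.Adj u v
    · rw [Finset.prod_pair huv.ne]
    · simp [adjIndicator, huv]
  have key₂ : ∑ q : V₂ × V₂, adjIndicator T₂ q.1 q.2 *
      ∏ v ∈ {q.1, q.2}, degreeFugacity x y (T₂.degree v) =
      ∑ u, ∑ v, adjIndicator T₂ u v *
        (degreeFugacity x y (T₂.degree u) * degreeFugacity x y (T₂.degree v)) := by
    rw [Fintype.sum_prod_type]
    refine Finset.sum_congr rfl fun u _ => Finset.sum_congr rfl fun v _ => ?_
    by_cases huv : T₂.Adj u v
    · rw [Finset.prod_pair huv.ne]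
    · simp [adjIndicator, huv]
  rw [← key₁, ← key₂]
  exact h1

/-- The second moment of 2e(A). The squared mean and the correction for coinciding edges depend only
on edge label counts, so they cancel by `hedge`; what remains comes from pairs of edges sharing one
vertex. -/
theorem sum_pathLabelCount_fugacity_eq (h : subsetProfile T₁ = subsetProfile T₂) {N : ℕ}
    (hN₁ : ∀ v, T₁.degree v < N) (hN₂ : ∀ v, T₂.degree v < N)
    (hedge : ∀ b c, edgeLabelCount T₁ b c = edgeLabelCount T₂ b c) {x y : ℝ}
    (hx : ∀ d, 1 + x * y ^ d ≠ 0) :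
    ∑ b ∈ Finset.range N, ∑ c ∈ Finset.range N, ∑ d ∈ Finset.range N,
      (pathLabelCount T₁ b c d : ℝ) * (degreeFugacity x y b *
        (degreeFugacity x y c * (1 - degreeFugacity x y c)) * degreeFugacity x y d) =
    ∑ b ∈ Finset.range N, ∑ c ∈ Finset.range N, ∑ d ∈ Finset.range N,
      (pathLabelCount T₂ b c d : ℝ) * (degreeFugacity x y b *
        (degreeFugacity x y c * (1 - degreeFugacity x y c)) * degreeFugacity x y d) := by
  have h1 := sum_prod_fugacity_eq h (φ := fun e => (2 * (e : ℝ)) ^ 2)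
    (sum_adjIndicator_sq_subset T₁) (sum_adjIndicator_sq_subset T₂)
    (fun v => hx _) (fun v => hx _)
  rw [sum_edge_pairs_eq, sum_edge_pairs_eq] at h1
  set p := degreeFugacity x y
  rw [sum_adjIndicator_eq_sum_edgeLabelCount T₁ hN₁ (fun b c => p b * p c),
    sum_adjIndicator_eq_sum_edgeLabelCount T₂ hN₂ (fun b c => p b * p c),
    sum_adjIndicator_eq_sum_edgeLabelCount T₁ hN₁ (fun b c => p b * p c - (p b * p c) ^ 2),
    sum_adjIndicator_eq_sum_edgeLabelCount T₂ hN₂ (fun b c => p b * p c - (p b * p c) ^ 2),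
    sum_adjIndicator_eq_sum_pathLabelCount T₁ hN₁ (fun b c d => p b * (p c * (1 - p c)) * p d),
    sum_adjIndicator_eq_sum_pathLabelCount T₂ hN₂ (fun b c d => p b * (p c * (1 - p c)) * p d)]
    at h1
  simp only [hedge] at h1
  linarith

end Relations

/-! ### Poles of the fugacities and Lambert series -/

section Asymptotics

open Filter Topology

/-- The fugacity of degree `d` when the vertices of degree `a` are near the singularity. -/
noncomputable def nearFugacity (a : ℕ) (y ε : ℝ) (d : ℕ) : ℝ :=
  degreeFugacity ((ε - 1) / y ^ a) y d

variable {a : ℕ} {y : ℝ}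

theorem one_sub_pow_div_pow_ne_zero (hy0 : 0 < y) (hy1 : y < 1) {d : ℕ} (hd : d ≠ a) :
    1 - y ^ d / y ^ a ≠ 0 := by
  rw [sub_ne_zero, ne_comm, Ne, div_eq_one_iff_eq (pow_pos hy0 a).ne']
  exact fun h => hd (pow_right_injective₀ hy0 hy1.ne h)

/-- One neighborhood serves all d: for 0 < ε < 1 - y the factor 1 - ε lies strictly between y and 1,
so (1 - ε) y^d never equals the power y^a. -/
theorem eventually_one_add_weight_ne_zero (hy0 : 0 < y) (hy1 : y < 1) :
    ∀ᶠ ε in 𝓝[>] (0 : ℝ), ∀ d : ℕ, 1 + (ε - 1) / y ^ a * y ^ d ≠ 0 := by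
  filter_upwards [Ioo_mem_nhdsGT (sub_pos.2 hy1)] with ε hε d
  obtain ⟨h0, h1⟩ := hε
  have hya := pow_pos hy0 a
  have hyd := pow_pos hy0 d
  intro h
  have h2 : y ^ a = (1 - ε) * y ^ d := by
    field_simp at h
    linarith
  rcases lt_trichotomy d a with hda | rfl | hda
  · have h3 : y ^ a ≤ y ^ (d + 1) := pow_le_pow_of_le_one hy0.le hy1.le hda
    rw [pow_succ] at h3
    nlinarith
  · nlinarith
  · have h3 : y ^ d < y ^ a := pow_lt_pow_right_of_lt_one₀ hy0 hy1 hda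
    nlinarith

theorem nearFugacity_self (hy0 : 0 < y) (ε : ℝ) : nearFugacity a y ε a = (ε - 1) / ε := by
  have hya := (pow_pos hy0 a).ne'
  rw [nearFugacity, degreeFugacity, div_mul_cancel₀ _ hya, add_sub_cancel]

theorem tendsto_nearFugacity_of_ne (hy0 : 0 < y) (hy1 : y < 1) {d : ℕ} (hd : d ≠ a) :
    Tendsto (fun ε => nearFugacity a y ε d) (𝓝[>] 0) (𝓝 (nearFugacity a y 0 d)) := by
  have hne := one_sub_pow_div_pow_ne_zero hy0 hy1 hd
  have : ContinuousAt (fun ε => nearFugacity a y ε d) 0 := by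
    unfold nearFugacity degreeFugacity
    refine ContinuousAt.div (by fun_prop) (by fun_prop) ?_
    convert hne using 1
    ring
  exact this.tendsto.mono_left nhdsWithin_le_nhds

theorem tendsto_mul_nearFugacity_self (hy0 : 0 < y) :
    Tendsto (fun ε => ε * nearFugacity a y ε a) (𝓝[>] 0) (𝓝 (-1)) := by
  have h : Tendsto (fun ε : ℝ => ε - 1) (𝓝[>] 0) (𝓝 (0 - 1)) :=
    ((continuous_id.sub continuous_const).tendsto 0).mono_left nhdsWithin_le_nhds
  rw [zero_sub] at h
  refine h.congr' ?_
  filter_upwards [self_mem_nhdsWithin] with ε hε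
  rw [nearFugacity_self hy0, mul_div_cancel₀ _ (ne_of_gt hε)]

theorem tendsto_mul_one_sub_nearFugacity_self (hy0 : 0 < y) :
    Tendsto (fun ε => ε * (1 - nearFugacity a y ε a)) (𝓝[>] 0) (𝓝 1) := by
  refine tendsto_const_nhds.congr' ?_
  filter_upwards [self_mem_nhdsWithin] with ε hε
  have : ε ≠ 0 := ne_of_gt hε
  rw [nearFugacity_self hy0]
  field_simp
  ring

theorem tendsto_id_nhdsGT_zero : Tendsto (fun ε : ℝ => ε) (𝓝[>] 0) (𝓝 0) :=
  tendsto_id.mono_left nhdsWithin_le_nhds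

theorem tendsto_mul_nearFugacity (hy0 : 0 < y) (hy1 : y < 1) (d : ℕ) :
    Tendsto (fun ε => ε * nearFugacity a y ε d) (𝓝[>] 0) (𝓝 (if d = a then -1 else 0)) := by
  split_ifs with h
  · subst h
    exact tendsto_mul_nearFugacity_self hy0
  · simpa using tendsto_id_nhdsGT_zero.mul (tendsto_nearFugacity_of_ne hy0 hy1 h)

theorem tendsto_mul_one_sub_nearFugacity (hy0 : 0 < y) (hy1 : y < 1) (d : ℕ) :
    Tendsto (fun ε => ε * (1 - nearFugacity a y ε d)) (𝓝[>] 0) (𝓝 (if d = a then 1 else 0)) := by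
  split_ifs with h
  · subst h
    exact tendsto_mul_one_sub_nearFugacity_self hy0
  · simpa using tendsto_id_nhdsGT_zero.mul
      ((tendsto_nearFugacity_of_ne hy0 hy1 h).const_sub 1)

/-- Only the term b = c = a has a double pole, so multiplication by ε² isolates it. -/
theorem edge_coefficient_self_eq_zero {N : ℕ} (ha : a < N) {Δ : ℕ → ℕ → ℝ}
    (hy0 : 0 < y) (hy1 : y < 1)
    (h : ∀ᶠ ε in 𝓝[>] (0 : ℝ), ∑ b ∈ Finset.range N, ∑ c ∈ Finset.range N,
      Δ b c * (nearFugacity a y ε b * nearFugacity a y ε c) = 0) : Δ a a = 0 := by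
  have h1 : Tendsto (fun ε => ∑ b ∈ Finset.range N, ∑ c ∈ Finset.range N,
      Δ b c * ((ε * nearFugacity a y ε b) * (ε * nearFugacity a y ε c))) (𝓝[>] 0)
      (𝓝 (∑ b ∈ Finset.range N, ∑ c ∈ Finset.range N,
        Δ b c * ((if b = a then -1 else 0) * (if c = a then -1 else 0)))) :=
    tendsto_finsetSum _ fun b _ => tendsto_finsetSum _ fun c _ =>
      ((tendsto_mul_nearFugacity hy0 hy1 b).mul (tendsto_mul_nearFugacity hy0 hy1 c)).const_mul _
  have h2 := tendsto_nhds_unique (h1.congr' (f₂ := fun _ => (0 : ℝ)) (by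
    filter_upwards [h] with ε hε
    have : ε ^ 2 * ∑ b ∈ Finset.range N, ∑ c ∈ Finset.range N,
      Δ b c * (nearFugacity a y ε b * nearFugacity a y ε c) = 0 := by rw [hε, mul_zero]
    rw [← this]
    simp only [Finset.mul_sum]
    refine Finset.sum_congr rfl fun b _ => Finset.sum_congr rfl fun c _ => ?_
    ring)) tendsto_const_nhds
  simpa [ha] using h2

/-- With the double pole gone, this is the coefficient of the simple pole. The terms (a, d) and (d,
a) contribute equally by symmetry. -/
theorem edge_coefficient_sum_eq_zero {N : ℕ} (ha : a < N) {Δ : ℕ → ℕ → ℝ}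
    (hsymm : ∀ b c, Δ b c = Δ c b) (hy0 : 0 < y) (hy1 : y < 1)
    (h : ∀ᶠ ε in 𝓝[>] (0 : ℝ), ∑ b ∈ Finset.range N, ∑ c ∈ Finset.range N,
      Δ b c * (nearFugacity a y ε b * nearFugacity a y ε c) = 0) :
    ∑ d ∈ Finset.range N, (if d = a then 0 else Δ a d * nearFugacity a y 0 d) = 0 := by
  have hΔ := edge_coefficient_self_eq_zero ha hy0 hy1 h
  have hterm : ∀ b c, Tendsto (fun ε => Δ b c * (ε * nearFugacity a y ε b * nearFugacity a y ε c))
      (𝓝[>] 0) (𝓝 (-(if b = a then (if c = a then 0 else Δ a c * nearFugacity a y 0 c) else 0) -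
        (if c = a then (if b = a then 0 else Δ a b * nearFugacity a y 0 b) else 0))) := by
    intro b c
    by_cases hb : b = a <;> by_cases hc : c = a
    · subst hb; subst hc
      simp [hΔ]
    · subst hb
      have := ((tendsto_mul_nearFugacity_self (a := b) hy0).mul
        (tendsto_nearFugacity_of_ne hy0 hy1 hc)).const_mul (Δ b c)
      simpa [hc] using this
    · subst hc
      have := ((tendsto_mul_nearFugacity_self (a := c) hy0).mul
        (tendsto_nearFugacity_of_ne hy0 hy1 hb)).const_mul (Δ b c)
      refine (this.congr fun ε => by ring).trans ?_
      simp [hb, hsymm b c]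
    · have := ((tendsto_id_nhdsGT_zero.mul (tendsto_nearFugacity_of_ne hy0 hy1 hb)).mul
        (tendsto_nearFugacity_of_ne hy0 hy1 hc)).const_mul (Δ b c)
      simpa [hb, hc] using this
  have h1 := tendsto_finsetSum (Finset.range N) fun b _ =>
    tendsto_finsetSum (Finset.range N) fun c _ => hterm b c
  have h2 := tendsto_nhds_unique (h1.congr' (f₂ := fun _ => (0 : ℝ)) (by
    filter_upwards [h] with ε hε
    have : ε * ∑ b ∈ Finset.range N, ∑ c ∈ Finset.range N,
      Δ b c * (nearFugacity a y ε b * nearFugacity a y ε c) = 0 := by rw [hε, mul_zero]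
    rw [← this]
    simp only [Finset.mul_sum]
    refine Finset.sum_congr rfl fun b _ => Finset.sum_congr rfl fun c _ => ?_
    ring)) tendsto_const_nhds
  simp only [Finset.sum_sub_distrib, Finset.sum_neg_distrib, Finset.sum_ite_eq',
    Finset.mem_range, ha, if_true] at h2
  rw [Finset.sum_comm] at h2
  simp only [Finset.sum_ite_eq', Finset.mem_range, ha, if_true] at h2
  linarith

/-- The middle factor p (1 - p) has a double pole at degree a, so the term with all three labels a
has order four and no other term does. -/
theorem path_coefficient_self_eq_zero {N : ℕ} (ha : a < N) {Δ : ℕ → ℕ → ℕ → ℝ}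
    (hy0 : 0 < y) (hy1 : y < 1)
    (h : ∀ᶠ ε in 𝓝[>] (0 : ℝ), ∑ b ∈ Finset.range N, ∑ c ∈ Finset.range N,
      ∑ d ∈ Finset.range N, Δ b c d * (nearFugacity a y ε b *
        (nearFugacity a y ε c * (1 - nearFugacity a y ε c)) * nearFugacity a y ε d) = 0) :
    Δ a a a = 0 := by
  have h1 : Tendsto (fun ε => ∑ b ∈ Finset.range N, ∑ c ∈ Finset.range N, ∑ d ∈ Finset.range N,
      Δ b c d * ((ε * nearFugacity a y ε b) * ((ε * nearFugacity a y ε c) *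
        (ε * (1 - nearFugacity a y ε c))) * (ε * nearFugacity a y ε d))) (𝓝[>] 0)
      (𝓝 (∑ b ∈ Finset.range N, ∑ c ∈ Finset.range N, ∑ d ∈ Finset.range N,
        Δ b c d * ((if b = a then -1 else 0) * ((if c = a then -1 else 0) *
          (if c = a then 1 else 0)) * (if d = a then -1 else 0)))) :=
    tendsto_finsetSum _ fun b _ => tendsto_finsetSum _ fun c _ => tendsto_finsetSum _ fun d _ =>
      (((tendsto_mul_nearFugacity hy0 hy1 b).mul ((tendsto_mul_nearFugacity hy0 hy1 c).mul
        (tendsto_mul_one_sub_nearFugacity hy0 hy1 c))).mul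
          (tendsto_mul_nearFugacity hy0 hy1 d)).const_mul _
  have h2 := tendsto_nhds_unique (h1.congr' (f₂ := fun _ => (0 : ℝ)) (by
    filter_upwards [h] with ε hε
    have : ε ^ 4 * ∑ b ∈ Finset.range N, ∑ c ∈ Finset.range N,
      ∑ d ∈ Finset.range N, Δ b c d * (nearFugacity a y ε b *
        (nearFugacity a y ε c * (1 - nearFugacity a y ε c)) * nearFugacity a y ε d) = 0 := by
      rw [hε, mul_zero]
    rw [← this]
    simp only [Finset.mul_sum]
    refine Finset.sum_congr rfl fun b _ => Finset.sum_congr rfl fun c _ =>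
      Finset.sum_congr rfl fun d _ => ?_
    ring)) tendsto_const_nhds
  simpa [ha] using h2

/-- Order three is reached exactly by a middle label a and one end label a. A middle label different
from a leaves at most the two poles of the ends. -/
theorem path_coefficient_sum_eq_zero {N : ℕ} (ha : a < N) {Δ : ℕ → ℕ → ℕ → ℝ}
    (hsymm : ∀ b c d, Δ b c d = Δ d c b) (hy0 : 0 < y) (hy1 : y < 1)
    (h : ∀ᶠ ε in 𝓝[>] (0 : ℝ), ∑ b ∈ Finset.range N, ∑ c ∈ Finset.range N,
      ∑ d ∈ Finset.range N, Δ b c d * (nearFugacity a y ε b *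
        (nearFugacity a y ε c * (1 - nearFugacity a y ε c)) * nearFugacity a y ε d) = 0) :
    ∑ d ∈ Finset.range N, (if d = a then 0 else Δ a a d * nearFugacity a y 0 d) = 0 := by
  have hΔ := path_coefficient_self_eq_zero ha hy0 hy1 h
  have hs := tendsto_mul_nearFugacity_self (a := a) hy0
  have hs' := tendsto_mul_one_sub_nearFugacity_self (a := a) hy0
  have hn := fun {d : ℕ} (hd : d ≠ a) => tendsto_nearFugacity_of_ne hy0 hy1 hd
  have hi := tendsto_id_nhdsGT_zero
  have hterm : ∀ b c d, Tendsto (fun ε => Δ b c d * (ε ^ 3 * (nearFugacity a y ε b *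
        (nearFugacity a y ε c * (1 - nearFugacity a y ε c)) * nearFugacity a y ε d)))
      (𝓝[>] 0) (𝓝 ((if b = a then if c = a then (if d = a then 0 else
          Δ a a d * nearFugacity a y 0 d) else 0 else 0) +
        (if d = a then if c = a then (if b = a then 0 else
          Δ a a b * nearFugacity a y 0 b) else 0 else 0))) := by
    intro b c d
    by_cases hc : c = a
    · subst hc
      by_cases hb : b = c <;> by_cases hd : d = c
      · subst hb; subst hd
        simp [hΔ]
      · subst hb
        have := (((hs.mul hs).mul hs').mul (hn hd)).const_mul (Δ b b d)
        refine (this.congr fun ε => by ring).trans ?_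
        simp [hd]
      · subst hd
        have := (((hs.mul hs).mul hs').mul (hn hb)).const_mul (Δ b d d)
        refine (this.congr fun ε => by ring).trans ?_
        simp [hb, hsymm b d d]
      · have := ((((hs.mul hs').mul hi).mul (hn hb)).mul (hn hd)).const_mul (Δ b c d)
        refine (this.congr fun ε => by ring).trans ?_
        simp [hb, hd]
    · have hb := tendsto_mul_nearFugacity (a := a) hy0 hy1 b
      have hd := tendsto_mul_nearFugacity (a := a) hy0 hy1 d
      have := (((hi.mul hb).mul hd).mul ((hn hc).mul ((hn hc).const_sub 1))).const_mul (Δ b c d)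
      refine (this.congr fun ε => by ring).trans ?_
      simp [hc]
  have h1 := tendsto_finsetSum (Finset.range N) fun b _ =>
    tendsto_finsetSum (Finset.range N) fun c _ =>
      tendsto_finsetSum (Finset.range N) fun d _ => hterm b c d
  have h2 := tendsto_nhds_unique (h1.congr' (f₂ := fun _ => (0 : ℝ)) (by
    filter_upwards [h] with ε hε
    have : ε ^ 3 * ∑ b ∈ Finset.range N, ∑ c ∈ Finset.range N,
      ∑ d ∈ Finset.range N, Δ b c d * (nearFugacity a y ε b *
        (nearFugacity a y ε c * (1 - nearFugacity a y ε c)) * nearFugacity a y ε d) = 0 := by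
      rw [hε, mul_zero]
    rw [← this]
    simp only [Finset.mul_sum]
    refine Finset.sum_congr rfl fun b _ => Finset.sum_congr rfl fun c _ =>
      Finset.sum_congr rfl fun d _ => ?_
    ring)) tendsto_const_nhds
  simp only [Finset.sum_add_distrib, Finset.sum_ite_eq', Finset.mem_range, ha, if_true] at h2
  have h3 : ∑ b ∈ Finset.range N, ∑ c ∈ Finset.range N, ∑ d ∈ Finset.range N,
      (if b = a then if c = a then (if d = a then 0 else
          Δ a a d * nearFugacity a y 0 d) else 0 else 0) =
      ∑ d ∈ Finset.range N, (if d = a then 0 else Δ a a d * nearFugacity a y 0 d) := by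
    rw [Finset.sum_eq_single_of_mem a (Finset.mem_range.2 ha) (fun b _ hb => by simp [hb]),
      Finset.sum_eq_single_of_mem a (Finset.mem_range.2 ha) (fun b _ hb => by simp [hb])]
    simp
  rw [h3] at h2
  linarith

/-- Linear independence of the Lambert functions `y ^ m / (1 - y ^ m)`, `m ≥ 1`, and `1`. -/
theorem lambert_coefficient_eq_zero {M : ℕ} {γ : ℕ → ℝ} {C : ℝ}
    (h : ∀ y : ℝ, 0 < y → y < 1 →
      C + ∑ m ∈ Finset.range M, γ m * (y ^ (m + 1) / (1 - y ^ (m + 1))) = 0) :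
    ∀ m < M, γ m = 0 := by
  have hev : ∀ᶠ y in 𝓝[>] (0 : ℝ),
      C + ∑ m ∈ Finset.range M, γ m * (y ^ (m + 1) / (1 - y ^ (m + 1))) = 0 := by
    filter_upwards [Ioo_mem_nhdsGT one_pos] with y hy using h y hy.1 hy.2
  have hcont : ∀ j m : ℕ, Tendsto (fun y : ℝ => y ^ j / (1 - y ^ (m + 1))) (𝓝[>] 0)
      (𝓝 (0 ^ j / (1 - 0 ^ (m + 1)))) := fun j m => by
    have : ContinuousAt (fun y : ℝ => y ^ j / (1 - y ^ (m + 1))) 0 :=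
      ContinuousAt.div (by fun_prop) (by fun_prop) (by simp)
    exact this.tendsto.mono_left nhdsWithin_le_nhds
  have hC : C = 0 := by
    have h1 := (tendsto_finsetSum (Finset.range M) fun m _ =>
      (hcont (m + 1) m).const_mul (γ m)).const_add C
    have := tendsto_nhds_unique (h1.congr' (f₂ := fun _ => (0 : ℝ)) hev) tendsto_const_nhds
    simpa using this
  intro m
  induction m using Nat.strong_induction_on with
  | _ m ih =>
    intro hm
    -- After division by y^(m+1), the terms above m vanish as y → 0. For j < m the exponent j - m is
    -- truncated to 0, harmlessly, since γ j = 0 by induction.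
    have h1 := tendsto_finsetSum (Finset.range M) fun j _ =>
      (hcont (j - m) j).const_mul (γ j)
    have h2 := tendsto_nhds_unique (h1.congr' (f₂ := fun _ => (0 : ℝ)) (by
      filter_upwards [hev, self_mem_nhdsWithin] with y hy hy0
      have hy0' : y ^ (m + 1) ≠ 0 := pow_ne_zero _ (ne_of_gt hy0)
      rw [hC, zero_add] at hy
      refine mul_left_cancel₀ hy0' ?_
      rw [mul_zero, ← hy, Finset.mul_sum]
      refine Finset.sum_congr rfl fun j hj => ?_
      rcases lt_or_ge j m with hjm | hjm
      · rw [ih j hjm (Finset.mem_range.1 hj)]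
        ring
      · have : y ^ (j + 1) = y ^ (m + 1) * y ^ (j - m) := by
          rw [← pow_add]; congr 1; omega
        rw [mul_left_comm, mul_div_assoc', ← this])) tendsto_const_nhds
    rw [Finset.sum_eq_single_of_mem m (Finset.mem_range.2 hm)] at h2
    · simpa using h2
    · intro j hj hjm
      rcases lt_or_ge j m with hlt | hge
      · rw [ih j hlt (Finset.mem_range.1 hj), zero_mul]
      · have : j - m ≠ 0 := by omega
        simp [this]

/-- At ε = 0 the fugacity at a + k is -L_k and at a - k it is 1 + L_k, where L_k = y^k / (1 - y^k)
and k = m + 1. Independence of the L_k and 1 equates the coefficients at labels symmetric about a; a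
label below 0 counts as coefficient 0. -/
theorem coefficient_reflect {M : ℕ} (hM : a ≤ M) {δ : ℕ → ℝ}
    (h : ∀ y : ℝ, 0 < y → y < 1 → ∑ d ∈ Finset.range (a + 1 + M),
      (if d = a then 0 else δ d * nearFugacity a y 0 d) = 0) (m : ℕ) (hm : m < M) :
    δ (a + 1 + m) = if m < a then δ (a - 1 - m) else 0 := by
  have key := lambert_coefficient_eq_zero (M := M) (C := ∑ m ∈ Finset.range a, δ (a - 1 - m))
    (γ := fun m => (if m < a then δ (a - 1 - m) else 0) - δ (a + 1 + m)) ?_ m hm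
  · linarith
  intro y hy0 hy1
  have h1 := h y hy0 hy1
  rw [Finset.sum_range_add, Finset.sum_range_succ, if_pos rfl, add_zero,
    ← Finset.sum_range_reflect] at h1
  have hlo : ∀ j ∈ Finset.range a, (if a - 1 - j = a then 0 else
      δ (a - 1 - j) * nearFugacity a y 0 (a - 1 - j)) =
      δ (a - 1 - j) + (if j < a then δ (a - 1 - j) else 0) * (y ^ (j + 1) / (1 - y ^ (j + 1))) := by
    intro j hj
    have hja := Finset.mem_range.1 hj
    have hp : y ^ a = y ^ (a - 1 - j) * y ^ (j + 1) := by
      rw [← pow_add]; congr 1; omega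
    have h2 : 1 - y ^ (j + 1) ≠ 0 := by
      have := pow_lt_one₀ hy0.le hy1 (n := j + 1) (by omega)
      linarith
    have h3 : y ^ (j + 1) - 1 ≠ 0 := by
      rw [← neg_sub]
      exact neg_ne_zero.2 h2
    have h4 := (pow_pos hy0 (j + 1)).ne'
    have h5 := (pow_pos hy0 (a - 1 - j)).ne'
    rw [if_neg (by omega), if_pos hja, nearFugacity, degreeFugacity, hp]
    have : (0 - 1) / (y ^ (a - 1 - j) * y ^ (j + 1)) * y ^ (a - 1 - j) = -(y ^ (j + 1))⁻¹ := by
      field_simp; ring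
    rw [this]
    have h6 : 1 + -(y ^ (j + 1))⁻¹ = (y ^ (j + 1) - 1) / y ^ (j + 1) := by
      field_simp; ring
    rw [h6]
    field_simp
    ring
  have hhi : ∀ j, (if a + 1 + j = a then 0 else δ (a + 1 + j) * nearFugacity a y 0 (a + 1 + j)) =
      -(δ (a + 1 + j) * (y ^ (j + 1) / (1 - y ^ (j + 1)))) := by
    intro j
    have hp : y ^ (a + 1 + j) = y ^ a * y ^ (j + 1) := by
      rw [← pow_add]; congr 1; omega
    have h4 := (pow_pos hy0 a).ne'
    rw [if_neg (by omega), nearFugacity, degreeFugacity, hp]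
    have : (0 - 1) / y ^ a * (y ^ a * y ^ (j + 1)) = -y ^ (j + 1) := by
      field_simp; ring
    rw [this]
    ring
  rw [Finset.sum_congr rfl hlo, Finset.sum_congr rfl (fun j _ => hhi j), Finset.sum_add_distrib,
    Finset.sum_neg_distrib] at h1
  have hext : ∑ j ∈ Finset.range a, (if j < a then δ (a - 1 - j) else 0) *
      (y ^ (j + 1) / (1 - y ^ (j + 1))) = ∑ j ∈ Finset.range M,
      (if j < a then δ (a - 1 - j) else 0) * (y ^ (j + 1) / (1 - y ^ (j + 1))) := by
    refine Finset.sum_subset (Finset.range_subset_range.2 hM) fun j _ hj => ?_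
    rw [if_neg (by simpa using hj), zero_mul]
  rw [hext] at h1
  simp only [sub_mul, Finset.sum_sub_distrib]
  linarith

end Asymptotics

/-! ### Edge and path label counts are determined -/

section LabelCounts

variable {V₁ V₂ : Type*} [Fintype V₁] [DecidableEq V₁] [Fintype V₂] [DecidableEq V₂]
  {T₁ : SimpleGraph V₁} [DecidableRel T₁.Adj] {T₂ : SimpleGraph V₂} [DecidableRel T₂.Adj]

theorem edgeLabelCount_comm {V : Type*} [Fintype V] (T : SimpleGraph V) [DecidableRel T.Adj]
    (b c : ℕ) : edgeLabelCount T b c = edgeLabelCount T c b := by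
  refine Finset.card_bij (fun q _ => q.swap) ?_ ?_ ?_
  · intro q hq
    simp only [Finset.mem_filter, Finset.mem_univ, true_and] at hq ⊢
    exact ⟨hq.1.symm, hq.2.2, hq.2.1⟩
  · intro q _ r _ h
    exact Prod.swap_injective h
  · intro q hq
    simp only [Finset.mem_filter, Finset.mem_univ, true_and] at hq
    exact ⟨q.swap, by simp [hq.1.symm, hq.2.1, hq.2.2], by simp⟩

theorem pathLabelCount_comm {V : Type*} [Fintype V] [DecidableEq V] (T : SimpleGraph V)
    [DecidableRel T.Adj] (b c d : ℕ) : pathLabelCount T b c d = pathLabelCount T d c b := by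
  refine Finset.card_bij (fun q _ => (q.2.2, q.2.1, q.1)) ?_ ?_ ?_
  · intro q hq
    simp only [Finset.mem_filter, Finset.mem_univ, true_and] at hq ⊢
    obtain ⟨⟨h1, h2, h3⟩, h4, h5, h6⟩ := hq
    exact ⟨⟨h2.symm, h1.symm, h3.symm⟩, h6, h5, h4⟩
  · rintro ⟨q1, q2, q3⟩ _ ⟨r1, r2, r3⟩ _ h
    simp only [Prod.mk.injEq] at h ⊢
    exact ⟨h.2.2, h.2.1, h.1⟩
  · rintro ⟨q1, q2, q3⟩ hq
    simp only [Finset.mem_filter, Finset.mem_univ, true_and] at hq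
    obtain ⟨⟨h1, h2, h3⟩, h4, h5, h6⟩ := hq
    exact ⟨(q3, q2, q1), by simp [h1.symm, h2.symm, Ne.symm h3, h4, h5, h6], rfl⟩

theorem pathLabelCount_zero_right {V : Type*} [Fintype V] [DecidableEq V] (T : SimpleGraph V)
    [DecidableRel T.Adj] (b c : ℕ) : pathLabelCount T b c 0 = 0 := by
  rw [pathLabelCount, Finset.card_eq_zero, Finset.filter_eq_empty_iff]
  rintro ⟨u, v, w⟩ - ⟨⟨-, h, -⟩, -, -, h0⟩
  exact ((T.degree_pos_iff_exists_adj w).2 ⟨v, h.symm⟩).ne' h0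

/-- Trees with the same profile have the same number of edges with prescribed end degrees. -/
theorem edgeLabelCount_eq (h : subsetProfile T₁ = subsetProfile T₂) (b c : ℕ) :
    edgeLabelCount T₁ b c = edgeLabelCount T₂ b c := by
  set Δ : ℕ → ℕ → ℝ := fun b c => edgeLabelCount T₁ b c - edgeLabelCount T₂ b c with hΔ
  have hsymm : ∀ b c, Δ b c = Δ c b := fun b c => by
    simp only [hΔ, edgeLabelCount_comm _ b c]
  have hrel : ∀ (a N : ℕ), (∀ v, T₁.degree v < N) → (∀ v, T₂.degree v < N) →
      ∀ y : ℝ, 0 < y → y < 1 → ∀ᶠ ε in nhdsWithin (0 : ℝ) (Set.Ioi 0),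
        ∑ b ∈ Finset.range N, ∑ c ∈ Finset.range N,
          Δ b c * (nearFugacity a y ε b * nearFugacity a y ε c) = 0 := by
    intro a N h1 h2 y hy0 hy1
    filter_upwards [eventually_one_add_weight_ne_zero (a := a) hy0 hy1] with ε hε
    simp only [hΔ, sub_mul, Finset.sum_sub_distrib]
    exact sub_eq_zero.2 (sum_edgeLabelCount_fugacity_eq h h1 h2 hε)
  -- Strong induction on the smaller label: reflection turns (a, a + m) into (a, a - m), whose
  -- smaller label is below a.
  have key : ∀ a m, Δ a (a + m) = 0 := by
    intro a
    induction a using Nat.strong_induction_on with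
    | _ a ih =>
      intro m
      have hN : ∀ M, Fintype.card V₁ + Fintype.card V₂ ≤ M →
          (∀ v, T₁.degree v < a + 1 + M) ∧ ∀ v, T₂.degree v < a + 1 + M := fun M hM =>
        ⟨fun v => by have := T₁.degree_lt_card_verts v; omega,
          fun v => by have := T₂.degree_lt_card_verts v; omega⟩
      -- Large enough that the range a + 1 + M contains all degrees, that a ≤ M, and that the wanted
      -- index is below M.
      set M := Fintype.card V₁ + Fintype.card V₂ + a + m + 1 with hM
      obtain ⟨h1, h2⟩ := hN M (by omega)
      rcases m with _ | m
      · exact edge_coefficient_self_eq_zero (N := a + 1 + M) (by omega) one_half_pos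
          one_half_lt_one (hrel a _ h1 h2 _ one_half_pos one_half_lt_one)
      · have := coefficient_reflect (a := a) (M := M) (by omega) (δ := Δ a) (fun y hy0 hy1 =>
          edge_coefficient_sum_eq_zero (by omega) hsymm hy0 hy1 (hrel a _ h1 h2 y hy0 hy1))
          m (by omega)
        rw [show a + (m + 1) = a + 1 + m by omega, this]
        split_ifs with hma
        · rw [hsymm]
          have := ih (a - 1 - m) (by omega) (m + 1)
          rwa [show a - 1 - m + (m + 1) = a by omega] at this
        · rfl
  have hbc : Δ b c = 0 := by
    rcases le_total b c with hle | hle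
    · have := key b (c - b)
      rwa [Nat.add_sub_cancel' hle] at this
    · have := key c (b - c)
      rwa [Nat.add_sub_cancel' hle, hsymm] at this
  exact_mod_cast sub_eq_zero.1 hbc

theorem pathLabelCount_relation (h : subsetProfile T₁ = subsetProfile T₂) (a : ℕ) {N : ℕ}
    (h1 : ∀ v, T₁.degree v < N) (h2 : ∀ v, T₂.degree v < N) {y : ℝ} (hy0 : 0 < y) (hy1 : y < 1) :
    ∀ᶠ ε in nhdsWithin (0 : ℝ) (Set.Ioi 0),
      ∑ b ∈ Finset.range N, ∑ c ∈ Finset.range N, ∑ d ∈ Finset.range N,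
        ((pathLabelCount T₁ b c d : ℝ) - pathLabelCount T₂ b c d) * (nearFugacity a y ε b *
          (nearFugacity a y ε c * (1 - nearFugacity a y ε c)) * nearFugacity a y ε d) = 0 := by
  filter_upwards [eventually_one_add_weight_ne_zero (a := a) hy0 hy1] with ε hε
  simp only [sub_mul, Finset.sum_sub_distrib]
  exact sub_eq_zero.2 (sum_pathLabelCount_fugacity_eq h h1 h2 (edgeLabelCount_eq h) hε)

theorem pathLabelCount_self_eq (h : subsetProfile T₁ = subsetProfile T₂) (a : ℕ) :
    pathLabelCount T₁ a a a = pathLabelCount T₂ a a a := by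
  have := path_coefficient_self_eq_zero (a := a)
    (N := a + 1 + Fintype.card V₁ + Fintype.card V₂)
    (Δ := fun b c d => (pathLabelCount T₁ b c d : ℝ) - pathLabelCount T₂ b c d)
    (by omega) one_half_pos one_half_lt_one
    (pathLabelCount_relation h a (fun v => by have := T₁.degree_lt_card_verts v; omega)
      (fun v => by have := T₂.degree_lt_card_verts v; omega) one_half_pos one_half_lt_one)
  exact_mod_cast sub_eq_zero.1 this

/-- Reflection about a sends b to 2a - b ≤ 0. Label 0 is impossible for the end of a path, and a
negative label does not occur. -/
theorem pathLabelCount_self_right_eq (h : subsetProfile T₁ = subsetProfile T₂) {a b : ℕ}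
    (ha : 0 < a) (hab : 2 * a ≤ b) : pathLabelCount T₁ a a b = pathLabelCount T₂ a a b := by
  have := coefficient_reflect (a := a) (M := Fintype.card V₁ + Fintype.card V₂ + a + b) (by omega)
    (δ := fun d => (pathLabelCount T₁ a a d : ℝ) - pathLabelCount T₂ a a d)
    (fun y hy0 hy1 => path_coefficient_sum_eq_zero
      (Δ := fun b c d => (pathLabelCount T₁ b c d : ℝ) - pathLabelCount T₂ b c d) (by omega)
      (fun b c d => by simp only [pathLabelCount_comm _ b c d]) hy0 hy1
      (pathLabelCount_relation h a
        (fun v => by have := T₁.degree_lt_card_verts v; omega)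
        (fun v => by have := T₂.degree_lt_card_verts v; omega) hy0 hy1)) (b - a - 1) (by omega)
  rw [show a + 1 + (b - a - 1) = b by omega] at this
  have h0 : ((pathLabelCount T₁ a a b : ℝ) - pathLabelCount T₂ a a b) = 0 := by
    rw [this]
    split_ifs with hlt
    · rw [show a - 1 - (b - a - 1) = 0 by omega, pathLabelCount_zero_right,
        pathLabelCount_zero_right, sub_self]
    · rfl
  exact_mod_cast sub_eq_zero.1 h0

end LabelCounts

/-! ### Embedding numbers and labeled copies -/

/-- The injective homomorphisms `D → T` that carry the labels of `D` to vertex degrees. -/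
def LabeledCopy {W V : Type*} [Fintype V] (D : SimpleGraph W) (a : W → ℕ)
    (T : SimpleGraph V) [DecidableRel T.Adj] : Type _ :=
  {f : W → V // Function.Injective f ∧ (∀ u v, D.Adj u v → T.Adj (f u) (f v)) ∧
    ∀ u, a u = T.degree (f u)}

/-- The image of an injective homomorphism as a subgraph. -/
def imageSubgraph {W V : Type*} {D : SimpleGraph W} {T : SimpleGraph V} (f : W → V)
    (hf : ∀ u v, D.Adj u v → T.Adj (f u) (f v)) : T.Subgraph where
  verts := Set.range f
  Adj x y := ∃ u v, D.Adj u v ∧ f u = x ∧ f v = y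
  adj_sub := by
    rintro x y ⟨u, v, h, rfl, rfl⟩
    exact hf u v h
  edge_vert := by
    rintro x y ⟨u, v, h, rfl, rfl⟩
    exact ⟨u, rfl⟩
  symm := ⟨by
    rintro x y ⟨u, v, h, rfl, rfl⟩
    exact ⟨v, u, h.symm, rfl, rfl⟩⟩

noncomputable def imageSubgraphIso {W V : Type*} {D : SimpleGraph W} {T : SimpleGraph V}
    (f : W → V) (hf : ∀ u v, D.Adj u v → T.Adj (f u) (f v)) (hinj : Function.Injective f) :
    D ≃g (imageSubgraph f hf).coe where
  toEquiv := Equiv.ofInjective f hinj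
  map_rel_iff' := by
    intro u v
    constructor
    · rintro ⟨u', v', h, hu, hv⟩
      have hu' := hinj hu
      have hv' := hinj hv
      subst hu' hv'
      exact h
    · intro h
      exact ⟨u, v, h, rfl, rfl⟩

theorem imageSubgraph_eq {W V : Type*} {D : SimpleGraph W} {T : SimpleGraph V}
    {T' : T.Subgraph} (φ : D ≃g T'.coe)
    (hf : ∀ u v, D.Adj u v → T.Adj (φ u : V) (φ v : V)) :
    imageSubgraph (fun u => (φ u : V)) hf = T' := by
  ext x y
  · constructor
    · rintro ⟨u, rfl⟩
      exact (φ u).2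
    · intro hx
      exact ⟨φ.symm ⟨x, hx⟩, by simp⟩
  · constructor
    · rintro ⟨u, v, h, rfl, rfl⟩
      exact φ.map_adj_iff.2 h
    · intro h
      have hx := T'.edge_vert h
      have hy := T'.edge_vert h.symm
      refine ⟨φ.symm ⟨x, hx⟩, φ.symm ⟨y, hy⟩, ?_, by simp, by simp⟩
      rw [← φ.map_adj_iff]
      simpa using h

/-- Labeled copies are counted by embedding numbers times label-preserving automorphisms. -/
theorem card_labeledCopy {W V : Type*} [Fintype W] [Fintype V] {D : SimpleGraph W}
    (hD : D.Connected) (a : W → ℕ) {T : SimpleGraph V} [DecidableRel T.Adj] (hT : T.IsAcyclic) :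
    Nat.card (LabeledCopy D a T) =
      degreeEmbeddingNumber D a T * Nat.card {σ : D ≃g D // ∀ u, a (σ u) = a u} := by
  classical
  rw [degreeEmbeddingNumber, ← Nat.card_coe_set_eq, ← Nat.card_prod]
  -- A reference isomorphism is fixed for each subgraph; every labeled copy is then uniquely such a
  -- reference preceded by a label-preserving automorphism of D.
  let φ : ∀ T' : {T' : T.Subgraph | T'.coe.IsTree ∧
    ∃ φ : D ≃g T'.coe, ∀ u : W, a u = T.degree (φ u : V)}, D ≃g T'.1.coe := fun T' =>
      T'.2.2.choose
  have hφ : ∀ T' u, a u = T.degree (φ T' u : V) := fun T' => T'.2.2.choose_spec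
  let F : {T' : T.Subgraph | T'.coe.IsTree ∧
      ∃ φ : D ≃g T'.coe, ∀ u : W, a u = T.degree (φ u : V)} ×
      {σ : D ≃g D // ∀ u, a (σ u) = a u} → LabeledCopy D a T := fun p =>
    ⟨fun u => (φ p.1 (p.2.1 u) : V),
      Subtype.val_injective.comp ((φ p.1).injective.comp p.2.1.injective),
      fun u v h => p.1.1.adj_sub ((φ p.1).map_adj_iff.2 (p.2.1.map_adj_iff.2 h)),
      fun u => by rw [← hφ, p.2.2]⟩
  refine (Nat.card_congr (Equiv.ofBijective F ⟨?_, ?_⟩)).symm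
  · rintro ⟨T', σ, hσ⟩ ⟨T'', τ, hτ⟩ h
    have hfun : (fun u => (φ T' (σ u) : V)) = fun u => (φ T'' (τ u) : V) :=
      congrArg Subtype.val h
    have h1 := imageSubgraph_eq (σ.trans (φ T')) (F (T', ⟨σ, hσ⟩)).2.2.1
    have h2 := imageSubgraph_eq (τ.trans (φ T'')) (F (T'', ⟨τ, hτ⟩)).2.2.1
    have hT' : T' = T'' := by
      apply Subtype.ext
      rw [← h1, ← h2]
      congr 1
    subst hT'
    have hστ : σ = τ := by
      ext u
      exact (φ T').injective (Subtype.val_injective (congrFun hfun u))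
    subst hστ
    rfl
  · rintro ⟨f, hinj, hf, ha⟩
    let ψ := imageSubgraphIso f hf hinj
    have hψ : ∀ u, (ψ u : V) = f u := fun u => rfl
    let T' : {T' : T.Subgraph | T'.coe.IsTree ∧
        ∃ φ : D ≃g T'.coe, ∀ u : W, a u = T.degree (φ u : V)} :=
      ⟨imageSubgraph f hf, ⟨ψ.connected_iff.1 hD, hT.subgraph _⟩, ψ, ha⟩
    refine ⟨(T', ⟨ψ.trans (φ T').symm, fun u => ?_⟩), ?_⟩
    · have h : ((φ T') ((φ T').symm (ψ u)) : V) = f u := by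
        rw [RelIso.apply_symm_apply, hψ]
      rw [hφ T', ha u]
      exact congrArg (fun v => T.degree v) h
    · apply Subtype.ext
      funext u
      change ((φ T') ((φ T').symm (ψ u)) : V) = f u
      rw [RelIso.apply_symm_apply, hψ]

/-- The automorphism factor depends only on the labeled tree and is positive, so it cancels. -/
theorem degreeEmbeddingNumber_eq_of_card_labeledCopy_eq {W V₁ V₂ : Type*} [Fintype W]
    [Fintype V₁] [Fintype V₂] {D : SimpleGraph W} (hD : D.Connected) {a : W → ℕ}
    {T₁ : SimpleGraph V₁} [DecidableRel T₁.Adj] {T₂ : SimpleGraph V₂} [DecidableRel T₂.Adj]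
    (hT₁ : T₁.IsAcyclic) (hT₂ : T₂.IsAcyclic) :
    degreeEmbeddingNumber D a T₁ = degreeEmbeddingNumber D a T₂ ↔
      Nat.card (LabeledCopy D a T₁) = Nat.card (LabeledCopy D a T₂) := by
  rw [card_labeledCopy hD a hT₁, card_labeledCopy hD a hT₂]
  have : Finite {σ : D ≃g D // ∀ u, a (σ u) = a u} :=
    Finite.of_injective (β := W → W) (fun σ => σ.1) fun σ τ h => by
      apply Subtype.ext
      ext u
      exact congrFun h u
  have : Nonempty {σ : D ≃g D // ∀ u, a (σ u) = a u} := ⟨⟨Iso.refl, fun _ => rfl⟩⟩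
  exact (Nat.mul_left_inj Nat.card_pos.ne').symm

theorem card_labeledCopy_path_two {V : Type*} [Fintype V] (T : SimpleGraph V)
    [DecidableRel T.Adj] (a b : ℕ) :
    Nat.card (LabeledCopy (pathGraph 2) ![a, b] T) = edgeLabelCount T a b := by
  rw [edgeLabelCount, ← Fintype.card_subtype, ← Nat.card_eq_fintype_card]
  refine Nat.card_congr
    { toFun := fun f => ⟨(f.1 0, f.1 1), f.2.2.1 0 1 (by simp [pathGraph_adj]),
        (f.2.2.2 0).symm, (f.2.2.2 1).symm⟩
      invFun := fun q => ⟨![q.1.1, q.1.2], ?_, ?_, ?_⟩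
      left_inv := ?_
      right_inv := fun q => rfl }
  · have := q.2.1.ne
    intro i j
    fin_cases i <;> fin_cases j <;> simp [this, this.symm]
  · have := q.2.1
    intro i j
    fin_cases i <;> fin_cases j <;> simp [pathGraph_adj, this, this.symm]
  · intro i
    fin_cases i
    exacts [q.2.2.1.symm, q.2.2.2.symm]
  · intro f
    apply Subtype.ext
    funext i
    fin_cases i <;> rfl

theorem card_labeledCopy_path_three {V : Type*} [Fintype V] [DecidableEq V] (T : SimpleGraph V)
    [DecidableRel T.Adj] (a b c : ℕ) :
    Nat.card (LabeledCopy (pathGraph 3) ![a, b, c] T) = pathLabelCount T a b c := by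
  rw [pathLabelCount, ← Fintype.card_subtype, ← Nat.card_eq_fintype_card]
  refine Nat.card_congr
    { toFun := fun f => ⟨(f.1 0, f.1 1, f.1 2), ⟨f.2.2.1 0 1 (by simp [pathGraph_adj]),
        f.2.2.1 1 2 (by simp [pathGraph_adj]), f.2.1.ne (by decide)⟩,
        (f.2.2.2 0).symm, (f.2.2.2 1).symm, (f.2.2.2 2).symm⟩
      invFun := fun q => ⟨![q.1.1, q.1.2.1, q.1.2.2], ?_, ?_, ?_⟩
      left_inv := ?_
      right_inv := fun q => rfl }
  · have h1 := q.2.1.1.ne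
    have h2 := q.2.1.2.1.ne
    have h3 := q.2.1.2.2
    intro i j
    fin_cases i <;> fin_cases j <;> simp [h1, h1.symm, h2, h2.symm, h3, h3.symm]
  · have h1 := q.2.1.1
    have h2 := q.2.1.2.1
    intro i j
    fin_cases i <;> fin_cases j <;> simp [pathGraph_adj, h1, h1.symm, h2, h2.symm]
  · intro i
    fin_cases i
    exacts [q.2.2.1.symm, q.2.2.2.1.symm, q.2.2.2.2.symm]
  · intro f
    apply Subtype.ext
    funext i
    fin_cases i <;> rfl

/-- A labeled copy is a center with an ordered choice of k distinct adjacent leaves. Keeping the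
center at vertex 0 avoids special cases for stars with extra symmetry. -/
theorem card_labeledCopy_star {V : Type*} [Fintype V] [DecidableEq V] (T : SimpleGraph V)
    [DecidableRel T.Adj] (d k : ℕ) :
    Nat.card (LabeledCopy (starGraph (0 : Fin (k + 1))) (Fin.cons d (fun _ : Fin k => 1)) T) =
      ∑ v with T.degree v = d, (adjacentLeafCount T v).descFactorial k := by
  have hcard : ∀ v, Nat.card (Fin k ↪ {w // w ∈ (T.neighborFinset v).filter
      (fun w => T.degree w = 1)}) = (adjacentLeafCount T v).descFactorial k := by
    intro v
    rw [Nat.card_eq_fintype_card, Fintype.card_embedding_eq, Fintype.card_coe, Fintype.card_fin]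
    rfl
  rw [Finset.sum_subtype (p := fun v => T.degree v = d) _ (by simp)]
  simp only [← hcard]
  rw [← Nat.card_sigma]
  refine Nat.card_congr
    { toFun := fun f => ⟨⟨f.1 0, (f.2.2.2 0).symm⟩, ⟨fun i => ⟨f.1 i.succ, ?_⟩, ?_⟩⟩
      invFun := fun q => ⟨Fin.cons q.1.1 (fun i => (q.2 i : V)), ?_, ?_, ?_⟩
      left_inv := ?_
      right_inv := fun q => rfl }
  · rw [Finset.mem_filter, mem_neighborFinset]
    exact ⟨f.2.2.1 0 i.succ (starGraph_center_adj (Fin.succ_ne_zero i).symm),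
      (f.2.2.2 i.succ).symm⟩
  · intro i j h
    exact Fin.succ_injective _ (f.2.1 (congrArg Subtype.val h))
  · have hadj : ∀ i, T.Adj q.1.1 (q.2 i : V) := fun i => by
      have := (Finset.mem_filter.1 (q.2 i).2).1
      rwa [mem_neighborFinset] at this
    rw [Fin.cons_injective_iff]
    refine ⟨?_, Subtype.val_injective.comp q.2.injective⟩
    rintro ⟨i, hi⟩
    exact (hadj i).ne hi.symm
  · have hadj : ∀ i, T.Adj q.1.1 (q.2 i : V) := fun i => by
      have := (Finset.mem_filter.1 (q.2 i).2).1
      rwa [mem_neighborFinset] at this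
    intro u v huv
    rw [starGraph_adj] at huv
    obtain ⟨hne, rfl | rfl⟩ := huv
    · obtain ⟨i, rfl⟩ := Fin.exists_succ_eq_of_ne_zero hne.symm
      simpa using hadj i
    · obtain ⟨i, rfl⟩ := Fin.exists_succ_eq_of_ne_zero hne
      simpa using (hadj i).symm
  · intro u
    refine Fin.cases ?_ (fun i => ?_) u
    · exact q.1.2.symm
    · exact (Finset.mem_filter.1 (q.2 i).2).2.symm
  · intro f
    apply Subtype.ext
    funext i
    refine Fin.cases rfl (fun j => rfl) i

theorem adjacentLeafCount_lt {V : Type*} [Fintype V] (T : SimpleGraph V)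
    [DecidableRel T.Adj] (v : V) : adjacentLeafCount T v < Fintype.card V :=
  ((Finset.card_filter_le _ _).trans_eq (card_neighborFinset_eq_degree T v)).trans_lt
    (T.degree_lt_card_verts v)

theorem sum_descFactorial_eq {V : Type*} [Fintype V] [DecidableEq V] (T : SimpleGraph V)
    [DecidableRel T.Adj] (d k : ℕ) {N : ℕ} (hN : Fintype.card V ≤ N) :
    ∑ v with T.degree v = d, (adjacentLeafCount T v).descFactorial k =
      ∑ l ∈ Finset.range N, leafAdjacencyNumber T d l * l.descFactorial k := by
  rw [← Finset.sum_fiberwise_of_maps_to (t := Finset.range N) (g := adjacentLeafCount T)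
    (fun v _ => Finset.mem_range.2 ((adjacentLeafCount_lt T v).trans_le hN))]
  refine Finset.sum_congr rfl fun l _ => ?_
  rw [Finset.filter_filter, leafAdjacencyNumber, ← smul_eq_mul, ← Finset.sum_const]
  refine Finset.sum_congr rfl fun v hv => ?_
  rw [(Finset.mem_filter.1 hv).2.2]

/-- The system is triangular: `l.descFactorial k` vanishes for l < k and is k! for l = k, so the
largest k isolates the top coefficient. -/
theorem eq_of_sum_descFactorial_eq {N : ℕ} {f g : ℕ → ℕ}
    (h : ∀ k, ∑ l ∈ Finset.range N, f l * l.descFactorial k =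
      ∑ l ∈ Finset.range N, g l * l.descFactorial k) : ∀ l < N, f l = g l := by
  induction N with
  | zero => intro l hl; omega
  | succ N ih =>
    have hN : f N = g N := by
      have := h N
      rw [Finset.sum_range_succ, Finset.sum_range_succ, Finset.sum_eq_zero, Finset.sum_eq_zero,
        zero_add, zero_add] at this
      · refine Nat.eq_of_mul_eq_mul_right ?_ this
        rw [Nat.descFactorial_self]
        exact Nat.factorial_pos N
      · intro l hl
        rw [Nat.descFactorial_of_lt (Finset.mem_range.1 hl), mul_zero]
      · intro l hl
        rw [Nat.descFactorial_of_lt (Finset.mem_range.1 hl), mul_zero]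
    intro l hl
    rcases Nat.lt_succ_iff_lt_or_eq.1 hl with hl | rfl
    · refine ih (fun k => ?_) l hl
      have := h k
      rw [Finset.sum_range_succ, Finset.sum_range_succ, hN] at this
      omega
    · exact hN

/-- The star embedding numbers and the leaf adjacency numbers determine each other. -/
theorem starEmbeddingNumber_eq_iff {V₁ V₂ : Type*}
    [Fintype V₁] [DecidableEq V₁] [Fintype V₂] [DecidableEq V₂]
    {T₁ : SimpleGraph V₁} [DecidableRel T₁.Adj] {T₂ : SimpleGraph V₂} [DecidableRel T₂.Adj]
    (hT₁ : T₁.IsAcyclic) (hT₂ : T₂.IsAcyclic) (d : ℕ) :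
    (∀ k, starEmbeddingNumber d k T₁ = starEmbeddingNumber d k T₂) ↔
      ∀ l, leafAdjacencyNumber T₁ d l = leafAdjacencyNumber T₂ d l := by
  set N := Fintype.card V₁ + Fintype.card V₂ with hN
  have h1 : ∀ k, starEmbeddingNumber d k T₁ = starEmbeddingNumber d k T₂ ↔
      ∑ l ∈ Finset.range N, leafAdjacencyNumber T₁ d l * l.descFactorial k =
        ∑ l ∈ Finset.range N, leafAdjacencyNumber T₂ d l * l.descFactorial k := by
    intro k
    rw [starEmbeddingNumber, starEmbeddingNumber,
      degreeEmbeddingNumber_eq_of_card_labeledCopy_eq (connected_starGraph _) hT₁ hT₂,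
      card_labeledCopy_star, card_labeledCopy_star,
      sum_descFactorial_eq T₁ d k (N := N) (by omega),
      sum_descFactorial_eq T₂ d k (N := N) (by omega)]
  simp only [h1]
  constructor
  · intro h l
    by_cases hl : l < N
    · exact eq_of_sum_descFactorial_eq h l hl
    · rw [leafAdjacencyNumber, leafAdjacencyNumber, Finset.filter_false_of_mem,
        Finset.filter_false_of_mem]
      · rfl
      · rintro v - ⟨-, h⟩
        have := adjacentLeafCount_lt T₂ v
        omega
      · rintro v - ⟨-, h⟩
        have := adjacentLeafCount_lt T₁ v
        omega
  · intro h k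
    simp only [h]

/-! ### Unique exponents in products of power series -/

section LeadingTerm

variable {R : Type*} [CommRing R]

/-- `A = 1 + c X ^ m + O(X ^ (m + 1))`. -/
def HasLeadingTerm (m : ℕ) (A : PowerSeries R) (c : R) : Prop :=
  ∃ B : PowerSeries R, A = 1 + PowerSeries.X ^ m * B ∧ PowerSeries.constantCoeff B = c

theorem HasLeadingTerm.mul {m : ℕ} {A A' : PowerSeries R} {c c' : R}
    (h : HasLeadingTerm (m + 1) A c) (h' : HasLeadingTerm (m + 1) A' c') :
    HasLeadingTerm (m + 1) (A * A') (c + c') := by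
  obtain ⟨B, rfl, rfl⟩ := h
  obtain ⟨B', rfl, rfl⟩ := h'
  refine ⟨B + B' + PowerSeries.X ^ (m + 1) * (B * B'), by ring, ?_⟩
  simp

theorem HasLeadingTerm.one (m : ℕ) : HasLeadingTerm m (1 : PowerSeries R) 0 :=
  ⟨0, by simp, by simp⟩

theorem HasLeadingTerm.pow {m : ℕ} {A : PowerSeries R} {c : R}
    (h : HasLeadingTerm (m + 1) A c) (n : ℕ) : HasLeadingTerm (m + 1) (A ^ n) (n * c) := by
  induction n with
  | zero => simpa using HasLeadingTerm.one (R := R) (m + 1)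
  | succ n ih =>
    rw [pow_succ, Nat.cast_succ, add_mul, one_mul]
    exact ih.mul h

theorem HasLeadingTerm.of_lt {m n : ℕ} {A : PowerSeries R} {c : R}
    (h : HasLeadingTerm n A c) (hmn : m < n) : HasLeadingTerm m A 0 := by
  obtain ⟨B, rfl, rfl⟩ := h
  refine ⟨PowerSeries.X ^ (n - m) * B, ?_, ?_⟩
  · rw [← mul_assoc, ← pow_add, Nat.add_sub_cancel' hmn.le]
  · rw [map_mul, map_pow, PowerSeries.constantCoeff_X, zero_pow (by omega), zero_mul]

theorem HasLeadingTerm.prod {ι : Type*} {m : ℕ} {s : Finset ι} {A : ι → PowerSeries R} {c : ι → R}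
    (h : ∀ i ∈ s, HasLeadingTerm (m + 1) (A i) (c i)) :
    HasLeadingTerm (m + 1) (∏ i ∈ s, A i) (∑ i ∈ s, c i) := by
  classical
  induction s using Finset.induction_on with
  | empty => simpa using HasLeadingTerm.one (R := R) (m + 1)
  | insert i s hi ih =>
    rw [Finset.prod_insert hi, Finset.sum_insert hi]
    exact (h i (Finset.mem_insert_self i s)).mul
      (ih fun j hj => h j (Finset.mem_insert_of_mem hj))

theorem HasLeadingTerm.coeff {m : ℕ} {A : PowerSeries R} {c : R}
    (h : HasLeadingTerm (m + 1) A c) : PowerSeries.coeff (m + 1) A = c := by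
  obtain ⟨B, rfl, rfl⟩ := h
  rw [map_add, PowerSeries.coeff_one, if_neg (by omega), zero_add,
    PowerSeries.coeff_X_pow_mul', if_pos le_rfl, Nat.sub_self,
    PowerSeries.coeff_zero_eq_constantCoeff]

theorem HasLeadingTerm.ne_zero [Nontrivial R] {m : ℕ} {A : PowerSeries R} {c : R}
    (h : HasLeadingTerm (m + 1) A c) : A ≠ 0 := by
  obtain ⟨B, rfl, rfl⟩ := h
  intro h0
  have := congrArg PowerSeries.constantCoeff h0
  simp at this

/-- The exponents of a product of power series `1 + c_j X ^ (j + 1) + ⋯`, with all `c_j` nonzero,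
are determined by the product. -/
theorem exponent_eq_of_prod_pow_eq [IsDomain R] [CharZero R] {N : ℕ} {ρ : ℕ → PowerSeries R}
    {c : ℕ → R} (hρ : ∀ j < N, HasLeadingTerm (j + 1) (ρ j) (c j)) (hc : ∀ j < N, c j ≠ 0)
    {f g : ℕ → ℕ} (h : ∏ j ∈ Finset.range N, ρ j ^ f j = ∏ j ∈ Finset.range N, ρ j ^ g j) :
    ∀ j < N, f j = g j := by
  intro j
  induction j using Nat.strong_induction_on with
  | _ j ih =>
    intro hj
    have hsplit : ∀ e : ℕ → ℕ, ∏ i ∈ Finset.range N, ρ i ^ e i =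
        (∏ i ∈ Finset.range j, ρ i ^ e i) * ∏ i ∈ Finset.Ico j N, ρ i ^ e i := fun e =>
      (Finset.prod_range_mul_prod_Ico _ hj.le).symm
    -- The factors below j agree by induction and cancel. In the rest only the factor j reaches
    -- X^(j+1), with coefficient its exponent times c j.
    have hlow : ∏ i ∈ Finset.range j, ρ i ^ f i = ∏ i ∈ Finset.range j, ρ i ^ g i :=
      Finset.prod_congr rfl fun i hi => by
        have := Finset.mem_range.1 hi
        rw [ih i this (this.trans hj)]
    rw [hsplit, hsplit, hlow] at h
    have hne : ∏ i ∈ Finset.range j, ρ i ^ g i ≠ 0 :=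
      Finset.prod_ne_zero_iff.2 fun i hi =>
        pow_ne_zero _ (hρ i ((Finset.mem_range.1 hi).trans hj)).ne_zero
    have h' := mul_left_cancel₀ hne h
    have hcoeff : ∀ e : ℕ → ℕ, PowerSeries.coeff (j + 1) (∏ i ∈ Finset.Ico j N, ρ i ^ e i) =
        e j * c j := by
      intro e
      have hlead : ∀ i ∈ Finset.Ico j N,
          HasLeadingTerm (j + 1) (ρ i ^ e i) (if i = j then e j * c j else 0) := by
        intro i hi
        rw [Finset.mem_Ico] at hi
        split_ifs with hij
        · subst hij
          exact (hρ i hi.2).pow _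
        · have h1 : HasLeadingTerm (j + 1) (ρ i) 0 := (hρ i hi.2).of_lt (by omega)
          simpa using h1.pow (e i)
      rw [(HasLeadingTerm.prod hlead).coeff, Finset.sum_ite_eq',
        if_pos (Finset.mem_Ico.2 ⟨le_rfl, hj⟩)]
    have h2 := congrArg (PowerSeries.coeff (j + 1)) h'
    rw [hcoeff, hcoeff] at h2
    exact_mod_cast mul_right_cancel₀ (hc j hj) h2

end LeadingTerm

/-! ### Summing out the leaves -/

section Leaves

open Filter Topology

variable {V : Type*} [Fintype V] [DecidableEq V] (T : SimpleGraph V) [DecidableRel T.Adj]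

theorem sum_sum_adjIndicator (A : Finset V) :
    ∑ u ∈ A, ∑ v ∈ A, adjIndicator T u v = 2 * (internalEdgeCount T A : ℝ) := by
  rw [← sum_adjIndicator_subset, Fintype.sum_prod_type, ← Finset.sum_filter_add_sum_filter_not
    Finset.univ (· ∈ A), Finset.filter_mem_eq_inter, Finset.univ_inter]
  rw [Finset.sum_eq_zero (s := Finset.univ.filter (· ∉ A)), add_zero]
  · refine Finset.sum_congr rfl fun u hu => ?_
    rw [← Fintype.sum_ite_mem]
    refine Finset.sum_congr rfl fun v _ => ?_
    by_cases hv : v ∈ A <;> simp [hu, hv, Finset.insert_subset_iff]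
  · intro u hu
    have := (Finset.mem_filter.1 hu).2
    simp [Finset.insert_subset_iff, this]

theorem sum_adjIndicator_mem (B : Finset V) (c : V) :
    ∑ v ∈ B, adjIndicator T c v = (((T.neighborFinset c) ∩ B).card : ℝ) := by
  simp only [adjIndicator, Finset.sum_boole]
  congr 2
  ext v
  simp [and_comm]

theorem internalEdgeCount_union {B C : Finset V} (hBC : Disjoint B C)
    (hC : ∀ u ∈ C, ∀ v ∈ C, ¬ T.Adj u v) :
    internalEdgeCount T (B ∪ C) =
      internalEdgeCount T B + ∑ c ∈ C, (T.neighborFinset c ∩ B).card := by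
  have h := sum_sum_adjIndicator T (B ∪ C)
  rw [Finset.sum_union hBC] at h
  simp only [Finset.sum_union hBC, Finset.sum_add_distrib, sum_sum_adjIndicator] at h
  have h1 : ∑ u ∈ C, ∑ v ∈ C, adjIndicator T u v = 0 :=
    Finset.sum_eq_zero fun u hu => Finset.sum_eq_zero fun v hv => if_neg (hC u hu v hv)
  have h2 : ∑ u ∈ B, ∑ v ∈ C, adjIndicator T u v = ∑ u ∈ C, ∑ v ∈ B, adjIndicator T u v := by
    rw [Finset.sum_comm]
    exact Finset.sum_congr rfl fun u _ => Finset.sum_congr rfl fun v _ => adjIndicator_comm T v u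
  rw [sum_sum_adjIndicator] at h1
  rw [h1, h2] at h
  simp only [sum_adjIndicator_mem] at h
  have : (internalEdgeCount T (B ∪ C) : ℝ) =
      internalEdgeCount T B + ∑ c ∈ C, ((T.neighborFinset c ∩ B).card : ℝ) := by linarith
  exact_mod_cast this

/-- The set of leaves. -/
def leafSet : Finset V := Finset.univ.filter (fun v => T.degree v = 1)

theorem sum_leafSet_card_inter (B : Finset V) :
    ∑ c ∈ leafSet T, (T.neighborFinset c ∩ B).card = ∑ v ∈ B, adjacentLeafCount T v := by
  have h : ∑ c ∈ leafSet T, ∑ v ∈ B, adjIndicator T c v =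
      ∑ v ∈ B, ∑ c ∈ leafSet T, adjIndicator T v c := by
    rw [Finset.sum_comm]
    exact Finset.sum_congr rfl fun u _ => Finset.sum_congr rfl fun v _ => adjIndicator_comm T v u
  have h2 : ∀ v, T.neighborFinset v ∩ leafSet T =
      (T.neighborFinset v).filter (fun w => T.degree w = 1) := by
    intro v; ext; simp [leafSet]
  simp only [sum_adjIndicator_mem, h2] at h
  exact_mod_cast h

/-- Fix the nonleaf part B of A. A leaf has weight ε - 1, and the edge variable t = (1 - εh) / (1 -
ε) is chosen so that its total contribution is 1 + (ε - 1) = ε if its neighbor is outside B and 1 +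
(ε - 1) t = εh if inside. The product over leaves is a power of ε times h to the number of leaves
attached to B. -/
theorem sum_subsets_eq_sum_leaf_split
    (hleaf : ∀ u ∈ leafSet T, ∀ v ∈ leafSet T, ¬ T.Adj u v) {y ε : ℝ} (h : ℝ) (hy : y ≠ 0)
    (hε : ε ≠ 1) :
    ∑ A : Finset V, ((1 - ε * h) / (1 - ε)) ^ internalEdgeCount T A *
        ∏ v ∈ A, (ε - 1) / y * y ^ T.degree v =
      ε ^ (leafSet T).card * ∑ B ∈ (leafSet T)ᶜ.powerset,
        ((1 - ε * h) / (1 - ε)) ^ internalEdgeCount T B *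
        ∏ v ∈ B, ((ε - 1) / y * y ^ T.degree v * h ^ adjacentLeafCount T v) := by
  set t := (1 - ε * h) / (1 - ε) with ht
  set L := leafSet T with hL
  let w : V → ℝ := fun v => (ε - 1) / y * y ^ T.degree v
  have hwL : ∀ c ∈ L, w c = ε - 1 := by
    intro c hc
    have : T.degree c = 1 := (Finset.mem_filter.1 hc).2
    simp only [w, this, pow_one]
    field_simp
  have hwv : ∀ v, (ε - 1) / y * y ^ T.degree v = w v := fun v => rfl
  clear_value w
  simp only [hwv]
  have hbij : ∑ A : Finset V, t ^ internalEdgeCount T A * ∏ v ∈ A, w v =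
      ∑ B ∈ Lᶜ.powerset, ∑ C ∈ L.powerset,
        t ^ internalEdgeCount T (B ∪ C) * ∏ v ∈ B ∪ C, w v := by
    rw [← Finset.sum_product']
    refine Finset.sum_bij' (fun A _ => (A ∩ Lᶜ, A ∩ L)) (fun p _ => p.1 ∪ p.2) ?_ ?_ ?_ ?_ ?_
    · intro A _
      simp [Finset.inter_subset_right]
    · simp
    · intro A _
      ext v; simp; tauto
    · rintro ⟨B, C⟩ hp
      simp only [Finset.mem_product, Finset.mem_powerset] at hp
      obtain ⟨hB, hC⟩ := hp
      have hB' : ∀ v ∈ B, v ∉ L := fun v hv => Finset.mem_compl.1 (hB hv)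
      ext v
      · simp only [Finset.mem_inter, Finset.mem_union, Finset.mem_compl]
        have := hB' v
        have := @hC v
        tauto
      · simp only [Finset.mem_inter, Finset.mem_union]
        have := hB' v
        have := @hC v
        tauto
    · intro A _
      have : A ∩ Lᶜ ∪ A ∩ L = A := by ext v; simp; tauto
      simp only [this]
  rw [hbij, Finset.mul_sum]
  refine Finset.sum_congr rfl fun B hB => ?_
  rw [Finset.mem_powerset] at hB
  have hdisj : ∀ C ∈ L.powerset, Disjoint B C := by
    intro C hC
    rw [Finset.mem_powerset] at hC
    exact Finset.disjoint_left.2 fun v hv hvC => Finset.mem_compl.1 (hB hv) (hC hvC)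
  have hC : ∀ C ∈ L.powerset, t ^ internalEdgeCount T (B ∪ C) * ∏ v ∈ B ∪ C, w v =
      (t ^ internalEdgeCount T B * ∏ v ∈ B, w v) *
        ∏ c ∈ C, w c * t ^ (T.neighborFinset c ∩ B).card := by
    intro C hC
    have hCL := Finset.mem_powerset.1 hC
    rw [internalEdgeCount_union T (hdisj C hC) fun u hu v hv => hleaf u (hCL hu) v (hCL hv),
      Finset.prod_union (hdisj C hC), Finset.prod_mul_distrib, Finset.prod_pow_eq_pow_sum C, pow_add]
    ring
  rw [Finset.sum_congr rfl hC, ← Finset.mul_sum, ← Finset.prod_one_add]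
  -- A leaf has at most one neighbor in B, so only the exponents 0 and 1 occur.
  have hone : ∀ c ∈ L, 1 + w c * t ^ (T.neighborFinset c ∩ B).card =
      ε * h ^ (T.neighborFinset c ∩ B).card := by
    intro c hc
    have hle : (T.neighborFinset c ∩ B).card ≤ 1 := by
      refine (Finset.card_le_card Finset.inter_subset_left).trans ?_
      rw [card_neighborFinset_eq_degree]
      exact (Finset.mem_filter.1 hc).2.le
    rw [hwL c hc]
    have h1 : 1 - ε ≠ 0 := sub_ne_zero.2 hε.symm
    interval_cases (T.neighborFinset c ∩ B).card
    · ring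
    · rw [ht]
      field_simp
      ring
  rw [Finset.prod_congr rfl hone, Finset.prod_mul_distrib, Finset.prod_const,
    Finset.prod_pow_eq_pow_sum L, sum_leafSet_card_inter, Finset.prod_mul_distrib,
    Finset.prod_pow_eq_pow_sum B]
  ring

/-- At ε = 0 the edge variable becomes 1, edges inside B no longer matter, and the sum over B
factors over the nonleaves. -/
theorem tendsto_sum_leaf_split (y h : ℝ) :
    Tendsto (fun ε : ℝ => ∑ B ∈ (leafSet T)ᶜ.powerset,
        ((1 - ε * h) / (1 - ε)) ^ internalEdgeCount T B *
        ∏ v ∈ B, ((ε - 1) / y * y ^ T.degree v * h ^ adjacentLeafCount T v)) (𝓝[>] 0)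
      (𝓝 (∏ v ∈ (leafSet T)ᶜ, (1 - y ^ T.degree v / y * h ^ adjacentLeafCount T v))) := by
  have hlim : ∏ v ∈ (leafSet T)ᶜ, (1 - y ^ T.degree v / y * h ^ adjacentLeafCount T v) =
      ∑ B ∈ (leafSet T)ᶜ.powerset,
        ((1 - 0 * h) / (1 - 0)) ^ internalEdgeCount T B *
        ∏ v ∈ B, ((0 - 1) / y * y ^ T.degree v * h ^ adjacentLeafCount T v) := by
    simp only [sub_eq_add_neg, Finset.prod_one_add]
    refine Finset.sum_congr rfl fun B _ => ?_
    simp only [zero_mul, neg_zero, add_zero, div_one, one_pow, one_mul]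
    refine Finset.prod_congr rfl fun v _ => ?_
    ring
  rw [hlim]
  have : ContinuousAt (fun ε : ℝ => ∑ B ∈ (leafSet T)ᶜ.powerset,
        ((1 - ε * h) / (1 - ε)) ^ internalEdgeCount T B *
        ∏ v ∈ B, ((ε - 1) / y * y ^ T.degree v * h ^ adjacentLeafCount T v)) 0 := by
    refine tendsto_finsetSum _ fun B _ => ContinuousAt.mul ?_ ?_
    · exact (ContinuousAt.div (by fun_prop) (by fun_prop) (by simp)).pow _
    · fun_prop
  exact this.tendsto.mono_left nhdsWithin_le_nhds

end Leaves

/-- Two adjacent leaves form a whole component. Orders at most 2 are therefore treated separately.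
-/
theorem not_adj_of_degree_eq_one {V : Type*} [Fintype V] {T : SimpleGraph V} [DecidableRel T.Adj]
    (hT : T.Connected) (hV : 2 < Fintype.card V) {u v : V} (hu : T.degree u = 1)
    (hv : T.degree v = 1) : ¬ T.Adj u v := by
  classical
  intro huv
  obtain ⟨u', hu', huu⟩ := degree_eq_one_iff_existsUnique_adj.1 hu
  obtain ⟨v', hv', hvv⟩ := degree_eq_one_iff_existsUnique_adj.1 hv
  have e1 := huu v huv
  have e2 := hvv u huv.symm
  subst e1 e2
  have hall : ∀ w, w = u ∨ w = v := by
    intro w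
    have := hT.preconnected u w
    rw [reachable_iff_reflTransGen] at this
    induction this with
    | refl => exact Or.inl rfl
    | tail _ h ih =>
      rcases ih with rfl | rfl
      · exact Or.inr (huu _ h)
      · exact Or.inl (hvv _ h)
  have h2 : Finset.univ ⊆ ({u, v} : Finset V) := fun w _ => by simpa using hall w
  have h3 := Finset.card_le_card h2
  rw [Finset.card_univ] at h3
  have := Finset.card_le_two (a := u) (b := v)
  omega

theorem degree_of_card_le_two {V : Type*} [Fintype V] {T : SimpleGraph V} [DecidableRel T.Adj]
    (hT : T.Connected) (hV : Fintype.card V ≤ 2) (v : V) :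
    T.degree v = Fintype.card V - 1 ∧ adjacentLeafCount T v = Fintype.card V - 1 := by
  classical
  have hdeg : ∀ v, T.degree v = Fintype.card V - 1 := by
    intro v
    have h1 := T.degree_lt_card_verts v
    rcases Nat.lt_or_ge 1 (Fintype.card V) with h | h
    · have : Nontrivial V := Fintype.one_lt_card_iff_nontrivial.1 h
      have := hT.preconnected.degree_pos_of_nontrivial v
      omega
    · omega
  refine ⟨hdeg v, ?_⟩
  rcases Nat.lt_or_ge 1 (Fintype.card V) with h | h
  · rw [adjacentLeafCount, Finset.filter_true_of_mem, card_neighborFinset_eq_degree, hdeg]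
    intro w _
    rw [hdeg]
    omega
  · have h1 : adjacentLeafCount T v ≤ T.degree v :=
      (Finset.card_filter_le _ _).trans_eq (card_neighborFinset_eq_degree T v)
    rw [hdeg] at h1
    omega

/-! ### The profile determines the leaf adjacency numbers -/

section LeafAdjacency

variable {V₁ V₂ : Type*} [Fintype V₁] [DecidableEq V₁] [Fintype V₂] [DecidableEq V₂]
  {T₁ : SimpleGraph V₁} [DecidableRel T₁.Adj] {T₂ : SimpleGraph V₂} [DecidableRel T₂.Adj]

/-- The powers of ε cancel because the profile determines the number of leaves; then ε → 0. -/
theorem prod_nonleaf_eq (h : subsetProfile T₁ = subsetProfile T₂)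
    (hl₁ : ∀ u ∈ leafSet T₁, ∀ v ∈ leafSet T₁, ¬ T₁.Adj u v)
    (hl₂ : ∀ u ∈ leafSet T₂, ∀ v ∈ leafSet T₂, ¬ T₂.Adj u v) {y : ℝ} (hy : y ≠ 0) (z : ℝ) :
    ∏ v ∈ (leafSet T₁)ᶜ, (1 - y ^ T₁.degree v / y * z ^ adjacentLeafCount T₁ v) =
      ∏ v ∈ (leafSet T₂)ᶜ, (1 - y ^ T₂.degree v / y * z ^ adjacentLeafCount T₂ v) := by
  refine tendsto_nhds_unique ((tendsto_sum_leaf_split T₁ y z).congr' ?_)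
    (tendsto_sum_leaf_split T₂ y z)
  filter_upwards [Ioo_mem_nhdsGT (zero_lt_one' ℝ)] with ε hε
  have h1 := sum_subsets_eq_sum_leaf_split T₁ hl₁ z hy hε.2.ne
  have h2 := sum_subsets_eq_sum_leaf_split T₂ hl₂ z hy hε.2.ne
  have h3 : (leafSet T₁).card = (leafSet T₂).card := card_degree_eq h 1
  have h4 := sum_subsets_eq h (fun a D e =>
    ((1 - ε * z) / (1 - ε)) ^ e * (((ε - 1) / y) ^ a * y ^ D))
  simp only [prod_weight (deg := fun v => T₁.degree v)] at h1
  simp only [prod_weight (deg := fun v => T₂.degree v)] at h2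
  rw [h4, h2, h3] at h1
  exact (mul_left_cancel₀ (pow_ne_zero _ hε.1.ne') h1).symm

/-- Substituting h = y^M merges degree and leaf count into one exponent, reducing to a univariate
identity. -/
theorem prod_one_sub_X_pow_eq (h : subsetProfile T₁ = subsetProfile T₂)
    (hl₁ : ∀ u ∈ leafSet T₁, ∀ v ∈ leafSet T₁, ¬ T₁.Adj u v)
    (hl₂ : ∀ u ∈ leafSet T₂, ∀ v ∈ leafSet T₂, ¬ T₂.Adj u v)
    (hp₁ : ∀ v, 0 < T₁.degree v) (hp₂ : ∀ v, 0 < T₂.degree v) (M : ℕ) :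
    (∏ v ∈ (leafSet T₁)ᶜ, (1 - PowerSeries.X ^ (T₁.degree v - 1 + M * adjacentLeafCount T₁ v)) :
      PowerSeries ℝ) =
      ∏ v ∈ (leafSet T₂)ᶜ, (1 - PowerSeries.X ^ (T₂.degree v - 1 + M * adjacentLeafCount T₂ v)) := by
  have hpoly : (∏ v ∈ (leafSet T₁)ᶜ,
      (1 - Polynomial.X ^ (T₁.degree v - 1 + M * adjacentLeafCount T₁ v)) : Polynomial ℝ) =
      ∏ v ∈ (leafSet T₂)ᶜ,
        (1 - Polynomial.X ^ (T₂.degree v - 1 + M * adjacentLeafCount T₂ v)) := by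
    refine Polynomial.eq_of_infinite_eval_eq _ _ ((Set.Ioi_infinite (0 : ℝ)).mono fun y hy => ?_)
    have hy0 : y ≠ 0 := ne_of_gt hy
    have := prod_nonleaf_eq h hl₁ hl₂ hy0 (y ^ M)
    change Polynomial.eval y _ = Polynomial.eval y _
    simp only [Polynomial.eval_prod, Polynomial.eval_sub, Polynomial.eval_one,
      Polynomial.eval_pow, Polynomial.eval_X]
    have e₁ : ∀ v, y ^ (T₁.degree v - 1 + M * adjacentLeafCount T₁ v) =
        y ^ T₁.degree v / y * (y ^ M) ^ adjacentLeafCount T₁ v := fun v => by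
      rw [pow_add, pow_mul, ← pow_sub_one_mul (hp₁ v).ne' y, mul_div_cancel_right₀ _ hy0]
    have e₂ : ∀ v, y ^ (T₂.degree v - 1 + M * adjacentLeafCount T₂ v) =
        y ^ T₂.degree v / y * (y ^ M) ^ adjacentLeafCount T₂ v := fun v => by
      rw [pow_add, pow_mul, ← pow_sub_one_mul (hp₂ v).ne' y, mul_div_cancel_right₀ _ hy0]
    simpa only [e₁, e₂] using this
  have := congrArg (Polynomial.coeToPowerSeries.ringHom (R := ℝ)) hpoly
  simpa [map_prod] using this

theorem prod_one_sub_X_pow_fiberwise {ι : Type*} {s : Finset ι} {c : ι → ℕ} {N : ℕ}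
    (hc : ∀ i ∈ s, 0 < c i ∧ c i ≤ N) :
    (∏ i ∈ s, (1 - PowerSeries.X ^ c i) : PowerSeries ℝ) =
      ∏ j ∈ Finset.range N, (1 - PowerSeries.X ^ (j + 1)) ^ (s.filter (fun i => c i = j + 1)).card := by
  rw [← Finset.prod_fiberwise_of_maps_to (t := Finset.range N) (g := fun i => c i - 1)
    (fun i hi => Finset.mem_range.2 (by have := hc i hi; omega))]
  refine Finset.prod_congr rfl fun j _ => ?_
  have : s.filter (fun i => c i - 1 = j) = s.filter (fun i => c i = j + 1) :=
    Finset.filter_congr fun i hi => by have := hc i hi; omega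
  rw [this, ← Finset.prod_const]
  exact Finset.prod_congr rfl fun i hi => by rw [(Finset.mem_filter.1 hi).2]

theorem hasLeadingTerm_one_sub_X_pow (m : ℕ) :
    HasLeadingTerm m (1 - PowerSeries.X ^ m : PowerSeries ℝ) (-1) :=
  ⟨-1, by ring, by simp⟩

/-- Trees with the same profile have the same leaf adjacency numbers. -/
theorem leafAdjacencyNumber_eq (hT₁ : T₁.IsTree) (hT₂ : T₂.IsTree)
    (h : subsetProfile T₁ = subsetProfile T₂) (d l : ℕ) :
    leafAdjacencyNumber T₁ d l = leafAdjacencyNumber T₂ d l := by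
  have hcard := card_eq_of_subsetProfile_eq h
  rcases Nat.lt_or_ge 2 (Fintype.card V₁) with hn | hn
  swap
  · have h1 := degree_of_card_le_two hT₁.connected hn
    have h2 := degree_of_card_le_two hT₂.connected (hcard ▸ hn)
    simp only [leafAdjacencyNumber, h1, h2, hcard, Finset.filter_const]
    split_ifs
    · simp [hcard]
    · rfl
  have hn₂ : 2 < Fintype.card V₂ := hcard ▸ hn
  have : Nontrivial V₁ := Fintype.one_lt_card_iff_nontrivial.1 (by omega)
  have : Nontrivial V₂ := Fintype.one_lt_card_iff_nontrivial.1 (by omega)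
  have hp₁ : ∀ v, 0 < T₁.degree v := fun v =>
    hT₁.connected.preconnected.degree_pos_of_nontrivial v
  have hp₂ : ∀ v, 0 < T₂.degree v := fun v =>
    hT₂.connected.preconnected.degree_pos_of_nontrivial v
  have hl₁ : ∀ u ∈ leafSet T₁, ∀ v ∈ leafSet T₁, ¬ T₁.Adj u v := fun u hu v hv =>
    not_adj_of_degree_eq_one hT₁.connected hn (Finset.mem_filter.1 hu).2 (Finset.mem_filter.1 hv).2
  have hl₂ : ∀ u ∈ leafSet T₂, ∀ v ∈ leafSet T₂, ¬ T₂.Adj u v := fun u hu v hv =>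
    not_adj_of_degree_eq_one hT₂.connected hn₂ (Finset.mem_filter.1 hu).2
      (Finset.mem_filter.1 hv).2
  rcases Nat.lt_or_ge (Fintype.card V₁) (d + 1) with hd | hd
  · rw [leafAdjacencyNumber, leafAdjacencyNumber, Finset.filter_false_of_mem,
      Finset.filter_false_of_mem]
    · rfl
    · rintro v - ⟨h1, -⟩
      have := T₂.degree_lt_card_verts v
      omega
    · rintro v - ⟨h1, -⟩
      have := T₁.degree_lt_card_verts v
      omega
  rcases Nat.eq_zero_or_pos d with rfl | hd0
  · rw [leafAdjacencyNumber, leafAdjacencyNumber, Finset.filter_false_of_mem,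
      Finset.filter_false_of_mem]
    · rfl
    · rintro v - ⟨h1, -⟩
      exact (hp₂ v).ne' h1
    · rintro v - ⟨h1, -⟩
      exact (hp₁ v).ne' h1
  -- The product runs over nonleaves, so degree 1 is separate: a leaf has no adjacent leaf, and the
  -- number of leaves is known.
  by_cases hd1 : d = 1
  · subst hd1
    have hz₁ : ∀ v, T₁.degree v = 1 → adjacentLeafCount T₁ v = 0 := fun v hv => by
      rw [adjacentLeafCount, Finset.card_eq_zero, Finset.filter_eq_empty_iff]
      exact fun w hw hw1 => not_adj_of_degree_eq_one hT₁.connected hn hv hw1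
        ((mem_neighborFinset _ _ _).1 hw)
    have hz₂ : ∀ v, T₂.degree v = 1 → adjacentLeafCount T₂ v = 0 := fun v hv => by
      rw [adjacentLeafCount, Finset.card_eq_zero, Finset.filter_eq_empty_iff]
      exact fun w hw hw1 => not_adj_of_degree_eq_one hT₂.connected hn₂ hv hw1
        ((mem_neighborFinset _ _ _).1 hw)
    by_cases hl0 : l = 0
    · subst hl0
      refine Eq.trans ?_ ((card_degree_eq h 1).trans ?_)
      · exact congrArg _ (Finset.filter_congr fun v _ => and_iff_left_of_imp (hz₁ v))
      · exact congrArg _ (Finset.filter_congr fun v _ => (and_iff_left_of_imp (hz₂ v)).symm)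
    · rw [leafAdjacencyNumber, leafAdjacencyNumber, Finset.filter_false_of_mem,
        Finset.filter_false_of_mem]
      · rfl
      · rintro v - ⟨h1, h2⟩
        exact hl0 (h2.symm.trans (hz₂ v h1))
      · rintro v - ⟨h1, h2⟩
        exact hl0 (h2.symm.trans (hz₁ v h1))
  set n := Fintype.card V₁ with hnn
  -- With M = n the exponent has remainder d - 1 and quotient ℓ modulo n. The summand n * l only
  -- enlarges the range, to include the index of (d, l) even if no vertex realizes it.
  have hbound₁ : ∀ v ∈ (leafSet T₁)ᶜ, 0 < T₁.degree v - 1 + n * adjacentLeafCount T₁ v ∧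
      T₁.degree v - 1 + n * adjacentLeafCount T₁ v ≤ n + n * n + n * l := by
    intro v hv
    have h1 : T₁.degree v ≠ 1 := by simpa [leafSet] using hv
    have h2 := hp₁ v
    have h3 := T₁.degree_lt_card_verts v
    have h4 := Nat.mul_le_mul_left n (adjacentLeafCount_lt T₁ v).le
    rw [← hnn] at h3 h4
    constructor <;> omega
  have hbound₂ : ∀ v ∈ (leafSet T₂)ᶜ, 0 < T₂.degree v - 1 + n * adjacentLeafCount T₂ v ∧
      T₂.degree v - 1 + n * adjacentLeafCount T₂ v ≤ n + n * n + n * l := by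
    intro v hv
    have h1 : T₂.degree v ≠ 1 := by simpa [leafSet] using hv
    have h2 := hp₂ v
    have h3 := T₂.degree_lt_card_verts v
    have h4 := Nat.mul_le_mul_left n (adjacentLeafCount_lt T₂ v).le
    rw [← hcard] at h3 h4
    constructor <;> omega
  have hprod := prod_one_sub_X_pow_eq h hl₁ hl₂ hp₁ hp₂ n
  rw [prod_one_sub_X_pow_fiberwise hbound₁, prod_one_sub_X_pow_fiberwise hbound₂] at hprod
  have key := exponent_eq_of_prod_pow_eq (c := fun _ => (-1 : ℝ))
    (fun j _ => hasLeadingTerm_one_sub_X_pow (j + 1)) (fun _ _ => by norm_num) hprod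
    (d - 1 + n * l - 1) (by have := Nat.zero_le (n * n); omega)
  rw [show d - 1 + n * l - 1 + 1 = d - 1 + n * l by omega] at key
  have huniq : ∀ a b p q : ℕ, a < n → b < n → (a + n * p = b + n * q ↔ a = b ∧ p = q) := by
    intro a b p q ha hb
    constructor
    · intro h
      have h1 := congrArg (· % n) h
      simp only [Nat.add_mul_mod_self_left, Nat.mod_eq_of_lt ha, Nat.mod_eq_of_lt hb] at h1
      subst h1
      exact ⟨rfl, Nat.eq_of_mul_eq_mul_left (by omega) (Nat.add_left_cancel h)⟩
    · rintro ⟨rfl, rfl⟩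
      rfl
  refine Eq.trans (congrArg Finset.card ?_) (key.trans (congrArg Finset.card ?_))
  · ext v
    have h2 := hp₁ v
    have h3 := T₁.degree_lt_card_verts v
    simp only [Finset.mem_filter, Finset.mem_univ, true_and, Finset.mem_compl, leafSet]
    rw [huniq _ _ _ _ (by omega) (by omega)]
    omega
  · ext v
    have h2 := hp₂ v
    have h3 := T₂.degree_lt_card_verts v
    simp only [Finset.mem_filter, Finset.mem_univ, true_and, Finset.mem_compl, leafSet]
    rw [huniq _ _ _ _ (by omega) (by omega)]
    omega

end LeafAdjacency

/-! ### Matching polynomials from the profile -/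

section Matchings

open Filter Topology

/-- The set of vertices covered by a set of edges. -/
def coveredVertices {V : Type*} [Fintype V] [DecidableEq V] (F : Finset (Sym2 V)) : Finset V :=
  Finset.univ.filter (fun v => ∃ e ∈ F, v ∈ e)

section Covered

variable {V : Type*} [Fintype V] [DecidableEq V]

theorem mem_coveredVertices {F : Finset (Sym2 V)} {v : V} :
    v ∈ coveredVertices F ↔ ∃ e ∈ F, v ∈ e := by
  simp [coveredVertices]

theorem coveredVertices_insert (F : Finset (Sym2 V)) (u v : V) :
    coveredVertices (insert s(u, v) F) = {u, v} ∪ coveredVertices F := by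
  ext w
  simp [mem_coveredVertices, or_assoc]

theorem card_coveredVertices_le (F : Finset (Sym2 V)) :
    (coveredVertices F).card ≤ 2 * F.card := by
  induction F using Finset.induction_on with
  | empty => simp [coveredVertices]
  | insert e F he ih =>
    induction e with | _ u v => ?_
    rw [coveredVertices_insert, Finset.card_insert_of_notMem he]
    have := Finset.card_union_le {u, v} (coveredVertices F)
    have := Finset.card_le_two (a := u) (b := v)
    omega

theorem coveredVertices_subset_iff {F : Finset (Sym2 V)} {A : Finset V} :
    coveredVertices F ⊆ A ↔ ∀ e ∈ F, ∀ v ∈ e, v ∈ A := by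
  constructor
  · intro h e he v hv
    exact h (mem_coveredVertices.2 ⟨e, he, hv⟩)
  · intro h v hv
    obtain ⟨e, he, hv⟩ := mem_coveredVertices.1 hv
    exact h e he v hv

/-- The binomial expansion of (1 + (t - 1))^e(A) over the sets of edges inside A; it writes t^e(A)
through indicators of U ⊆ A. -/
theorem sum_powerset_covered_subset (T : SimpleGraph V) [DecidableRel T.Adj] (t : ℝ)
    (A : Finset V) :
    ∑ F ∈ T.edgeFinset.powerset, (t - 1) ^ F.card * (if coveredVertices F ⊆ A then 1 else 0) =
      t ^ internalEdgeCount T A := by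
  have h1 : ∀ S : Finset (Sym2 V), t ^ S.card = ∑ F ∈ S.powerset, (t - 1) ^ F.card := by
    intro S
    have := Finset.prod_one_add (s := S) (f := fun _ => t - 1)
    simpa using this
  rw [internalEdgeCount, h1]
  simp only [mul_ite, mul_one, mul_zero, ← Finset.sum_filter]
  refine Finset.sum_congr ?_ fun _ _ => rfl
  ext F
  simp only [Finset.mem_filter, Finset.mem_powerset, coveredVertices_subset_iff]
  simp only [Finset.subset_iff, Finset.mem_filter]
  exact ⟨fun h e he => ⟨h.1 he, h.2 e he⟩, fun h => ⟨fun e he => (h he).1, fun e he => (h he).2⟩⟩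

/-- The matching generating series `∑ X ^ |F|` over the matchings `F ⊆ E`. -/
noncomputable def matchingPolynomial (E : Finset (Sym2 V)) : Polynomial ℝ :=
  ∑ F ∈ E.powerset.filter (fun F => (coveredVertices F).card = 2 * F.card), Polynomial.X ^ F.card

/-- The edges both of whose endpoints have degree `a`. -/
def degreeEdges (T : SimpleGraph V) [DecidableRel T.Adj] (a : ℕ) : Finset (Sym2 V) :=
  T.edgeFinset.filter (fun e => ∀ v ∈ e, T.degree v = a)

/-- Each edge of F brings φ ε², and each covered vertex at most a simple pole. As F covers at most
2|F| vertices, a term survives only if exactly 2|F| are covered, all of degree a: a matching. The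
signs cancel in pairs. -/
theorem tendsto_sum_edge_subsets (T : SimpleGraph V) [DecidableRel T.Adj] (a : ℕ) {y : ℝ}
    (hy0 : 0 < y) (hy1 : y < 1) (φ : ℝ) :
    Tendsto (fun ε : ℝ => ∑ F ∈ T.edgeFinset.powerset, (1 + φ * ε ^ 2 - 1) ^ F.card *
      ∏ v ∈ coveredVertices F, nearFugacity a y ε (T.degree v)) (𝓝[>] 0)
      (𝓝 ((matchingPolynomial (degreeEdges T a)).eval φ)) := by
  have hlim : (matchingPolynomial (degreeEdges T a)).eval φ =
      ∑ F ∈ T.edgeFinset.powerset, φ ^ F.card * (0 ^ (2 * F.card - (coveredVertices F).card) *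
        ∏ v ∈ coveredVertices F, if T.degree v = a then -1 else 0) := by
    rw [matchingPolynomial, Polynomial.eval_finsetSum]
    simp only [Polynomial.eval_pow, Polynomial.eval_X]
    rw [← Finset.sum_filter_add_sum_filter_not T.edgeFinset.powerset (fun F =>
      (coveredVertices F).card = 2 * F.card ∧ ∀ v ∈ coveredVertices F, T.degree v = a),
      Finset.sum_eq_zero (s := Finset.filter (fun F => ¬ _) _), add_zero]
    · refine Finset.sum_congr ?_ ?_
      · ext F
        simp only [Finset.mem_filter, Finset.mem_powerset, degreeEdges, Finset.subset_iff,
          mem_coveredVertices]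
        constructor
        · rintro ⟨h1, h2⟩
          exact ⟨fun e he => (h1 he).1, h2, fun v ⟨e, he, hv⟩ => (h1 he).2 v hv⟩
        · rintro ⟨h1, h2, h3⟩
          exact ⟨fun e he => ⟨h1 he, fun v hv => h3 v ⟨e, he, hv⟩⟩, h2⟩
      · intro F hF
        obtain ⟨-, h1, h2⟩ := Finset.mem_filter.1 hF
        rw [Finset.prod_congr rfl (fun v hv => if_pos (h2 v hv)), Finset.prod_const, h1,
          Nat.sub_self, pow_mul]
        norm_num
    · intro F hF
      obtain ⟨-, h1⟩ := Finset.mem_filter.1 hF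
      by_cases h2 : (coveredVertices F).card = 2 * F.card
      · have h3 : ∃ v ∈ coveredVertices F, T.degree v ≠ a := by
          by_contra! h3
          exact h1 ⟨h2, h3⟩
        obtain ⟨v, hv, hva⟩ := h3
        rw [Finset.prod_eq_zero hv (if_neg hva), mul_zero, mul_zero]
      · have := card_coveredVertices_le F
        rw [zero_pow (by omega), zero_mul, mul_zero]
  rw [hlim]
  have hterm : ∀ F : Finset (Sym2 V), Tendsto (fun ε : ℝ => φ ^ F.card *
      (ε ^ (2 * F.card - (coveredVertices F).card) *
        ∏ v ∈ coveredVertices F, (ε * nearFugacity a y ε (T.degree v)))) (𝓝[>] 0)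
      (𝓝 (φ ^ F.card * (0 ^ (2 * F.card - (coveredVertices F).card) *
        ∏ v ∈ coveredVertices F, if T.degree v = a then -1 else 0))) := fun F =>
    ((tendsto_id_nhdsGT_zero.pow _).mul (tendsto_finsetProd _ fun v _ =>
      tendsto_mul_nearFugacity hy0 hy1 _)).const_mul _
  refine (tendsto_finsetSum _ fun F _ => hterm F).congr fun ε => ?_
  refine Finset.sum_congr rfl fun F _ => ?_
  rw [Finset.prod_mul_distrib, Finset.prod_const, ← mul_assoc (ε ^ _) (ε ^ _), ← pow_add,
    Nat.sub_add_cancel (card_coveredVertices_le F), pow_mul]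
  ring

end Covered

variable {V₁ V₂ : Type*} [Fintype V₁] [DecidableEq V₁] [Fintype V₂] [DecidableEq V₂]
  {T₁ : SimpleGraph V₁} [DecidableRel T₁.Adj] {T₂ : SimpleGraph V₂} [DecidableRel T₂.Adj]

/-- The profile determines the matching polynomial of the subgraph on the vertices of degree `a`. -/
theorem matchingPolynomial_degreeEdges_eq (h : subsetProfile T₁ = subsetProfile T₂) (a : ℕ) :
    matchingPolynomial (degreeEdges T₁ a) = matchingPolynomial (degreeEdges T₂ a) := by
  refine Polynomial.funext fun φ => ?_
  refine tendsto_nhds_unique ((tendsto_sum_edge_subsets T₁ a one_half_pos one_half_lt_one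
    φ).congr' ?_) (tendsto_sum_edge_subsets T₂ a one_half_pos one_half_lt_one φ)
  filter_upwards [eventually_one_add_weight_ne_zero (a := a) (y := 1 / 2) one_half_pos
    one_half_lt_one] with ε hε
  exact sum_prod_fugacity_eq h (φ := fun e => (1 + φ * ε ^ 2) ^ e)
    (sum_powerset_covered_subset T₁ _) (sum_powerset_covered_subset T₂ _)
    (fun v => hε _) (fun v => hε _)

end Matchings

/-! ### Pendant edges in matchings and paths -/

section PathLists

variable {V : Type*}

/-- The matchings of `E` split according to whether they use a pendant edge. -/
theorem matchingPolynomial_of_pendant [Fintype V] [DecidableEq V] {E : Finset (Sym2 V)}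
    {u v : V} (huv : u ≠ v)
    (he : s(v, u) ∈ E) (huniq : ∀ e ∈ E, v ∈ e → e = s(v, u)) :
    matchingPolynomial E = matchingPolynomial (E.filter (v ∉ ·)) +
      Polynomial.X * matchingPolynomial ((E.filter (v ∉ ·)).filter (u ∉ ·)) := by
  set E₁ := E.filter (v ∉ ·) with hE₁
  have hnot : s(v, u) ∉ E₁ := by simp [hE₁]
  have hE : E = insert s(v, u) E₁ := by
    ext e
    simp only [hE₁, Finset.mem_insert, Finset.mem_filter]
    constructor
    · intro h
      by_cases hv : v ∈ e
      · exact Or.inl (huniq e h hv)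
      · exact Or.inr ⟨h, hv⟩
    · rintro (rfl | h)
      · exact he
      · exact h.1
  have hv : ∀ F ⊆ E₁, v ∉ coveredVertices F := by
    intro F hF h
    obtain ⟨e, heF, hve⟩ := mem_coveredVertices.1 h
    exact (Finset.mem_filter.1 (hF heF)).2 hve
  rw [hE]
  simp only [matchingPolynomial, Finset.sum_filter]
  rw [Finset.sum_powerset_insert hnot]
  congr 1
  rw [← Finset.sum_filter, ← Finset.sum_filter, Finset.mul_sum]
  refine Finset.sum_congr ?_ ?_
  · ext F
    simp only [Finset.mem_filter, Finset.mem_powerset]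
    have key : ∀ hF : F ⊆ E₁, (coveredVertices (insert s(v, u) F)).card =
        2 * (insert s(v, u) F).card ↔
        (coveredVertices F).card = 2 * F.card ∧ u ∉ coveredVertices F := by
      intro hF
      rw [coveredVertices_insert, Finset.card_insert_of_notMem (fun h => hnot (hF h)),
        Finset.insert_union, Finset.card_insert_of_notMem, Finset.singleton_union]
      · have hle := card_coveredVertices_le F
        by_cases hu : u ∈ coveredVertices F
        · rw [Finset.insert_eq_of_mem hu]
          constructor
          · intro h; omega
          · exact fun h => absurd hu h.2
        · rw [Finset.card_insert_of_notMem hu]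
          constructor
          · intro h; exact ⟨by omega, hu⟩
          · intro h; omega
      · rw [Finset.mem_union, not_or, Finset.mem_singleton]
        exact ⟨huv.symm, hv F hF⟩
    constructor
    · rintro ⟨hF, h⟩
      obtain ⟨h1, h2⟩ := (key hF).1 h
      refine ⟨fun e heF => Finset.mem_filter.2 ⟨hF heF, fun hu => h2 ?_⟩, h1⟩
      exact mem_coveredVertices.2 ⟨e, heF, hu⟩
    · rintro ⟨hF, h1⟩
      have hF1 : F ⊆ E₁ := fun e heF => (Finset.mem_filter.1 (hF heF)).1
      refine ⟨hF1, (key hF1).2 ⟨h1, fun hu => ?_⟩⟩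
      obtain ⟨e, heF, hue⟩ := mem_coveredVertices.1 hu
      exact (Finset.mem_filter.1 (hF heF)).2 hue
  · intro F hF
    have hF1 := Finset.mem_powerset.1 (Finset.mem_filter.1 hF).1
    rw [Finset.card_insert_of_notMem (fun h => hnot ((Finset.mem_filter.1 (hF1 h)).1)), pow_succ,
      mul_comm]

/-- The vertex lists of length `j` that trace a path with edges in `E`. -/
def pathLists {V : Type*} (E : Finset (Sym2 V)) (j : ℕ) : Set (List V) :=
  {l | l.Nodup ∧ l.IsChain (fun a b => s(a, b) ∈ E) ∧ l.length = j}

/-- The vertex lists of length `j` that trace a path with edges in `E` starting at `v`. -/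
def pathListsFrom {V : Type*} (E : Finset (Sym2 V)) (v : V) (j : ℕ) : Set (List V) :=
  {l | l ∈ pathLists E j ∧ l.head? = some v}

theorem finite_pathLists [Fintype V] (E : Finset (Sym2 V)) (j : ℕ) : (pathLists E j).Finite :=
  (List.finite_length_eq V j).subset fun _ h => h.2.2

theorem pathLists_eq_empty [Fintype V] (E : Finset (Sym2 V)) {j : ℕ} (hj : Fintype.card V < j) :
    pathLists E j = ∅ := by
  rw [Set.eq_empty_iff_forall_notMem]
  rintro l ⟨h1, -, h3⟩
  have := h1.length_le_card
  omega

theorem exists_mem_of_isChain_cons {E : Finset (Sym2 V)} {u w : V} {l : List V}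
    (h : (u :: l).IsChain (fun a b => s(a, b) ∈ E)) (hw : w ∈ l) : ∃ e ∈ E, w ∈ e := by
  induction l generalizing u with
  | nil => simp at hw
  | cons x l ih =>
    rw [List.isChain_cons_cons] at h
    rcases List.mem_cons.1 hw with rfl | hw
    · exact ⟨_, h.1, by simp⟩
    · exact ih h.2 hw

theorem pathListsFrom_one (E : Finset (Sym2 V)) (v : V) : pathListsFrom E v 1 = {[v]} := by
  ext l
  simp only [pathListsFrom, pathLists, Set.mem_ofPred_eq, Set.mem_singleton_iff]
  constructor
  · rintro ⟨⟨-, -, h⟩, h'⟩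
    obtain ⟨a, rfl⟩ := List.length_eq_one_iff.1 h
    simpa using h'
  · rintro rfl
    simp

theorem pathListsFrom_of_isolated {E : Finset (Sym2 V)} {v : V} (hv : ∀ e ∈ E, v ∉ e) {j : ℕ}
    (hj : 2 ≤ j) : pathListsFrom E v j = ∅ := by
  rw [Set.eq_empty_iff_forall_notMem]
  rintro l ⟨⟨-, h, hlen⟩, h'⟩
  match l with
  | [] => simp at h'
  | [a] => simp at hlen; omega
  | a :: b :: l =>
    simp only [List.head?_cons, Option.some.injEq] at h'
    subst h'
    rw [List.isChain_cons_cons] at h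
    exact hv _ h.1 (by simp)

theorem isChain_filter_of_notMem [DecidableEq V] {E : Finset (Sym2 V)} {v : V}
    {l : List V} (hv : v ∉ l)
    (h : l.IsChain (fun a b => s(a, b) ∈ E)) :
    l.IsChain (fun a b => s(a, b) ∈ E.filter (v ∉ ·)) := by
  refine h.imp_of_mem_imp fun a b ha hb hab => ?_
  rw [Finset.mem_filter, Sym2.mem_iff, not_or]
  exact ⟨hab, fun h => hv (h ▸ ha), fun h => hv (h ▸ hb)⟩

/-- From a pendant vertex the path must go to its only neighbor and never returns. -/
theorem pathListsFrom_of_pendant [DecidableEq V] {E : Finset (Sym2 V)} {u v : V} (huv : u ≠ v)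
    (he : s(v, u) ∈ E) (huniq : ∀ e ∈ E, v ∈ e → e = s(v, u)) (j : ℕ) :
    pathListsFrom E v (j + 2) = (v :: ·) '' pathListsFrom (E.filter (v ∉ ·)) u (j + 1) := by
  ext l
  simp only [Set.mem_image]
  constructor
  · rintro ⟨⟨h1, h2, hlen⟩, h'⟩
    match l with
    | [] => simp at h'
    | [a] => simp at hlen
    | a :: b :: l =>
      simp only [List.head?_cons, Option.some.injEq] at h'
      subst h'
      rw [List.isChain_cons_cons] at h2
      rw [List.nodup_cons] at h1
      have hb : b = u := by
        exact Sym2.congr_right.1 (huniq _ h2.1 (by simp))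
      subst hb
      refine ⟨b :: l, ⟨⟨h1.2, isChain_filter_of_notMem h1.1 h2.2, ?_⟩, rfl⟩, rfl⟩
      simpa using hlen
  · rintro ⟨l', ⟨⟨h1, h2, hlen⟩, h'⟩, rfl⟩
    match l' with
    | [] => simp at h'
    | b :: l =>
      simp only [List.head?_cons, Option.some.injEq] at h'
      subst h'
      refine ⟨⟨?_, ?_, by simpa using hlen⟩, rfl⟩
      · rw [List.nodup_cons, List.mem_cons, not_or]
        refine ⟨⟨huv.symm, fun hv => ?_⟩, h1⟩
        obtain ⟨e, he, hve⟩ := exists_mem_of_isChain_cons h2 hv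
        exact (Finset.mem_filter.1 he).2 hve
      · rw [List.isChain_cons_cons]
        exact ⟨he, h2.imp fun a b hab => (Finset.mem_filter.1 hab).1⟩

/-- In a path list, a vertex with a unique incident edge occurs at one of the ends. -/
theorem head_or_getLast_of_pendant {E : Finset (Sym2 V)} {u v : V}
    (huniq : ∀ e ∈ E, v ∈ e → e = s(v, u)) {l : List V} (h1 : l.Nodup)
    (h2 : l.IsChain (fun a b => s(a, b) ∈ E)) (hv : v ∈ l) :
    l.head? = some v ∨ l.reverse.head? = some v := by
  obtain ⟨s, t, rfl⟩ := List.append_of_mem hv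
  rcases s.eq_nil_or_concat with rfl | ⟨s, a, rfl⟩
  · exact Or.inl rfl
  rcases t with _ | ⟨b, t⟩
  · right; simp
  exfalso
  rw [List.concat_eq_append, List.append_assoc, List.singleton_append] at h1 h2
  have h3 := h2.right_of_append
  rw [List.isChain_cons_cons, List.isChain_cons_cons] at h3
  have ha := huniq _ h3.1 (by simp)
  have hb := huniq _ h3.2.1 (by simp)
  rw [Sym2.eq_swap] at ha
  have ha' : a = u := Sym2.congr_right.1 ha
  have hb' : b = u := Sym2.congr_right.1 hb
  subst ha' hb'
  have h4 := h1.of_append_right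
  simp at h4

theorem reverse_mem_pathLists {E : Finset (Sym2 V)} {j : ℕ} {l : List V} (h : l ∈ pathLists E j) :
    l.reverse ∈ pathLists E j := by
  refine ⟨List.nodup_reverse.2 h.1, List.isChain_reverse.2 ?_, by simpa using h.2.2⟩
  exact h.2.1.imp fun a b hab => by rwa [Sym2.eq_swap]

/-- A path through the pendant v has v at an end. Length at least 2 excludes both ends, so reversal
pairs the lists starting and ending at v. -/
theorem ncard_pathLists_of_pendant [Fintype V] [DecidableEq V] {E : Finset (Sym2 V)} {u v : V}
    (huniq : ∀ e ∈ E, v ∈ e → e = s(v, u)) (j : ℕ) :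
    (pathLists E (j + 2)).ncard = (pathLists (E.filter (v ∉ ·)) (j + 2)).ncard +
      2 * (pathListsFrom E v (j + 2)).ncard := by
  have hmem : ∀ l ∈ pathLists (E.filter (v ∉ ·)) (j + 2), v ∉ l := by
    rintro l ⟨h1, h2, hlen⟩ hv
    match l with
    | [] => simp at hlen
    | [a] => simp at hlen
    | a :: b :: l =>
      rcases List.mem_cons.1 hv with rfl | hv
      · rw [List.isChain_cons_cons] at h2
        exact (Finset.mem_filter.1 h2.1).2 (by simp)
      · obtain ⟨e, he, hve⟩ := exists_mem_of_isChain_cons h2 hv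
        exact (Finset.mem_filter.1 he).2 hve
  have hset : pathLists E (j + 2) = pathLists (E.filter (v ∉ ·)) (j + 2) ∪
      (pathListsFrom E v (j + 2) ∪ List.reverse '' pathListsFrom E v (j + 2)) := by
    ext l
    constructor
    · intro hl
      by_cases hv : v ∈ l
      · right
        rcases head_or_getLast_of_pendant huniq hl.1 hl.2.1 hv with h | h
        · exact Or.inl ⟨hl, h⟩
        · exact Or.inr ⟨l.reverse, ⟨reverse_mem_pathLists hl, h⟩, l.reverse_reverse⟩
      · exact Or.inl ⟨hl.1, isChain_filter_of_notMem hv hl.2.1, hl.2.2⟩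
    · rintro (hl | hl | ⟨l, hl, rfl⟩)
      · exact ⟨hl.1, hl.2.1.imp fun a b hab => (Finset.mem_filter.1 hab).1, hl.2.2⟩
      · exact hl.1
      · exact reverse_mem_pathLists hl.1
  have hfin : (pathListsFrom E v (j + 2)).Finite :=
    (finite_pathLists E (j + 2)).subset fun _ h => h.1
  have hd1 : Disjoint (pathListsFrom E v (j + 2)) (List.reverse '' pathListsFrom E v (j + 2)) := by
    rw [Set.disjoint_left]
    rintro l ⟨⟨h1, -, hlen⟩, h⟩ ⟨l', ⟨-, h'⟩, rfl⟩
    match l' with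
    | [] => simp at hlen
    | a :: l' =>
      simp only [List.head?_cons, Option.some.injEq] at h'
      subst h'
      rw [List.reverse_cons] at h h1
      have hne : l'.reverse ≠ [] := by
        intro h0
        have : l' = [] := by simpa using h0
        subst this
        simp at hlen
      rw [List.head?_append_of_ne_nil _ hne] at h
      have := List.mem_of_head? h
      rw [List.nodup_append] at h1
      exact h1.2.2 a this a (by simp) rfl
  have hd2 : Disjoint (pathLists (E.filter (v ∉ ·)) (j + 2))
      (pathListsFrom E v (j + 2) ∪ List.reverse '' pathListsFrom E v (j + 2)) := by
    rw [Set.disjoint_left]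
    rintro l hl (⟨-, h⟩ | ⟨l', ⟨-, h⟩, rfl⟩)
    · exact hmem l hl (List.mem_of_head? h)
    · exact hmem _ hl (List.mem_reverse.2 (List.mem_of_head? h))
  rw [hset, Set.ncard_union_eq hd2 (finite_pathLists _ _) (hfin.union (hfin.image _)),
    Set.ncard_union_eq hd1 hfin (hfin.image _),
    Set.ncard_image_of_injective _ List.reverse_injective]
  omega

end PathLists

/-! ### Matching series of paths -/

/-- The matching generating series of the path of order `n`. -/
noncomputable def pathMatchingSeries : ℕ → PowerSeries ℝ
  | 0 => 1
  | 1 => 1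
  | n + 2 => pathMatchingSeries (n + 1) + PowerSeries.X * pathMatchingSeries n

theorem pathMatchingSeries_add_two (n : ℕ) : pathMatchingSeries (n + 2) =
    pathMatchingSeries (n + 1) + PowerSeries.X * pathMatchingSeries n := rfl

theorem constantCoeff_pathMatchingSeries (n : ℕ) :
    PowerSeries.constantCoeff (pathMatchingSeries n) = 1 := by
  induction n using Nat.twoStepInduction with
  | zero => simp [pathMatchingSeries]
  | one => simp [pathMatchingSeries]
  | more n _ ih => simp [pathMatchingSeries_add_two, ih]

theorem pathMatchingSeries_ne_zero (n : ℕ) : pathMatchingSeries n ≠ 0 := by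
  intro h
  have := constantCoeff_pathMatchingSeries n
  simp [h] at this

theorem pathMatchingSeries_mul_inv (n : ℕ) :
    pathMatchingSeries n * (pathMatchingSeries n)⁻¹ = 1 :=
  PowerSeries.mul_inv_cancel _ (by rw [constantCoeff_pathMatchingSeries]; exact one_ne_zero)

/-- The Cassini identity of the recurrence: each step multiplies the determinant by -X. Dividing by
the square gives the leading term of `subpathFactor`. -/
theorem pathMatchingSeries_cassini (j : ℕ) :
    pathMatchingSeries (j + 2) * pathMatchingSeries j =
      pathMatchingSeries (j + 1) ^ 2 + PowerSeries.X ^ (j + 1) * (-1) ^ j := by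
  induction j with
  | zero => simp [pathMatchingSeries]
  | succ j ih =>
    rw [pathMatchingSeries_add_two (j + 1)]
    have := pathMatchingSeries_add_two j
    rw [pow_succ _ (j + 1), pow_succ (-1 : PowerSeries ℝ) j]
    linear_combination (-PowerSeries.X) * ih + (-pathMatchingSeries (j + 2)) * this

/-- The factor contributed by each subpath of order `j + 2`. -/
noncomputable def subpathFactor (j : ℕ) : PowerSeries ℝ :=
  pathMatchingSeries (j + 2) * pathMatchingSeries j * ((pathMatchingSeries (j + 1))⁻¹) ^ 2

theorem hasLeadingTerm_subpathFactor (j : ℕ) :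
    HasLeadingTerm (j + 1) (subpathFactor j) ((-1) ^ j) := by
  refine ⟨(-1) ^ j * ((pathMatchingSeries (j + 1))⁻¹) ^ 2, ?_, ?_⟩
  · rw [subpathFactor, pathMatchingSeries_cassini]
    linear_combination (pathMatchingSeries (j + 1) * (pathMatchingSeries (j + 1))⁻¹ + 1) *
      pathMatchingSeries_mul_inv (j + 1)
  · simp [PowerSeries.constantCoeff_inv, constantCoeff_pathMatchingSeries]

/-- `subpathFactor` is the quotient of consecutive ratios of the series, so its products telescope.
-/
theorem pathMatchingSeries_mul_prod (k : ℕ) :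
    pathMatchingSeries k * ∏ j ∈ Finset.range k, subpathFactor j = pathMatchingSeries (k + 1) := by
  induction k with
  | zero => simp [pathMatchingSeries]
  | succ k ih =>
    refine mul_left_cancel₀ (pathMatchingSeries_ne_zero k) ?_
    rw [Finset.prod_range_succ]
    have h := pathMatchingSeries_mul_inv (k + 1)
    have h2 : pathMatchingSeries (k + 1) ^ 2 * subpathFactor k =
        pathMatchingSeries (k + 2) * pathMatchingSeries k := by
      rw [subpathFactor]
      linear_combination (pathMatchingSeries (k + 2) * pathMatchingSeries k) *
        (pathMatchingSeries (k + 1) * (pathMatchingSeries (k + 1))⁻¹ + 1) * h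
    linear_combination (pathMatchingSeries (k + 1) * subpathFactor k) * ih + h2

/-! ### Matching series of linear forests -/

section LinearForest

variable {V : Type*} [Fintype V] [DecidableEq V]

/-- Here v is an end of a path component with m edges, possibly none. Exactly one path from v exists
for each order up to m + 1, and removing v shortens the component from order m + 1 to m. -/
theorem exists_pendant_path {E : Finset (Sym2 V)} (hdiag : ∀ e ∈ E, ¬ e.IsDiag)
    (hdeg : ∀ v, (E.filter (v ∈ ·)).card ≤ 2) {v : V} (hv : (E.filter (v ∈ ·)).card ≤ 1) :
    ∃ m, (∀ j, (pathListsFrom E v (j + 1)).ncard = if j ≤ m then 1 else 0) ∧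
      (matchingPolynomial E : PowerSeries ℝ) * pathMatchingSeries m =
        (matchingPolynomial (E.filter (v ∉ ·)) : PowerSeries ℝ) * pathMatchingSeries (m + 1) := by
  induction hn : E.card using Nat.strong_induction_on generalizing E v with
  | _ n ih =>
  rcases Nat.le_one_iff_eq_zero_or_eq_one.1 hv with h0 | h1
  · have hiso : ∀ e ∈ E, v ∉ e := by
      intro e he hve
      rw [Finset.card_eq_zero, Finset.filter_eq_empty_iff] at h0
      exact h0 he hve
    refine ⟨0, fun j => ?_, ?_⟩
    · rcases j with _ | j
      · rw [pathListsFrom_one, Set.ncard_singleton, if_pos le_rfl]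
      · rw [pathListsFrom_of_isolated hiso (by omega), Set.ncard_empty, if_neg (by omega)]
    · rw [Finset.filter_true_of_mem hiso]
      rfl
  · obtain ⟨e₀, he₀⟩ := Finset.card_eq_one.1 h1
    have hmem : e₀ ∈ E.filter (v ∈ ·) := by rw [he₀]; exact Finset.mem_singleton_self _
    obtain ⟨he₀E, hve₀⟩ := Finset.mem_filter.1 hmem
    obtain ⟨u, rfl⟩ := Sym2.mem_iff_exists.1 hve₀
    have huv : u ≠ v := fun h => hdiag _ he₀E (by simp [h])
    have huniq : ∀ e ∈ E, v ∈ e → e = s(v, u) := fun e he hve => by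
      have : e ∈ E.filter (v ∈ ·) := Finset.mem_filter.2 ⟨he, hve⟩
      rwa [he₀, Finset.mem_singleton] at this
    set E₁ := E.filter (v ∉ ·) with hE₁
    have hsub : E₁ ⊆ E := Finset.filter_subset _ _
    have hlt : E₁.card < n := by
      rw [← hn]
      refine Finset.card_lt_card ((Finset.ssubset_iff_of_subset hsub).2 ⟨_, he₀E, ?_⟩)
      simp [hE₁]
    -- Losing the edge to v makes u an end of its component, so the induction continues along the
    -- path.
    have hu : (E₁.filter (u ∈ ·)).card ≤ 1 := by
      have hss : E₁.filter (u ∈ ·) ⊂ E.filter (u ∈ ·) := by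
        refine (Finset.ssubset_iff_of_subset (Finset.filter_subset_filter _ hsub)).2
          ⟨s(v, u), by simp [he₀E], by simp [hE₁]⟩
      have := Finset.card_lt_card hss
      have := hdeg u
      omega
    obtain ⟨m, hm1, hm2⟩ := ih _ hlt (fun e he => hdiag e (hsub he))
      (fun w => (Finset.card_le_card (Finset.filter_subset_filter _ hsub)).trans (hdeg w)) hu rfl
    refine ⟨m + 1, fun j => ?_, ?_⟩
    · rcases j with _ | j
      · rw [pathListsFrom_one, Set.ncard_singleton, if_pos (by omega)]
      · rw [pathListsFrom_of_pendant huv he₀E huniq,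
          Set.ncard_image_of_injective _ (List.cons_injective), hm1]
        simp only [Nat.add_le_add_iff_right]
    · have hrec := congrArg (fun p : Polynomial ℝ => (p : PowerSeries ℝ))
        (matchingPolynomial_of_pendant huv he₀E huniq)
      simp only [Polynomial.coe_add, Polynomial.coe_mul, Polynomial.coe_X] at hrec
      rw [hrec, pathMatchingSeries_add_two]
      linear_combination (-PowerSeries.X) * hm2

/-- The matching generating series of a linear forest as a product over its subpaths. -/
theorem matchingPolynomial_sq {E : Finset (Sym2 V)} (hdiag : ∀ e ∈ E, ¬ e.IsDiag)
    (hdeg : ∀ v, (E.filter (v ∈ ·)).card ≤ 2)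
    (hE : (SimpleGraph.fromEdgeSet (E : Set (Sym2 V))).IsAcyclic) :
    (matchingPolynomial E : PowerSeries ℝ) ^ 2 = ∏ j ∈ Finset.range (Fintype.card V),
      subpathFactor j ^ (pathLists E (j + 2)).ncard := by
  induction hn : E.card using Nat.strong_induction_on generalizing E with
  | _ n ih =>
  rcases E.eq_empty_or_nonempty with rfl | ⟨e, he⟩
  · have h1 : ∀ j, pathLists (∅ : Finset (Sym2 V)) (j + 2) = ∅ := by
      intro j
      rw [Set.eq_empty_iff_forall_notMem]
      rintro l ⟨-, h, hlen⟩
      match l with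
      | [] => simp at hlen
      | [a] => simp at hlen
      | a :: b :: l => simp at h
    have h2 : matchingPolynomial (∅ : Finset (Sym2 V)) = 1 := by
      rw [matchingPolynomial, Finset.powerset_empty, Finset.filter_singleton,
        if_pos (by simp [coveredVertices]), Finset.sum_singleton]
      simp
    simp [h1, h2]
  · induction e with | _ a b => ?_
    have hab : a ≠ b := fun h => hdiag _ he (by simp [h])
    obtain ⟨v, u, hvu, huniq'⟩ := exists_existsUnique_adj_of_isAcyclic hE
      ((fromEdgeSet_adj _).2 ⟨he, hab⟩)
    have heE : s(v, u) ∈ E := ((fromEdgeSet_adj _).1 hvu).1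
    have huniq : ∀ e ∈ E, v ∈ e → e = s(v, u) := by
      intro e he hve
      obtain ⟨w, rfl⟩ := Sym2.mem_iff_exists.1 hve
      rw [huniq' w ((fromEdgeSet_adj _).2 ⟨he, fun h => hdiag _ he (by simp [h])⟩)]
    have hdegv : (E.filter (v ∈ ·)).card ≤ 1 := by
      rw [Finset.card_le_one]
      intro e he e' he'
      rw [Finset.mem_filter] at he he'
      rw [huniq e he.1 he.2, huniq e' he'.1 he'.2]
    obtain ⟨m, hm1, hm2⟩ := exists_pendant_path hdiag hdeg hdegv
    set E₁ := E.filter (v ∉ ·) with hE₁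
    have hsub : E₁ ⊆ E := Finset.filter_subset _ _
    have hlt : E₁.card < n := by
      rw [← hn]
      refine Finset.card_lt_card ((Finset.ssubset_iff_of_subset hsub).2 ⟨_, heE, ?_⟩)
      simp [hE₁]
    have hih := ih _ hlt (fun e he => hdiag e (hsub he))
      (fun w => (Finset.card_le_card (Finset.filter_subset_filter _ hsub)).trans (hdeg w))
      (hE.anti (fromEdgeSet_mono (by exact_mod_cast hsub))) rfl
    -- Removing v divides the series by one factor for each order 2 to m + 1. Exactly one path from
    -- v has each such order; squaring matches its two directions in `pathLists`.
    have hM : (matchingPolynomial E : PowerSeries ℝ) =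
        (matchingPolynomial E₁ : PowerSeries ℝ) * ∏ j ∈ Finset.range m, subpathFactor j := by
      refine mul_right_cancel₀ (pathMatchingSeries_ne_zero m) ?_
      rw [hm2, ← pathMatchingSeries_mul_prod m]
      ring
    have hmcard : m ≤ Fintype.card V := by
      by_contra! hlt
      have h1 := hm1 m
      have hss : pathListsFrom E v (m + 1) ⊆ pathLists E (m + 1) := fun _ h => h.1
      rw [pathLists_eq_empty E (by omega)] at hss
      have h2 : pathListsFrom E v (m + 1) = ∅ := Set.subset_empty_iff.1 hss
      rw [h2, Set.ncard_empty, if_pos le_rfl] at h1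
      omega
    have hprod : ∏ j ∈ Finset.range m, subpathFactor j = ∏ j ∈ Finset.range (Fintype.card V),
        subpathFactor j ^ (pathListsFrom E v (j + 2)).ncard := by
      rw [← Finset.prod_subset (Finset.range_subset_range.2 hmcard)]
      · refine Finset.prod_congr rfl fun j hj => ?_
        rw [hm1 (j + 1), if_pos (by have := Finset.mem_range.1 hj; omega), pow_one]
      · intro j _ hj
        rw [hm1 (j + 1), if_neg (by rw [Finset.mem_range] at hj; omega), pow_zero]
    rw [hM, mul_pow, hih, hprod, ← Finset.prod_pow, ← Finset.prod_mul_distrib]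
    refine Finset.prod_congr rfl fun j _ => ?_
    rw [ncard_pathLists_of_pendant huniq, pow_add, ← pow_mul, mul_comm _ 2]

end LinearForest

/-! ### Paths with constant labels -/

theorem card_labeledCopy_path_one {V : Type*} [Fintype V] (T : SimpleGraph V)
    [DecidableRel T.Adj] (a : ℕ) :
    Nat.card (LabeledCopy (pathGraph 1) (fun _ => a) T) =
      (Finset.univ.filter (fun v => T.degree v = a)).card := by
  rw [← Fintype.card_subtype, ← Nat.card_eq_fintype_card]
  exact Nat.card_congr
    { toFun := fun f => ⟨f.1 0, (f.2.2.2 0).symm⟩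
      invFun := fun v => ⟨fun _ => v.1, Function.injective_of_subsingleton _,
        fun i j h => absurd (Subsingleton.elim i j) h.ne, fun _ => v.2.symm⟩
      left_inv := fun f => Subtype.ext (funext fun i => congrArg f.1 (Subsingleton.elim 0 i))
      right_inv := fun _ => rfl }

section Paths

variable {V : Type*} [Fintype V] [DecidableEq V] (T : SimpleGraph V) [DecidableRel T.Adj]

theorem mem_degreeEdges {a : ℕ} {u v : V} : s(u, v) ∈ degreeEdges T a ↔
    T.Adj u v ∧ T.degree u = a ∧ T.degree v = a := by
  simp [degreeEdges]

theorem card_degreeEdges_filter_le (a : ℕ) (v : V) :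
    ((degreeEdges T a).filter (v ∈ ·)).card ≤ a := by
  rcases ((degreeEdges T a).filter (v ∈ ·)).eq_empty_or_nonempty with h | ⟨e, he⟩
  · simp [h]
  · obtain ⟨h1, h2⟩ := Finset.mem_filter.1 he
    rw [← (Finset.mem_filter.1 h1).2 v h2, ← card_incidenceFinset_eq_degree,
      incidenceFinset_eq_filter]
    exact Finset.card_le_card (Finset.filter_subset_filter _ (Finset.filter_subset _ _))

theorem matchingPolynomial_degreeEdges_sq (hT : T.IsAcyclic) :
    (matchingPolynomial (degreeEdges T 2) : PowerSeries ℝ) ^ 2 =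
      ∏ j ∈ Finset.range (Fintype.card V),
        subpathFactor j ^ (pathLists (degreeEdges T 2) (j + 2)).ncard := by
  refine matchingPolynomial_sq (fun e he => ?_) (card_degreeEdges_filter_le T 2) (hT.anti ?_)
  · exact T.not_isDiag_of_mem_edgeFinset (Finset.mem_filter.1 he).1
  · intro u v h
    exact ((mem_degreeEdges T).1 ((fromEdgeSet_adj _).1 h).1).1

/-- The degree condition is carried by the edges, so every vertex must lie on one; hence order at
least 2, with order 1 counted separately. -/
theorem card_labeledCopy_path (a j : ℕ) :
    Nat.card (LabeledCopy (pathGraph (j + 2)) (fun _ => a) T) =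
      (pathLists (degreeEdges T a) (j + 2)).ncard := by
  rw [← Nat.card_coe_set_eq]
  let F : LabeledCopy (pathGraph (j + 2)) (fun _ => a) T →
      pathLists (degreeEdges T a) (j + 2) := fun f => ⟨List.ofFn f.1, List.nodup_ofFn.2 f.2.1,
    List.isChain_ofFn.2 fun i hi => (mem_degreeEdges T).2
      ⟨f.2.2.1 _ _ (by simp [pathGraph_adj]), (f.2.2.2 _).symm, (f.2.2.2 _).symm⟩,
    List.length_ofFn⟩
  refine Nat.card_congr (Equiv.ofBijective F ⟨fun f g h => ?_, ?_⟩)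
  · exact Subtype.ext (List.ofFn_injective (congrArg Subtype.val h))
  · rintro ⟨l, h1, h2, hlen⟩
    obtain ⟨f, rfl⟩ : ∃ f : Fin (j + 2) → V, List.ofFn f = l :=
      ⟨fun i => l.get (i.cast hlen.symm), List.ext_getElem (by simp [hlen]) fun i h₁ h₂ => by
        rw [List.getElem_ofFn]; rfl⟩
    rw [List.isChain_ofFn] at h2
    have h3 : ∀ i (hi : i + 1 < j + 2), T.Adj (f ⟨i, by omega⟩) (f ⟨i + 1, hi⟩) ∧
        T.degree (f ⟨i, by omega⟩) = a ∧ T.degree (f ⟨i + 1, hi⟩) = a := fun i hi =>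
      (mem_degreeEdges T).1 (h2 i hi)
    refine ⟨⟨f, List.nodup_ofFn.1 h1, ?_, ?_⟩, rfl⟩
    · rintro ⟨u, hu⟩ ⟨v, hv⟩ h
      rw [pathGraph_adj] at h
      rcases h with h | h
      · simp only at h
        subst h
        exact (h3 u hv).1
      · simp only at h
        subst h
        exact (h3 v hu).1.symm
    · rintro ⟨u, hu⟩
      rcases Nat.lt_or_ge (u + 1) (j + 2) with h | h
      · exact (h3 u h).2.1.symm
      · obtain ⟨w, rfl⟩ : ∃ w, u = w + 1 := ⟨u - 1, by omega⟩
        exact (h3 w hu).2.2.symm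

theorem card_labeledCopy_path_all_two_eq {V₁ V₂ : Type*}
    [Fintype V₁] [DecidableEq V₁] [Fintype V₂] [DecidableEq V₂]
    {T₁ : SimpleGraph V₁} [DecidableRel T₁.Adj] {T₂ : SimpleGraph V₂} [DecidableRel T₂.Adj]
    (hT₁ : T₁.IsAcyclic) (hT₂ : T₂.IsAcyclic) (h : subsetProfile T₁ = subsetProfile T₂)
    {m : ℕ} (hm : 0 < m) :
    Nat.card (LabeledCopy (pathGraph m) (fun _ => 2) T₁) =
      Nat.card (LabeledCopy (pathGraph m) (fun _ => 2) T₂) := by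
  match m, hm with
  | 1, _ =>
    rw [card_labeledCopy_path_one, card_labeledCopy_path_one, card_degree_eq h]
  | j + 2, _ =>
    rw [card_labeledCopy_path, card_labeledCopy_path]
    have hcard := card_eq_of_subsetProfile_eq h
    rcases Nat.lt_or_ge j (Fintype.card V₁) with hj | hj
    · have h1 := matchingPolynomial_degreeEdges_sq T₁ hT₁
      rw [matchingPolynomial_degreeEdges_eq h, matchingPolynomial_degreeEdges_sq T₂ hT₂,
        ← hcard] at h1
      exact (exponent_eq_of_prod_pow_eq (fun j _ => hasLeadingTerm_subpathFactor j)
        (fun j _ => pow_ne_zero _ (neg_ne_zero.2 one_ne_zero)) h1 j hj).symm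
    · rw [pathLists_eq_empty _ (by omega), pathLists_eq_empty _ (by omega),
        Set.ncard_empty, Set.ncard_empty]

end Paths

/-! ### The main theorem -/

theorem mainTheorem1 {V₁ V₂ : Type*}
    [Fintype V₁] [DecidableEq V₁] [Fintype V₂] [DecidableEq V₂]
    (T₁ : SimpleGraph V₁) [DecidableRel T₁.Adj] (T₂ : SimpleGraph V₂) [DecidableRel T₂.Adj]
    (hT₁ : T₁.IsTree) (hT₂ : T₂.IsTree) :
    ((generalizedDegreePolynomial T₁ = generalizedDegreePolynomial T₂ ∨
        chromaticSymmetricFunction T₁ = chromaticSymmetricFunction T₂) →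
      -- (i) paths of order 2
      (∀ a b : ℕ, 0 < a → 0 < b →
        pathEmbeddingNumber ![a, b] T₁ = pathEmbeddingNumber ![a, b] T₂) ∧
      -- (ii) paths of order 3 with all labels equal
      (∀ a : ℕ, 0 < a →
        pathEmbeddingNumber ![a, a, a] T₁ = pathEmbeddingNumber ![a, a, a] T₂) ∧
      -- (iii) paths of order 3 labeled a, a, b with b ≥ 2a
      (∀ a b : ℕ, 0 < a → 2 * a ≤ b →
        pathEmbeddingNumber ![a, a, b] T₁ = pathEmbeddingNumber ![a, a, b] T₂) ∧
      -- (iv) paths with every label 2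
      (∀ m : ℕ, 0 < m →
        pathEmbeddingNumber (fun _ : Fin m => 2) T₁ =
          pathEmbeddingNumber (fun _ : Fin m => 2) T₂) ∧
      -- (v) stars with outer vertices labeled 1, and the leaf adjacency sequence
      (∀ d k : ℕ, 0 < d → starEmbeddingNumber d k T₁ = starEmbeddingNumber d k T₂) ∧
      (∀ d l : ℕ, leafAdjacencyNumber T₁ d l = leafAdjacencyNumber T₂ d l)) ∧
    -- the two kinds of numbers in (v) determine each other
    (∀ d : ℕ, 0 < d →
      ((∀ k : ℕ, starEmbeddingNumber d k T₁ = starEmbeddingNumber d k T₂) ↔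
        (∀ l : ℕ, leafAdjacencyNumber T₁ d l = leafAdjacencyNumber T₂ d l))) := by
  refine ⟨fun h => ?_, fun d _ => starEmbeddingNumber_eq_iff hT₁.isAcyclic hT₂.isAcyclic d⟩
  have hp : subsetProfile T₁ = subsetProfile T₂ := h.elim
    subsetProfile_eq_of_generalizedDegreePolynomial_eq
    (subsetProfile_eq_of_chromaticSymmetricFunction_eq hT₁ hT₂)
  have key : ∀ (m : ℕ) (a : Fin (m + 1) → ℕ), Nat.card (LabeledCopy (pathGraph (m + 1)) a T₁) =
      Nat.card (LabeledCopy (pathGraph (m + 1)) a T₂) →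
      pathEmbeddingNumber a T₁ = pathEmbeddingNumber a T₂ := fun m a =>
    (degreeEmbeddingNumber_eq_of_card_labeledCopy_eq (pathGraph_connected m)
      hT₁.isAcyclic hT₂.isAcyclic).2
  refine ⟨fun a b _ _ => key 1 _ ?_, fun a _ => key 2 _ ?_, fun a b ha hab => key 2 _ ?_,
    fun m hm => ?_, fun d k _ => ?_, leafAdjacencyNumber_eq hT₁ hT₂ hp⟩
  · rw [card_labeledCopy_path_two, card_labeledCopy_path_two, edgeLabelCount_eq hp]
  · rw [card_labeledCopy_path_three, card_labeledCopy_path_three, pathLabelCount_self_eq hp]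
  · rw [card_labeledCopy_path_three, card_labeledCopy_path_three,
      pathLabelCount_self_right_eq hp ha hab]
  · obtain ⟨k, rfl⟩ : ∃ k, m = k + 1 := ⟨m - 1, by omega⟩
    exact key k _ (card_labeledCopy_path_all_two_eq hT₁.isAcyclic hT₂.isAcyclic hp hm)
  · exact (starEmbeddingNumber_eq_iff hT₁.isAcyclic hT₂.isAcyclic d).2
      (leafAdjacencyNumber_eq hT₁ hT₂ hp d) k
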